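/- **Setting.** Let $\mathbb K\in\{\mathbb R,\mathbb C\}$ and let $Z=(Z_0,\dots,Z_{N-1})$ be a random vector on a probability space with independent components, each of which is standard normally distributed, Gamma distributed with rate $1$ (density $\Gamma(a+1)^{-1}x^{a}e^{-x}$ on $(0,\infty)$, $a>-1$), or Beta distributed (density proportional to $(1-x)^{a}(1+x)^{b}$ on $(-1,1)$, $a,b>-1$). Let $\mathbb P_Z$ be its law on $\mathbb R^N$ and let $U$ be the open box on which $\mathbb P_Z$ has a positive density, the product of the intervals $\mathbb R$, $(0,\infty)$, $(-1,1)$, respectively. Put $\rho(z)_j=z_j$ if $Z_j$ is Gamma distributed, $\rho(z)_j=1$ otherwise, and $\rho(z)^{\alpha/2}=\prod_j\rho(z)_j^{\alpha_j/2}$ for $\alpha\in\mathbb N_0^N$. For a Hilbert space $X$ and $q\in\mathbb N_0$ let $H^q_\rho(\mathbb R^N,\mathbb P_Z;X)$ be the space of all $f\in L_2(\mathbb R^N,\mathbb P_Z;X)$ whose weak derivatives $\partial^\alpha f$ on $U$ exist and satisfy $\rho^{\alpha/2}\partial^\alpha f\in L_2(\mathbb R^N,\mathbb P_Z;X)$ for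 all $|\alpha|\le q$, with $\|f\|^2=\sum_{|\alpha|\le q}\|\rho^{\alpha/2}\partial^\alpha f\|^2_{L_2(\mathbb R^N,\mathbb P_Z;X)}$. Let $V,H$ be separable Hilbert spaces over $\mathbb K$ with $V\hookrightarrow H$ dense, and for $z\in\mathbb R^N$ let $a_z\colon V\times V\to\mathbb K$ be sesquilinear forms such that, for some $K,\kappa>0$ and $\mathbb P_Z$-a.e. $z$, $|a_z(u,v)|\le K\|u\|_V\|v\|_V$, $\operatorname{Re}a_z(u,u)\ge\kappa\|u\|_V^2$ and $a_z(u,v)=\overline{a_z(v,u)}$ for all $u,v\in V$. Let $A_z$ be the operator in $H$ associated with $a_z$, that is, $u\in\operatorname{dom}(A_z)$ and $A_zu=y$ iff $u\in V$ and $a_z(u,v)=(y\mid v)_H$ for all $v\in V$. Suppose that there is a Hilbert space $D\hookrightarrow H$ such that $\operatorname{dom}(A_z)=D$ for $\mathbb P_Z$-a.e. $z$ and the graph norms of $A_z$ are equivalent to $\|\cdot\|_D$ with constants independent of $z$. Let $\ell\in\mathbb N_0$ and suppose that $z\mapsto a_z(u,v)$ is in $C^\ell(\mathbb R^N)$ for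 all $u,v\in V$ and that there is $C_\ell\ge0$ with $$|\rho(z)^{\alpha/2}\,\partial_z^\alpha a_z(u,v)|\le C_\ell\|u\|_D\|v\|_H$$ for $\mathbb P_Z$-a.e. $z$, all $u\in D$, $v\in V$ and $|\alpha|\le\ell$. Let $\mathbf H=L_2(\mathbb R^N,\mathbb P_Z;H)$ and let $\mathbf A$ be the operator in $\mathbf H$ with $(\mathbf Af)(z)=A_zf(z)$, whose domain consists of all $f\in\mathbf H$ with $f(z)\in\operatorname{dom}(A_z)$ for a.e. $z$ and $[z\mapsto A_zf(z)]\in\mathbf H$. For $\eta\in(\frac\pi2,\pi)$ and $r>0$ let $\gamma_r=\{se^{-i\eta}:s>r\}\cup\{re^{i\varphi}:-\eta<\varphi<\eta\}\cup\{se^{i\eta}:s>r\}\subset\mathbb C$. **Proposition.** The operator $-\mathbf A$ generates a $C_0$-semigroup $(\mathbf T(t))_{t\ge0}$ on $\mathbf H$, and $\lambda+\mathbf A\colon\operatorname{dom}(\mathbf A)\to\mathbf H$ is bijective for every $\lambda\in\gamma_r$. For all $q\in\{0,\dots,\ell\}$, $\eta\in(\frac\pi2,\pi)$, $r>0$ and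 $\bar T>0$ there are constants $C_q$, $C_{q,r}=C_{q,r,\eta}$, $C_{\bar T,q}\ge0$ such that the following holds. (a) If $\mathbf f\in H^q_\rho(\mathbb R^N,\mathbb P_Z;D)$, then $\mathbf f\in\operatorname{dom}(\mathbf A)$, $\mathbf A\mathbf f\in H^q_\rho(\mathbb R^N,\mathbb P_Z;H)$ and $\|\mathbf A\mathbf f\|_{H^q_\rho(\mathbb R^N,\mathbb P_Z;H)}\le C_q\|\mathbf f\|_{H^q_\rho(\mathbb R^N,\mathbb P_Z;D)}$. In particular, $\|\mathbf A\mathbf f\|_{\mathbf H}\le C_0\|\mathbf f\|_{L_2(\mathbb R^N,\mathbb P_Z;D)}$ for $\mathbf f\in L_2(\mathbb R^N,\mathbb P_Z;D)$. (b) If $\mathbf f\in H^q_\rho(\mathbb R^N,\mathbb P_Z;H)$ and $\lambda\in\gamma_r$, then $(\lambda+\mathbf A)^{-1}\mathbf f\in H^q_\rho(\mathbb R^N,\mathbb P_Z;D)$ and $\|(\lambda+\mathbf A)^{-1}\mathbf f\|_{H^q_\rho(\mathbb R^N,\mathbb P_Z;D)}\le C_{q,r}\|\mathbf f\|_{H^q_\rho(\mathbb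 R^N,\mathbb P_Z;H)}$. In particular, $\|(\lambda+\mathbf A)^{-1}\mathbf f\|_{L_2(\mathbb R^N,\mathbb P_Z;D)}\le C_{0,r}\|\mathbf f\|_{\mathbf H}$ for $\mathbf f\in\mathbf H$. (If $\mathbb K=\mathbb R$, the resolvent at non-real $\lambda$ is that of the complexification of $\mathbf A$, and $\mathbf f$ may be taken in the complexified space.) (c) If $\mathbf f\in H^q_\rho(\mathbb R^N,\mathbb P_Z;H)$ and $t\in[0,\bar T]$, then $\mathbf T(t)\mathbf f\in H^q_\rho(\mathbb R^N,\mathbb P_Z;H)$ and $\|\mathbf T(t)\mathbf f\|_{H^q_\rho(\mathbb R^N,\mathbb P_Z;H)}\le C_{\bar T,q}\|\mathbf f\|_{H^q_\rho(\mathbb R^N,\mathbb P_Z;H)}$. (d) If $\mathbf f\in H^q_\rho(\mathbb R^N,\mathbb P_Z;H)$ and $0<\tau\le\bar T$, then $\mathbf T(\tau)\mathbf f\in\operatorname{dom}(\mathbf A)$, $\tau\mathbf A\mathbf T(\tau)\mathbf f\in H^q_\rho(\mathbb R^N,\mathbb P_Z;H)$ and $\|\tau\mathbf A\mathbf T(\tau)\mathbf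 f\|_{H^q_\rho(\mathbb R^N,\mathbb P_Z;H)}\le C_{\bar T,q}\|\mathbf f\|_{H^q_\rho(\mathbb R^N,\mathbb P_Z;H)}$. -/

import Mathlib

open MeasureTheory ProbabilityTheory Set Filter Topology
open scoped ENNReal NNReal

namespace RandomEvolution

/-! ### The noise -/

/-- The admissible laws of one noise component. The Gamma law has shape `a + 1` and rate `1`; the
Beta law with parameters `a, b` lives on `(-1, 1)`. -/
inductive NoiseLaw
  | normal
  | gamma (a : ℝ) (ha : -1 < a)
  | beta (a b : ℝ) (ha : -1 < a) (hb : -1 < b)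

/-- The probability measure on `ℝ` described by a `NoiseLaw`. -/
noncomputable def NoiseLaw.measure : NoiseLaw → Measure ℝ
  | .normal => gaussianReal 0 1
  | .gamma a _ => gammaMeasure (a + 1) 1
  | .beta a b _ _ => volume.withDensity ((Ioo (-1 : ℝ) 1).indicator fun x =>
      ENNReal.ofReal (Real.Gamma (a + b + 2) /
        ((2 : ℝ) ^ (a + b + 1) * Real.Gamma (a + 1) * Real.Gamma (b + 1)) *
          ((1 - x) ^ a * (1 + x) ^ b)))

/-- The open interval on which the law has a positive density. -/
def NoiseLaw.interval : NoiseLaw → Set ℝ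
  | .normal => univ
  | .gamma _ _ => Ioi 0
  | .beta _ _ _ _ => Ioo (-1) 1

/-- One component of the weight: `z` for a Gamma law and `1` otherwise. -/
def NoiseLaw.weight : NoiseLaw → ℝ → ℝ
  | .gamma _ _ => fun x => x
  | _ => fun _ => 1

variable {N : ℕ}

/-- The open box that carries the product law. -/
def box (law : Fin N → NoiseLaw) : Set (Fin N → ℝ) :=
  Set.univ.pi fun j => (law j).interval

/-- `ρ(z) ^ (α / 2) = ∏ j, ρ(z)_j ^ (α_j / 2)`. -/
noncomputable def rhoPow (law : Fin N → NoiseLaw) (α : Fin N → ℕ) (z : Fin N → ℝ) : ℝ :=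
  ∏ j, (law j).weight (z j) ^ ((α j : ℝ) / 2)

/-! ### Classical and weak partial derivatives -/

/-- The classical partial derivative in the `j`-th coordinate. -/
noncomputable def coordDeriv {F : Type*} [NormedAddCommGroup F] [NormedSpace ℝ F] (j : Fin N)
    (f : (Fin N → ℝ) → F) : (Fin N → ℝ) → F :=
  fun z => fderiv ℝ f z (Pi.single j 1)

/-- The classical partial derivative `∂^α f = ∂_0^{α_0} ⋯ ∂_{N-1}^{α_{N-1}} f`; used only for
functions that are `|α|` times continuously differentiable. -/
noncomputable def partialDeriv {F : Type*} [NormedAddCommGroup F] [NormedSpace ℝ F]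
    (α : Fin N → ℕ) (f : (Fin N → ℝ) → F) : (Fin N → ℝ) → F :=
  (List.finRange N).foldr (fun j g => (coordDeriv j)^[α j] g) f

/-- The order `|α|` of a multi-index. -/
def order (α : Fin N → ℕ) : ℕ := ∑ j, α j

/-- The finite set of multi-indices `α` with `|α| ≤ q`. -/
def multiIndices (N q : ℕ) : Finset (Fin N → ℕ) :=
  (Finset.Iic fun _ : Fin N => q).filter fun α => order α ≤ q

section Sobolev

variable (𝕜 : Type*) [RCLike 𝕜] {X : Type*} [NormedAddCommGroup X] [InnerProductSpace 𝕜 X]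

/-- `g` is the weak derivative `∂^α f` of the `X`-valued function `f` on the open set `U`. The
identity `∫ ∂^α φ • f = (-1) ^ |α| ∫ φ • g` in `X` is tested against all vectors `x : X`. -/
def IsWeakPartial (U : Set (Fin N → ℝ)) (α : Fin N → ℕ) (f g : (Fin N → ℝ) → X) : Prop :=
  LocallyIntegrableOn f U volume ∧ LocallyIntegrableOn g U volume ∧
    ∀ φ : (Fin N → ℝ) → ℝ, ContDiff ℝ ((⊤ : ℕ∞) : WithTop ℕ∞) φ → HasCompactSupport φ → tsupport φ ⊆ U → ∀ x : X,
      ∫ z in U, ((partialDeriv α φ z : ℝ) : 𝕜) * inner 𝕜 x (f z) =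
        (-1) ^ order α * ∫ z in U, ((φ z : ℝ) : 𝕜) * inner 𝕜 x (g z)

open Classical in
/-- A representative of the weak derivative `∂^α f` on `U`, which is unique up to Lebesgue null
sets of `U` (and zero if there is none). -/
noncomputable def weakPartial (U : Set (Fin N → ℝ)) (α : Fin N → ℕ) (f : (Fin N → ℝ) → X) :
    (Fin N → ℝ) → X :=
  if h : ∃ g, IsWeakPartial 𝕜 U α f g then h.choose else 0

variable (law : Fin N → NoiseLaw) (μ : Measure (Fin N → ℝ))

/-- `f` belongs to the weighted Sobolev space `H_ρ^q(ℝ^N, μ; X)`: all weak derivatives `∂^α f` with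
`|α| ≤ q` exist on the box that carries `μ`, and `ρ ^ (α / 2) ∂^α f ∈ L₂(μ; X)`. -/
def MemSobolev (q : ℕ) (f : (Fin N → ℝ) → X) : Prop :=
  ∀ α : Fin N → ℕ, order α ≤ q → ∃ g : (Fin N → ℝ) → X,
    IsWeakPartial 𝕜 (box law) α f g ∧ MemLp (fun z => (rhoPow law α z : 𝕜) • g z) 2 μ

/-- The norm of `H_ρ^q(ℝ^N, μ; X)`, used only for members of that space. -/
noncomputable def sobolevNorm (q : ℕ) (f : (Fin N → ℝ) → X) : ℝ :=
  √(∑ α ∈ multiIndices N q,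
    (eLpNorm (fun z => (rhoPow law α z : 𝕜) • weakPartial 𝕜 (box law) α f z) 2 μ).toReal ^ 2)

end Sobolev

/-! ### Operators -/

section Operators

variable {𝕜 : Type*} [RCLike 𝕜] {H V : Type*} [NormedAddCommGroup H] [InnerProductSpace 𝕜 H]
  [NormedAddCommGroup V] [InnerProductSpace 𝕜 V]

/-- The graph of the operator in `H` associated with a form `a` on `V ↪ H`: all pairs `(u, y)` with
`u ∈ V`, `y ∈ H` and `a(u, v) = (y | v)_H` for every `v ∈ V`. (The scalar product `(y | v)_H`,
linear in `y`, is `inner 𝕜 v y` here.) -/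
def formGraph (ιV : V →L[𝕜] H) (a : V →ₗ[𝕜] V →ₗ⋆[𝕜] 𝕜) : Submodule 𝕜 (H × H) where
  carrier := {p | ∃ u : V, ιV u = p.1 ∧ ∀ v : V, a u v = inner 𝕜 (ιV v) p.2}
  zero_mem' := ⟨0, by simp, by simp⟩
  add_mem' := by
    rintro p p' ⟨u, hu, h⟩ ⟨u', hu', h'⟩
    exact ⟨u + u', by simp [hu, hu'], fun v => by simp [h, h', inner_add_right]⟩
  smul_mem' := by
    rintro c p ⟨u, hu, h⟩
    exact ⟨c • u, by simp [hu], fun v => by simp [h, inner_smul_right]⟩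

/-- The operator in `H` associated with a form `a` on the densely embedded space `V ↪ H`. -/
noncomputable def formOperator (ιV : V →L[𝕜] H) (a : V →ₗ[𝕜] V →ₗ⋆[𝕜] 𝕜) : H →ₗ.[𝕜] H :=
  (formGraph ιV a).toLinearPMap

variable {E : Type*} [MeasurableSpace E] (μ : Measure E)

/-- The graph of the multiplication operator in `L₂(μ; H)` with symbol `z ↦ A z`. -/
def randomGraph (A : E → H →ₗ.[𝕜] H) : Submodule 𝕜 (Lp H 2 μ × Lp H 2 μ) where
  carrier := {p | ∀ᵐ z ∂μ, (p.1 z, p.2 z) ∈ (A z).graph}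
  zero_mem' := by
    filter_upwards [Lp.coeFn_zero H 2 μ] with z hz
    have h0 : ((0 : H), (0 : H)) ∈ (A z).graph := (A z).graph.zero_mem
    rw [Prod.fst_zero, Prod.snd_zero, hz]
    exact h0
  add_mem' := by
    rintro p p' h h'
    filter_upwards [h, h', Lp.coeFn_add p.1 p'.1, Lp.coeFn_add p.2 p'.2] with z h h' h1 h2
    rw [Prod.fst_add, Prod.snd_add, h1, h2]
    exact (A z).graph.add_mem h h'
  smul_mem' := by
    rintro c p h
    filter_upwards [h, Lp.coeFn_smul c p.1, Lp.coeFn_smul c p.2] with z h h1 h2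
    rw [Prod.smul_fst, Prod.smul_snd, h1, h2]
    exact (A z).graph.smul_mem c h

/-- The operator `𝐀` in `L₂(μ; H)`: its domain consists of all `f` with `f z ∈ dom (A z)` for
almost every `z` and `[z ↦ A z (f z)] ∈ L₂(μ; H)`, and `(𝐀 f) z = A z (f z)`. -/
noncomputable def randomOperator (A : E → H →ₗ.[𝕜] H) : Lp H 2 μ →ₗ.[𝕜] Lp H 2 μ :=
  (randomGraph μ A).toLinearPMap

/-- `T` is a strongly continuous semigroup of bounded operators. -/
structure IsC0Semigroup (T : ℝ≥0 → H →L[𝕜] H) : Prop where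
  map_zero : T 0 = ContinuousLinearMap.id 𝕜 H
  map_add : ∀ s t, T (s + t) = (T s).comp (T t)
  continuous : ∀ x, Continuous fun t => T t x

/-- `T` is a strongly continuous semigroup whose infinitesimal generator (with its full domain) is
`B`. -/
def Generates (B : H →ₗ.[𝕜] H) (T : ℝ≥0 → H →L[𝕜] H) : Prop :=
  IsC0Semigroup T ∧ ∀ x y : H, (x, y) ∈ B.graph ↔
    Tendsto (fun t : ℝ≥0 => (((t : ℝ)⁻¹ : ℝ) : 𝕜) • (T t x - x)) (𝓝[>] 0) (𝓝 y)

/-- For `λ` in the scalar field: `λ + B : dom B → H` is bijective. -/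
def ShiftBijective (B : H →ₗ.[𝕜] H) (l : 𝕜) : Prop :=
  Function.Bijective fun u : B.domain => l • (u : H) + B u

/-- `(λ + B) (u₁ + i u₂) = f₁ + i f₂` for a complex number `λ`, where `B` acts componentwise on
`u₁ + i u₂` and the equation is split into its two components. For `𝕜 = ℝ` this is the equation
`(λ + B) u = f` in the complexification of `H`. -/
def ComplexShiftEq (B : H →ₗ.[𝕜] H) (l : ℂ) (u : B.domain × B.domain) (f : H × H) : Prop :=
  (l.re : 𝕜) • (u.1 : H) - (l.im : 𝕜) • (u.2 : H) + B u.1 = f.1 ∧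
    (l.im : 𝕜) • (u.1 : H) + (l.re : 𝕜) • (u.2 : H) + B u.2 = f.2

end Operators

/-- The set of points of the curve `γ_r` with opening angle `η`: the ray
`{-s e^{-iη} : s < -r}`, the arc `{r e^{iφ} : -η < φ < η}` and the ray `{s e^{iη} : s > r}`. -/
def gammaCurve (η r : ℝ) : Set ℂ :=
  (fun s : ℝ => -(s : ℂ) * Complex.exp (-(η : ℂ) * Complex.I)) '' Iio (-r) ∪
    (fun φ : ℝ => (r : ℂ) * Complex.exp ((φ : ℂ) * Complex.I)) '' Ioo (-η) η ∪
      (fun s : ℝ => (s : ℂ) * Complex.exp ((η : ℂ) * Complex.I)) '' Ioi r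

/-! ### The assumptions on the random family of forms -/

section Assumptions

variable {𝕜 : Type*} [RCLike 𝕜] {H V D : Type*} [NormedAddCommGroup H] [InnerProductSpace 𝕜 H]
  [NormedAddCommGroup V] [InnerProductSpace 𝕜 V] [NormedAddCommGroup D] [InnerProductSpace 𝕜 D]

/-- The forms are almost surely uniformly bounded, uniformly coercive and symmetric. -/
def UniformForms (μ : Measure (Fin N → ℝ)) (a : (Fin N → ℝ) → V →ₗ[𝕜] V →ₗ⋆[𝕜] 𝕜) : Prop :=
  ∃ K > (0 : ℝ), ∃ κ > (0 : ℝ), ∀ᵐ z ∂μ,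
    (∀ u v : V, ‖a z u v‖ ≤ K * ‖u‖ * ‖v‖) ∧
    (∀ u : V, κ * ‖u‖ ^ 2 ≤ RCLike.re (a z u u)) ∧
    ∀ u v : V, a z u v = starRingEnd 𝕜 (a z v u)

/-- `D ↪ H` is the almost surely constant domain of the operators `A z`, and its norm is uniformly
equivalent to their graph norms. -/
def ConstantDomain (μ : Measure (Fin N → ℝ)) (ιD : D →L[𝕜] H) (A : (Fin N → ℝ) → H →ₗ.[𝕜] H) :
    Prop :=
  ∃ c > (0 : ℝ), ∃ C > (0 : ℝ), ∀ᵐ z ∂μ,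
    ((A z).domain : Set H) = Set.range ιD ∧
    ∀ (u : D) (w : (A z).domain), (w : H) = ιD u →
      c * ‖u‖ ≤ √(‖A z w‖ ^ 2 + ‖(w : H)‖ ^ 2) ∧ √(‖A z w‖ ^ 2 + ‖(w : H)‖ ^ 2) ≤ C * ‖u‖

/-- `z ↦ a z u v` is `ℓ` times continuously differentiable for all `u, v ∈ V`, and
`|ρ(z) ^ (α / 2) ∂_z^α a z (u, v)| ≤ C ‖u‖_D ‖v‖_H` for all `u ∈ D`, `v ∈ V`, `|α| ≤ ℓ` and
almost every `z`. (`w` is `u ∈ D` regarded as an element of `V`.) -/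
def DerivativeBounds (law : Fin N → NoiseLaw) (μ : Measure (Fin N → ℝ)) (ιV : V →L[𝕜] H)
    (ιD : D →L[𝕜] H) (a : (Fin N → ℝ) → V →ₗ[𝕜] V →ₗ⋆[𝕜] 𝕜) (ℓ : ℕ) : Prop :=
  (∀ u v : V, ContDiff ℝ ℓ fun z => a z u v) ∧
  ∃ C ≥ (0 : ℝ), ∀ᵐ z ∂μ, ∀ (u : D) (w v : V), ιV w = ιD u → ∀ α : Fin N → ℕ, order α ≤ ℓ →
    ‖(rhoPow law α z : 𝕜) * partialDeriv α (fun z' => a z' w v) z‖ ≤ C * ‖u‖ * ‖ιV v‖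

end Assumptions

end RandomEvolution

set_option linter.unusedSectionVars false

/-! Everything is done over ℝ. Hilbert spaces over `𝕜` are used with their real inner product, and
`λ + A` with `λ = a + ib` becomes a 2×2 block operator on pairs. The law of the noise has a positive
continuous density on the box. Hence it has the same null sets as Lebesgue measure there, and its L₂
functions are locally integrable.

Resolvent. By Riesz representation the bounds on the derivatives of the forms yield operators `B w z
: D → H`, one for each word `w` of coordinates, where `B [] z` is A_z (`exists_isSymmFamily`).
Coercivity and the uniform graph norms give c‖u‖_D ≤ ‖A_z u‖. Symmetry gives ‖(λ+A)u‖² ≥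
(1-δ)(|λ|²‖u‖² + ‖Au‖²) whenever Re λ ≥ -δ|λ|, and on the curve δ = -cos η works
(`le_norm_sq_shiftBlock`). So λ + A_z is invertible with bounds that do not depend on z, and the
D-norm bound does not depend on λ either.

Regularity in z. The solution of `B u = f` is the limit of the Richardson iteration u + θB*(f - Bu),
a contraction. Every iterate is weakly differentiable by the product rule, and the derivatives of
the iterates converge geometrically as well, so u is weakly differentiable
(`CoefDeriv.exists_hasWeakDeriv_of_eq`). Applying this to the differentiated equation gives all
orders. For the norms, the Leibniz rule is solved for B ∂_w u. The weights are multiplicative,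
ρ^((α+β)/2) = ρ^(α/2) ρ^(β/2), so each remaining term is a bounded weighted derivative of B applied
to a weighted derivative of u of lower order (`SobolevJet.eLpNorm_solution_le`). This estimate never
uses the size of `B []`, which is how it stays uniform in λ.

Semigroup. The multiplication operator is maximal monotone, so the Hille–Yosida theorem applies. For
the Sobolev bounds, ∫ tⁿ e^{-λt} T(t) dt = n! (λ+A)^{-(n+1)}. With resolvents bounded by k/|λ|, two
of them are integrable along the line Re λ = 1/τ, and Fourier inversion bounds τ T(τ) by a multiple
of τ. With n = 2 and A(λ+A)⁻³ = (λ+A)⁻² - λ(λ+A)⁻³ the same argument bounds τ² T(τ)A. All integrals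
are scalar: membership in the Sobolev space with norm control is equivalent to a family of
inequalities for inner products in L₂ (`HasDensity.DualBound`), so it suffices to test T(τ)f against
fixed vectors. -/

namespace RandomEvolution

/-! ### Weak first-order derivatives -/

section WeakDerivative

variable {N : ℕ} {U : Set (Fin N → ℝ)} {X Y : Type*}

/-- Smooth functions with compact support in `U`. -/
structure IsTest (U : Set (Fin N → ℝ)) (φ : (Fin N → ℝ) → ℝ) : Prop where
  contDiff : ContDiff ℝ ((⊤ : ℕ∞) : WithTop ℕ∞) φ
  compact : HasCompactSupport φ
  support : tsupport φ ⊆ U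

theorem contDiff_coordDeriv {F : Type*} [NormedAddCommGroup F] [NormedSpace ℝ F] {n m : WithTop ℕ∞}
    {f : (Fin N → ℝ) → F} (hf : ContDiff ℝ n f) (h : m + 1 ≤ n) (j : Fin N) :
    ContDiff ℝ m (coordDeriv j f) :=
  (hf.fderiv_right h).clm_apply contDiff_const

theorem tsupport_coordDeriv_subset {F : Type*} [NormedAddCommGroup F] [NormedSpace ℝ F]
    (f : (Fin N → ℝ) → F) (j : Fin N) : tsupport (coordDeriv j f) ⊆ tsupport f := by
  refine (closure_mono fun z hz => ?_).trans (tsupport_fderiv_subset ℝ (f := f))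
  intro h
  exact hz (by simp [coordDeriv, h])

theorem IsTest.coordDeriv {φ : (Fin N → ℝ) → ℝ} (h : IsTest U φ) (j : Fin N) :
    IsTest U (coordDeriv j φ) where
  contDiff := contDiff_coordDeriv h.contDiff (by simp) j
  compact := h.compact.mono' ((subset_tsupport _).trans (tsupport_coordDeriv_subset φ j))
  support := (tsupport_coordDeriv_subset φ j).trans h.support

theorem integrableOn_smul_of_tsupport_subset [NormedAddCommGroup X] [NormedSpace ℝ X]
    {f : (Fin N → ℝ) → X} (hf : LocallyIntegrableOn f U volume) {g : (Fin N → ℝ) → ℝ}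
    (hg : Continuous g) (hc : HasCompactSupport g) (hs : tsupport g ⊆ U) :
    IntegrableOn (fun z => g z • f z) U := by
  have hK : IsCompact (tsupport g) := hc
  have h1 : IntegrableOn (fun z => g z • f z) (tsupport g) :=
    (hf.integrableOn_compact_subset hs hK).continuousOn_smul hg.continuousOn hK
  have h2 : (fun z => g z • f z) = (tsupport g).indicator (fun z => g z • f z) := by
    symm
    apply indicator_eq_self.2
    apply Function.support_subset_iff'.2
    intro x hx
    simp [image_eq_zero_of_notMem_tsupport hx]
  rw [h2]
  exact ((integrable_indicator_iff hK.measurableSet).2 h1).integrableOn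

theorem IsTest.integrableOn [NormedAddCommGroup X] [NormedSpace ℝ X]
    {φ : (Fin N → ℝ) → ℝ} (h : IsTest U φ) {f : (Fin N → ℝ) → X}
    (hf : LocallyIntegrableOn f U volume) : IntegrableOn (fun z => φ z • f z) U :=
  integrableOn_smul_of_tsupport_subset hf h.contDiff.continuous h.compact h.support

/-- `g` is the weak derivative of `f` on `U` in the direction of the `j`-th coordinate. -/
structure HasWeakDeriv [NormedAddCommGroup X] [NormedSpace ℝ X] (U : Set (Fin N → ℝ)) (j : Fin N)
    (f g : (Fin N → ℝ) → X) : Prop where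
  left : LocallyIntegrableOn f U volume
  right : LocallyIntegrableOn g U volume
  eq : ∀ φ, IsTest U φ → ∫ z in U, coordDeriv j φ z • f z = -∫ z in U, φ z • g z

section Basic

variable [NormedAddCommGroup X] [NormedSpace ℝ X] [NormedAddCommGroup Y] [NormedSpace ℝ Y]
  {j : Fin N} {f g f' g' : (Fin N → ℝ) → X}

theorem HasWeakDeriv.congr (h : HasWeakDeriv U j f g) (hf : f =ᵐ[volume.restrict U] f')
    (hg : g =ᵐ[volume.restrict U] g') : HasWeakDeriv U j f' g' where
  left := h.left.congr hf
  right := h.right.congr hg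
  eq φ hφ := by
    have h1 : ∫ z in U, coordDeriv j φ z • f z = ∫ z in U, coordDeriv j φ z • f' z :=
      integral_congr_ae (hf.mono fun z hz => congrArg (coordDeriv j φ z • ·) hz)
    have h2 : ∫ z in U, φ z • g z = ∫ z in U, φ z • g' z :=
      integral_congr_ae (hg.mono fun z hz => congrArg (φ z • ·) hz)
    rw [← h1, ← h2, h.eq φ hφ]

theorem HasWeakDeriv.add (h : HasWeakDeriv U j f g) (h' : HasWeakDeriv U j f' g') :
    HasWeakDeriv U j (fun z => f z + f' z) (fun z => g z + g' z) where
  left := h.left.add h'.left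
  right := h.right.add h'.right
  eq φ hφ := by
    simp only [smul_add]
    rw [integral_add ((hφ.coordDeriv j).integrableOn h.left)
      ((hφ.coordDeriv j).integrableOn h'.left), integral_add (hφ.integrableOn h.right)
      (hφ.integrableOn h'.right), h.eq φ hφ, h'.eq φ hφ, neg_add]

theorem HasWeakDeriv.const_smul (c : ℝ) (h : HasWeakDeriv U j f g) :
    HasWeakDeriv U j (fun z => c • f z) (fun z => c • g z) where
  left := h.left.smul c
  right := h.right.smul c
  eq φ hφ := by
    simp only [smul_comm _ c]
    rw [integral_smul, integral_smul, h.eq φ hφ, smul_neg]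

theorem HasWeakDeriv.neg (h : HasWeakDeriv U j f g) :
    HasWeakDeriv U j (fun z => -f z) (fun z => -g z) := by
  simpa using h.const_smul (-1)

theorem HasWeakDeriv.sub (h : HasWeakDeriv U j f g) (h' : HasWeakDeriv U j f' g') :
    HasWeakDeriv U j (fun z => f z - f' z) (fun z => g z - g' z) := by
  simpa [sub_eq_add_neg] using h.add h'.neg

theorem HasWeakDeriv.zero : HasWeakDeriv U j (fun _ => (0 : X)) (fun _ => 0) where
  left := locallyIntegrableOn_zero
  right := locallyIntegrableOn_zero
  eq φ hφ := by simp

theorem HasWeakDeriv.sum {ι : Type*} (s : Finset ι) {F G : ι → (Fin N → ℝ) → X}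
    (h : ∀ i ∈ s, HasWeakDeriv U j (F i) (G i)) :
    HasWeakDeriv U j (fun z => ∑ i ∈ s, F i z) (fun z => ∑ i ∈ s, G i z) := by
  classical
  induction s using Finset.induction_on with
  | empty => simpa using HasWeakDeriv.zero
  | insert i s hi ih =>
    simp only [Finset.sum_insert hi]
    exact (h i (by simp)).add (ih fun k hk => h k (by simp [hk]))

theorem LocallyIntegrableOn.clm_comp {f : (Fin N → ℝ) → X} (L : X →L[ℝ] Y)
    (h : LocallyIntegrableOn f U volume) : LocallyIntegrableOn (fun z => L (f z)) U volume :=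
  fun z hz => (h z hz).imp fun _ hs => ⟨hs.1, L.integrable_comp hs.2⟩

theorem HasWeakDeriv.clm_comp [CompleteSpace X] [CompleteSpace Y] (L : X →L[ℝ] Y)
    (h : HasWeakDeriv U j f g) :
    HasWeakDeriv U j (fun z => L (f z)) (fun z => L (g z)) where
  left := LocallyIntegrableOn.clm_comp L h.left
  right := LocallyIntegrableOn.clm_comp L h.right
  eq φ hφ := by
    have h1 := L.integral_comp_comm ((hφ.coordDeriv j).integrableOn h.left)
    have h2 := L.integral_comp_comm (hφ.integrableOn h.right)
    simp only [map_smul] at h1 h2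
    rw [h1, h2, h.eq φ hφ, map_neg]

/-- Dominated convergence on both sides of the defining identity. A test function has compact
support in `U`, so a locally integrable bound suffices. Every passage from approximations to limits
below, for projections and for iterations, goes through this lemma. -/
theorem HasWeakDeriv.of_tendsto {F G : ℕ → (Fin N → ℝ) → X} {b : (Fin N → ℝ) → ℝ}
    (h : ∀ n, HasWeakDeriv U j (F n) (G n)) (hb : LocallyIntegrableOn b U volume)
    (hF : ∀ n, ∀ᵐ z ∂volume.restrict U, ‖F n z‖ ≤ b z)
    (hG : ∀ n, ∀ᵐ z ∂volume.restrict U, ‖G n z‖ ≤ b z)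
    (hf : ∀ᵐ z ∂volume.restrict U, Tendsto (fun n => F n z) atTop (𝓝 (f z)))
    (hg : ∀ᵐ z ∂volume.restrict U, Tendsto (fun n => G n z) atTop (𝓝 (g z))) :
    HasWeakDeriv U j f g := by
  have key : ∀ {F : ℕ → (Fin N → ℝ) → X} {f : (Fin N → ℝ) → X},
      (∀ n, LocallyIntegrableOn (F n) U volume) →
      (∀ n, ∀ᵐ z ∂volume.restrict U, ‖F n z‖ ≤ b z) →
      (∀ᵐ z ∂volume.restrict U, Tendsto (fun n => F n z) atTop (𝓝 (f z))) →
      LocallyIntegrableOn f U volume ∧ ∀ φ, IsTest U φ →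
        Tendsto (fun n => ∫ z in U, φ z • F n z) atTop (𝓝 (∫ z in U, φ z • f z)) := by
    intro F f hi hF hf
    have hfb : ∀ᵐ z ∂volume.restrict U, ‖f z‖ ≤ ‖b z‖ := by
      filter_upwards [hf, ae_all_iff.2 hF] with z h1 h2
      exact le_trans (le_of_tendsto h1.norm (Eventually.of_forall h2)) (le_abs_self _)
    have hfm : AEStronglyMeasurable f (volume.restrict U) :=
      aestronglyMeasurable_of_tendsto_ae atTop (fun n => (hi n).aestronglyMeasurable) hf
    refine ⟨fun z hz => ?_, fun φ hφ => ?_⟩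
    · obtain ⟨s, hs, hs'⟩ := hb z hz
      refine ⟨s ∩ U, inter_mem hs self_mem_nhdsWithin, ?_⟩
      refine Integrable.mono (hs'.mono_set inter_subset_left) (hfm.mono_set inter_subset_right) ?_
      exact ae_restrict_of_ae_restrict_of_subset inter_subset_right hfb
    · refine tendsto_integral_of_dominated_convergence (fun z => ‖φ z • b z‖)
        (fun n => (hφ.integrableOn (hi n)).aestronglyMeasurable) (hφ.integrableOn hb).norm
        (fun n => ?_) ?_
      · filter_upwards [hF n] with z hz
        rw [norm_smul, norm_smul]
        exact mul_le_mul_of_nonneg_left (hz.trans (le_abs_self _)) (norm_nonneg _)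
      · filter_upwards [hf] with z hz
        exact hz.const_smul _
  obtain ⟨h1, h2⟩ := key (fun n => (h n).left) hF hf
  obtain ⟨h3, h4⟩ := key (fun n => (h n).right) hG hg
  refine ⟨h1, h3, fun φ hφ => ?_⟩
  refine tendsto_nhds_unique (h2 _ (hφ.coordDeriv j)) ?_
  simp only [fun n => (h n).eq φ hφ]
  exact (h4 φ hφ).neg

/-- The fundamental lemma of the calculus of variations, applied to the difference. -/
theorem HasWeakDeriv.unique [CompleteSpace X] (hU : IsOpen U) (h : HasWeakDeriv U j f g)
    (h' : HasWeakDeriv U j f g') : g =ᵐ[volume.restrict U] g' := by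
  have := hU.ae_eq_zero_of_integral_contDiff_smul_eq_zero (μ := volume)
    (f := fun z => g z - g' z) (h.right.sub h'.right) (fun φ h1 h2 h3 => by
      have hφ : IsTest U φ := ⟨h1, h2, h3⟩
      have h0 : ∫ z, φ z • (g z - g' z) = ∫ z in U, φ z • (g z - g' z) := by
        rw [setIntegral_eq_integral_of_forall_compl_eq_zero]
        intro z hz
        rw [image_eq_zero_of_notMem_tsupport fun h => hz (h3 h), zero_smul]
      rw [h0]
      simp only [smul_sub]
      rw [integral_sub (hφ.integrableOn h.right) (hφ.integrableOn h'.right), sub_eq_zero,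
        ← neg_inj, ← h.eq φ hφ, ← h'.eq φ hφ])
  filter_upwards [ae_restrict_of_ae this, ae_restrict_mem hU.measurableSet] with z h1 h2
  exact sub_eq_zero.1 (h1 h2)

end Basic

theorem HasWeakDeriv.of_inner [NormedAddCommGroup X] [InnerProductSpace ℝ X] [CompleteSpace X]
    {j : Fin N} {f g : (Fin N → ℝ) → X} (hf : LocallyIntegrableOn f U volume)
    (hg : LocallyIntegrableOn g U volume)
    (h : ∀ x : X, HasWeakDeriv U j (fun z => inner ℝ x (f z)) (fun z => inner ℝ x (g z))) :
    HasWeakDeriv U j f g where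
  left := hf
  right := hg
  eq φ hφ := by
    refine ext_inner_left ℝ fun x => ?_
    have h1 := integral_inner (𝕜 := ℝ) ((hφ.coordDeriv j).integrableOn hf) x
    have h2 := integral_inner (𝕜 := ℝ) (hφ.integrableOn hg) x
    simp only [inner_smul_right] at h1 h2
    rw [inner_neg_right, ← h1, ← h2]
    exact (h x).eq φ hφ

/-- Testing with continuously differentiable functions. -/
theorem HasWeakDeriv.eq_of_contDiff_one [NormedAddCommGroup X] [NormedSpace ℝ X] (hU : IsOpen U)
    {j : Fin N} {f g : (Fin N → ℝ) → X} (h : HasWeakDeriv U j f g) {ψ : (Fin N → ℝ) → ℝ}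
    (hψ : ContDiff ℝ 1 ψ) (hc : HasCompactSupport ψ) (hs : tsupport ψ ⊆ U) :
    ∫ z in U, coordDeriv j ψ z • f z = -∫ z in U, ψ z • g z := by
  obtain ⟨ε, hε, hεU⟩ := IsCompact.exists_cthickening_subset_open hc hU hs
  have hK' : IsCompact (Metric.cthickening ε (tsupport ψ)) := IsCompact.cthickening hc
  -- Mollify `ψ`. Outer radii at most `ε` keep all supports in one compact thickening inside `U`, on
  -- which `f` is integrable; this gives the dominating function.
  let b : ℕ → ContDiffBump (0 : Fin N → ℝ) := fun n =>
    ⟨ε / (n + 2) / 2, ε / (n + 2), by positivity, half_lt_self (by positivity)⟩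
  have hb : Tendsto (fun n => (b n).rOut) atTop (𝓝 0) := by
    have h1 : Tendsto (fun n : ℕ => ε / ((n : ℝ) + 2)) atTop (𝓝 0) :=
      tendsto_const_nhds.div_atTop (tendsto_natCast_atTop_atTop.atTop_add tendsto_const_nhds)
    exact h1
  have hbε : ∀ n, (b n).rOut ≤ ε := fun n => by
    change ε / ((n : ℝ) + 2) ≤ ε
    exact div_le_self hε.le (by have : (0 : ℝ) ≤ n := n.cast_nonneg; linarith)
  let m : ℕ → ((Fin N → ℝ) → ℝ) → (Fin N → ℝ) → ℝ := fun n g =>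
    convolution ((b n).normed volume) g (ContinuousLinearMap.lsmul ℝ ℝ) volume
  have hm : ∀ (g : (Fin N → ℝ) → ℝ), Continuous g → HasCompactSupport g →
      tsupport g ⊆ tsupport ψ → (∀ n, ContDiff ℝ ((⊤ : ℕ∞) : WithTop ℕ∞) (m n g)) ∧
      (∀ n, tsupport (m n g) ⊆ Metric.cthickening ε (tsupport ψ)) ∧
      ∀ f : (Fin N → ℝ) → X, LocallyIntegrableOn f U volume →
        Tendsto (fun n => ∫ z in U, m n g z • f z) atTop (𝓝 (∫ z in U, g z • f z)) := by
    intro g hg hgc hgs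
    have hsm : ∀ n, ContDiff ℝ ((⊤ : ℕ∞) : WithTop ℕ∞) (m n g) := fun n =>
      (b n).hasCompactSupport_normed.contDiff_convolution_left _ (b n).contDiff_normed
        hg.locallyIntegrable
    have hsup : ∀ n, tsupport (m n g) ⊆ Metric.cthickening ε (tsupport ψ) := by
      intro n
      refine closure_minimal ?_ Metric.isClosed_cthickening
      refine (support_convolution_subset _).trans ?_
      rw [(b n).support_normed_eq]
      rintro _ ⟨x, hx, y, hy, rfl⟩
      refine Metric.mem_cthickening_of_dist_le _ y _ _ (hgs (subset_tsupport _ hy)) ?_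
      rw [mem_ball_zero_iff] at hx
      simpa [dist_eq_norm] using hx.le.trans (hbε n)
    refine ⟨hsm, hsup, fun f hf => ?_⟩
    obtain ⟨C, hC⟩ := hg.bounded_above_of_compact_support hgc
    have hC0 : 0 ≤ C := (norm_nonneg _).trans (hC 0)
    have hbd : ∀ n z, ‖m n g z‖ ≤ C := by
      intro n z
      have := dist_convolution_le (μ := volume) (z₀ := (0 : ℝ)) (x₀ := z) hC0
        (b n).support_normed_eq.subset (b n).nonneg_normed (b n).integral_normed
        hg.aestronglyMeasurable (fun x _ => by simpa using hC x)
      simpa using this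
    have hcs : ∀ n, HasCompactSupport (m n g) := fun n =>
      HasCompactSupport.of_support_subset_isCompact hK' ((subset_tsupport _).trans (hsup n))
    refine tendsto_integral_of_dominated_convergence
      ((Metric.cthickening ε (tsupport ψ)).indicator fun z => C * ‖f z‖) (fun n => ?_) ?_
      (fun n => ?_) ?_
    · exact (integrableOn_smul_of_tsupport_subset hf (hsm n).continuous (hcs n)
        ((hsup n).trans hεU)).aestronglyMeasurable
    · exact ((integrable_indicator_iff hK'.measurableSet).2
        ((hf.integrableOn_compact_subset hεU hK').norm.const_mul C)).integrableOn
    · refine Eventually.of_forall fun z => ?_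
      by_cases hz : z ∈ Metric.cthickening ε (tsupport ψ)
      · rw [indicator_of_mem hz, norm_smul]
        exact mul_le_mul_of_nonneg_right (hbd n z) (norm_nonneg _)
      · rw [indicator_of_notMem hz, image_eq_zero_of_notMem_tsupport fun h => hz (hsup n h)]
        simp
    · refine Eventually.of_forall fun z => ?_
      exact (ContDiffBump.convolution_tendsto_right_of_continuous hb hg z).smul_const _
  -- The derivative of a convolution may be put on the factor `ψ`, so mollified derivatives are
  -- derivatives of test functions.
  have hder : ∀ n, coordDeriv j (m n ψ) = m n (coordDeriv j ψ) := by
    intro n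
    ext z
    have h1 := hc.hasFDerivAt_convolution_right (ContinuousLinearMap.lsmul ℝ ℝ)
      (b n).continuous_normed.locallyIntegrable hψ z (f := (b n).normed volume) (μ := volume)
    have h2 : coordDeriv j (m n ψ) z = _ := congrArg (fun L => L (Pi.single j 1)) h1.fderiv
    rw [h2]
    exact convolution_precompR_apply _ (b n).continuous_normed.locallyIntegrable
      (hc.fderiv ℝ) (hψ.continuous_fderiv one_ne_zero) z _
  obtain ⟨h1, h2, h3⟩ := hm ψ hψ.continuous hc subset_rfl
  obtain ⟨-, -, h4⟩ := hm (coordDeriv j ψ)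
    (contDiff_coordDeriv (m := 0) hψ (by simp) j).continuous
    (hc.mono' ((subset_tsupport _).trans (tsupport_coordDeriv_subset ψ j)))
    (tsupport_coordDeriv_subset ψ j)
  refine tendsto_nhds_unique (h4 f h.left) ?_
  have h5 : ∀ n, ∫ z in U, m n (coordDeriv j ψ) z • f z = -∫ z in U, m n ψ z • g z := by
    intro n
    rw [← hder n]
    exact h.eq _ ⟨h1 n, HasCompactSupport.of_support_subset_isCompact hK'
      ((subset_tsupport _).trans (h2 n)), (h2 n).trans hεU⟩
  simp only [h5]
  exact (h3 g h.right).neg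

/-- Test `h` with `φ c` and expand by the product rule. Since `c` is only C¹, so is `φ c`; this is
what the extension to C¹ test functions is for. -/
theorem HasWeakDeriv.contDiff_mul (hU : IsOpen U) {j : Fin N} {h h' : (Fin N → ℝ) → ℝ}
    (hh : HasWeakDeriv U j h h') {c : (Fin N → ℝ) → ℝ} (hc : ContDiff ℝ 1 c) :
    HasWeakDeriv U j (fun z => c z * h z) (fun z => coordDeriv j c z * h z + c z * h' z) where
  left := hh.left.continuousOn_mul hc.continuous.continuousOn hU.isLocallyClosed
  right := (hh.left.continuousOn_mul (contDiff_coordDeriv (m := 0) hc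
    (by simp) j).continuous.continuousOn hU.isLocallyClosed).add
      (hh.right.continuousOn_mul hc.continuous.continuousOn hU.isLocallyClosed)
  eq φ hφ := by
    have hφ1 : ContDiff ℝ 1 φ := hφ.contDiff.of_le (by exact_mod_cast le_top)
    have hcs : HasCompactSupport fun z => φ z * c z := hφ.compact.mul_right
    have hts : tsupport (fun z => φ z * c z) ⊆ U := (tsupport_mul_subset_left).trans hφ.support
    have hmul : ContDiff ℝ 1 fun z => φ z * c z := hφ1.mul hc
    have h1 := hh.eq_of_contDiff_one hU hmul hcs hts
    have h2 : ∀ z, coordDeriv j (fun z => φ z * c z) z =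
        φ z * coordDeriv j c z + coordDeriv j φ z * c z := by
      intro z
      have := fderiv_fun_mul (𝕜 := ℝ) (hφ1.differentiable one_ne_zero z)
        (hc.differentiable one_ne_zero z)
      simp only [coordDeriv, this]
      simp
      ring
    have hc' := (contDiff_coordDeriv (m := 0) hc (by simp) j).continuous
    have i1 : IntegrableOn (fun z => φ z * (coordDeriv j c z * h z)) U :=
      hφ.integrableOn (hh.left.continuousOn_mul hc'.continuousOn hU.isLocallyClosed)
    have i2 : IntegrableOn (fun z => coordDeriv j φ z * (c z * h z)) U :=
      (hφ.coordDeriv j).integrableOn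
        (hh.left.continuousOn_mul hc.continuous.continuousOn hU.isLocallyClosed)
    have i3 : IntegrableOn (fun z => φ z * (c z * h' z)) U :=
      hφ.integrableOn (hh.right.continuousOn_mul hc.continuous.continuousOn hU.isLocallyClosed)
    simp only [smul_eq_mul, h2] at h1 ⊢
    have e1 : ∫ z in U, (φ z * coordDeriv j c z + coordDeriv j φ z * c z) * h z =
        (∫ z in U, φ z * (coordDeriv j c z * h z)) + ∫ z in U, coordDeriv j φ z * (c z * h z) := by
      rw [← integral_add i1 i2]
      exact integral_congr_ae (Eventually.of_forall fun z => by ring)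
    have e2 : ∫ z in U, φ z * c z * h' z = ∫ z in U, φ z * (c z * h' z) :=
      integral_congr_ae (Eventually.of_forall fun z => by ring)
    have e3 : ∫ z in U, φ z * (coordDeriv j c z * h z + c z * h' z) =
        (∫ z in U, φ z * (coordDeriv j c z * h z)) + ∫ z in U, φ z * (c z * h' z) := by
      rw [← integral_add i1 i3]
      exact integral_congr_ae (Eventually.of_forall fun z => by ring)
    rw [e1, e2] at h1
    rw [e3]
    linarith

end WeakDerivative

/-! ### Operator-valued coefficients -/

section Coefficients

/-- Finite rank approximation of the identity of a separable Hilbert space. -/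
theorem exists_finiteRank_approx (X : Type*) [NormedAddCommGroup X] [InnerProductSpace ℝ X]
    [CompleteSpace X] [TopologicalSpace.SeparableSpace X] :
    ∃ (d : ℕ → ℕ) (b : ∀ n, Fin (d n) → X), ∀ x : X,
      Tendsto (fun n => ∑ i, inner ℝ (b n i) x • b n i) atTop (𝓝 x) ∧
        ∀ n, ‖∑ i, inner ℝ (b n i) x • b n i‖ ≤ ‖x‖ := by
  classical
  let s := TopologicalSpace.denseSeq X
  -- The spans of the first `n` terms of a dense sequence increase to a dense subspace, so their
  -- orthogonal projections converge strongly to the identity and have norm at most 1.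
  let K : ℕ → Submodule ℝ X := fun n => Submodule.span ℝ (s '' (Finset.range n : Set ℕ))
  have hfin : ∀ n, FiniteDimensional ℝ (K n) := fun n =>
    FiniteDimensional.span_of_finite ℝ ((Finset.finite_toSet _).image _)
  have hmono : Monotone K := fun m n hmn =>
    Submodule.span_mono (image_mono (by
      intro i hi
      simp only [Finset.coe_range, mem_Iio] at hi ⊢
      omega))
  have hdense : ⊤ ≤ (⨆ n, K n).topologicalClosure := by
    intro x _
    have : range s ⊆ ((⨆ n, K n : Submodule ℝ X) : Set X) := by
      rintro _ ⟨n, rfl⟩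
      refine (le_iSup K (n + 1)) (Submodule.subset_span ⟨n, by simp, rfl⟩)
    exact closure_mono this (TopologicalSpace.denseRange_denseSeq X x)
  refine ⟨fun n => Module.finrank ℝ (K n), fun n i => (stdOrthonormalBasis ℝ (K n) i : X),
    fun x => ?_⟩
  have h : ∀ n, ∑ i, inner ℝ ((stdOrthonormalBasis ℝ (K n) i : K n) : X) x •
      ((stdOrthonormalBasis ℝ (K n) i : K n) : X) = (K n).starProjection x := by
    intro n
    rw [Submodule.starProjection_apply,
      (stdOrthonormalBasis ℝ (K n)).orthogonalProjectionOnto_apply_eq_sum x]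
    simp
  simp only [h]
  exact ⟨Submodule.starProjection_tendsto_self K hmono x hdense,
    fun n => Submodule.norm_starProjection_apply_le _ _⟩

variable {N : ℕ} {U : Set (Fin N → ℝ)} {X Y : Type*}

theorem locallyIntegrableOn_of_norm_le [NormedAddCommGroup X] {g : (Fin N → ℝ) → X}
    {b : (Fin N → ℝ) → ℝ} (hb : LocallyIntegrableOn b U volume)
    (hg : AEStronglyMeasurable g (volume.restrict U))
    (h : ∀ᵐ z ∂volume.restrict U, ‖g z‖ ≤ b z) : LocallyIntegrableOn g U volume := by
  intro z hz
  obtain ⟨s, hs, hs'⟩ := hb z hz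
  refine ⟨s ∩ U, inter_mem hs self_mem_nhdsWithin, ?_⟩
  refine Integrable.mono (hs'.mono_set inter_subset_left) (hg.mono_set inter_subset_right) ?_
  refine ae_restrict_of_ae_restrict_of_subset inter_subset_right ?_
  filter_upwards [h] with z hz using hz.trans (le_abs_self _)

variable [NormedAddCommGroup X] [InnerProductSpace ℝ X] [NormedAddCommGroup Y]
  [InnerProductSpace ℝ Y]

/-- Strongly measurable, locally bounded families of operators. -/
structure IsCoef (U : Set (Fin N → ℝ)) (B : (Fin N → ℝ) → X →L[ℝ] Y) : Prop where
  meas : ∀ x, AEStronglyMeasurable (fun z => B z x) (volume.restrict U)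
  bdd : ∃ b : (Fin N → ℝ) → ℝ, ContinuousOn b U ∧ ∀ᵐ z ∂volume.restrict U, ‖B z‖ ≤ b z

/-- `B'` is the derivative of `B` in the `j`-th coordinate, in the sense that the matrix elements
of `B` satisfy the product rule with respect to weakly differentiable functions. -/
structure CoefDeriv (U : Set (Fin N → ℝ)) (j : Fin N) (B B' : (Fin N → ℝ) → X →L[ℝ] Y) : Prop where
  left : IsCoef U B
  right : IsCoef U B'
  mul : ∀ (x : X) (y : Y) (h h' : (Fin N → ℝ) → ℝ), HasWeakDeriv U j h h' →
    HasWeakDeriv U j (fun z => inner ℝ y (B z x) * h z)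
      (fun z => inner ℝ y (B' z x) * h z + inner ℝ y (B z x) * h' z)

/-- Measurability is known only for `B z x` with fixed `x`. Projecting `u z` to finite dimensions
makes `B z (u z)` a limit of finite sums of measurable scalars times such functions. -/
theorem IsCoef.aestronglyMeasurable [CompleteSpace X] [TopologicalSpace.SeparableSpace X]
    {B : (Fin N → ℝ) → X →L[ℝ] Y} (hB : IsCoef U B) {u : (Fin N → ℝ) → X}
    (hu : AEStronglyMeasurable u (volume.restrict U)) :
    AEStronglyMeasurable (fun z => B z (u z)) (volume.restrict U) := by
  obtain ⟨d, b, hb⟩ := exists_finiteRank_approx X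
  refine aestronglyMeasurable_of_tendsto_ae atTop
    (f := fun n z => B z (∑ i, inner ℝ (b n i) (u z) • b n i)) (fun n => ?_)
    (Eventually.of_forall fun z => ((B z).continuous.tendsto _).comp (hb (u z)).1)
  simp only [map_sum, map_smul]
  exact Finset.aestronglyMeasurable_fun_sum _ fun i _ =>
    (aestronglyMeasurable_const.inner hu).smul (hB.meas _)

theorem IsCoef.locallyIntegrableOn (hU : IsOpen U) [CompleteSpace X]
    [TopologicalSpace.SeparableSpace X] {B : (Fin N → ℝ) → X →L[ℝ] Y} (hB : IsCoef U B)
    {u : (Fin N → ℝ) → X} (hu : LocallyIntegrableOn u U volume) :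
    LocallyIntegrableOn (fun z => B z (u z)) U volume := by
  obtain ⟨b, hb, hb'⟩ := hB.bdd
  refine locallyIntegrableOn_of_norm_le (hu.norm.continuousOn_mul hb hU.isLocallyClosed)
    (hB.aestronglyMeasurable hu.aestronglyMeasurable) ?_
  filter_upwards [hb'] with z hz
  exact (B z).le_of_opNorm_le hz _

/-- The coordinates of `B* y` are the matrix elements of `B`, hence measurable; the finite rank
expansion in `X` turns this weak measurability into strong measurability. -/
theorem IsCoef.adjointCoef [CompleteSpace X] [CompleteSpace Y] [TopologicalSpace.SeparableSpace X]
    {B : (Fin N → ℝ) → X →L[ℝ] Y} (hB : IsCoef U B) :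
    IsCoef U fun z => ContinuousLinearMap.adjoint (B z) where
  meas y := by
    obtain ⟨d, b, hb⟩ := exists_finiteRank_approx X
    refine aestronglyMeasurable_of_tendsto_ae atTop
      (f := fun n z => ∑ i, inner ℝ (b n i) (ContinuousLinearMap.adjoint (B z) y) • b n i)
      (fun n => ?_) (Eventually.of_forall fun z => (hb _).1)
    simp only [ContinuousLinearMap.adjoint_inner_right]
    exact Finset.aestronglyMeasurable_fun_sum _ fun i _ =>
      ((hB.meas _).inner aestronglyMeasurable_const).smul_const _
  bdd := by
    obtain ⟨b, hb, hb'⟩ := hB.bdd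
    exact ⟨b, hb, by simpa only [LinearIsometryEquiv.norm_map] using hb'⟩

/-- Passing to the adjoint only swaps the two vectors in a matrix element. Defining the derivative
of a coefficient through matrix elements makes this immediate. -/
theorem CoefDeriv.adjointCoef [CompleteSpace X] [CompleteSpace Y] [TopologicalSpace.SeparableSpace X]
    {j : Fin N} {B B' : (Fin N → ℝ) → X →L[ℝ] Y} (hB : CoefDeriv U j B B') :
    CoefDeriv U j (fun z => ContinuousLinearMap.adjoint (B z))
      (fun z => ContinuousLinearMap.adjoint (B' z)) where
  left := hB.left.adjointCoef
  right := hB.right.adjointCoef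
  mul y x h h' hh := by
    simp only [ContinuousLinearMap.adjoint_inner_right]
    simpa only [real_inner_comm] using hB.mul x y h h' hh

/-- The product rule for operator-valued coefficients. -/
theorem CoefDeriv.hasWeakDeriv (hU : IsOpen U) [CompleteSpace X]
    [TopologicalSpace.SeparableSpace X] [CompleteSpace Y] {j : Fin N}
    {B B' : (Fin N → ℝ) → X →L[ℝ] Y} (hB : CoefDeriv U j B B') {u u' : (Fin N → ℝ) → X}
    (hu : HasWeakDeriv U j u u') :
    HasWeakDeriv U j (fun z => B z (u z)) (fun z => B' z (u z) + B z (u' z)) := by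
  obtain ⟨d, b, hb⟩ := exists_finiteRank_approx X
  obtain ⟨β, hβ, hβ'⟩ := hB.left.bdd
  obtain ⟨γ, hγ, hγ'⟩ := hB.right.bdd
  -- Replace `u` by its projections. Then only finitely many matrix columns of `B` occur, for which
  -- the product rule is the definition of `CoefDeriv`, and projections do not increase norms, which
  -- gives the dominating function.
  refine HasWeakDeriv.of_tendsto
    (F := fun n z => B z (∑ i, inner ℝ (b n i) (u z) • b n i))
    (G := fun n z => B' z (∑ i, inner ℝ (b n i) (u z) • b n i) +
      B z (∑ i, inner ℝ (b n i) (u' z) • b n i))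
    (b := fun z => β z * ‖u z‖ + (γ z * ‖u z‖ + β z * ‖u' z‖)) (fun n => ?_) ?_
    (fun n => ?_) (fun n => ?_) ?_ ?_
  · simp only [map_sum, map_smul, ← Finset.sum_add_distrib]
    refine HasWeakDeriv.sum _ fun i _ => ?_
    have hi : HasWeakDeriv U j (fun z => inner ℝ (b n i) (u z)) (fun z => inner ℝ (b n i) (u' z)) :=
      hu.clm_comp (innerSL ℝ (b n i))
    have hloc : ∀ (C : (Fin N → ℝ) → X →L[ℝ] Y) (v : (Fin N → ℝ) → X), IsCoef U C →
        LocallyIntegrableOn v U volume →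
        LocallyIntegrableOn (fun z => inner ℝ (b n i) (v z) • C z (b n i)) U volume := by
      intro C v hC hv
      have := hC.locallyIntegrableOn hU (LocallyIntegrableOn.clm_comp
        ((innerSL ℝ (b n i)).smulRight (b n i)) hv)
      simpa using this
    refine HasWeakDeriv.of_inner (hloc _ _ hB.left hu.left)
      ((hloc _ _ hB.right hu.left).add (hloc _ _ hB.left hu.right)) fun y => ?_
    have := hB.mul (b n i) y _ _ hi
    simpa only [inner_add_right, inner_smul_right, mul_comm] using this
  · exact (hu.left.norm.continuousOn_mul hβ hU.isLocallyClosed).add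
      ((hu.left.norm.continuousOn_mul hγ hU.isLocallyClosed).add
        (hu.right.norm.continuousOn_mul hβ hU.isLocallyClosed))
  · filter_upwards [hβ', hγ'] with z h1 h2
    have h3 := (norm_nonneg _).trans h1
    have h4 := (norm_nonneg _).trans h2
    have : 0 ≤ γ z * ‖u z‖ + β z * ‖u' z‖ := by positivity
    exact ((B z).le_of_opNorm_le_of_le h1 ((hb (u z)).2 n)).trans (by linarith)
  · filter_upwards [hβ', hγ'] with z h1 h2
    have h3 := (norm_nonneg _).trans h1
    have : 0 ≤ β z * ‖u z‖ := by positivity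
    refine (norm_add_le_of_le ((B' z).le_of_opNorm_le_of_le h2 ((hb (u z)).2 n))
      ((B z).le_of_opNorm_le_of_le h1 ((hb (u' z)).2 n))).trans (by linarith)
  · exact Eventually.of_forall fun z => ((B z).continuous.tendsto _).comp (hb (u z)).1
  · exact Eventually.of_forall fun z => (((B' z).continuous.tendsto _).comp (hb (u z)).1).add
      (((B z).continuous.tendsto _).comp (hb (u' z)).1)

end Coefficients

/-! ### Weak differentiability of solutions -/

section Richardson

open ContinuousLinearMap (adjoint)

variable {X Y : Type*} [NormedAddCommGroup X] [InnerProductSpace ℝ X] [CompleteSpace X]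
  [NormedAddCommGroup Y] [InnerProductSpace ℝ Y] [CompleteSpace Y]

/-- Expand the square: with `θ = C⁻²` the term θ²‖B*Bx‖² is at most θ‖Bx‖² and eats half of the
cross term -2θ‖Bx‖². What remains is ‖x‖² - θ‖Bx‖². -/
theorem norm_sub_smul_adjoint_le {B : X →L[ℝ] Y} {c C : ℝ} (hc : 0 < c) (hC : 0 < C)
    (hlow : ∀ x, c * ‖x‖ ≤ ‖B x‖) (hup : ‖B‖ ≤ C) (x : X) :
    ‖x - (C ^ 2)⁻¹ • adjoint B (B x)‖ ≤ √(1 - c ^ 2 / C ^ 2) * ‖x‖ := by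
  have h1 : ‖x - (C ^ 2)⁻¹ • adjoint B (B x)‖ ^ 2 ≤ (1 - c ^ 2 / C ^ 2) * ‖x‖ ^ 2 := by
    have h2 : ‖adjoint B (B x)‖ ≤ C * ‖B x‖ :=
      (adjoint B).le_of_opNorm_le (by simpa using hup) _
    have h3 : inner ℝ x (adjoint B (B x)) = ‖B x‖ ^ 2 := by
      rw [ContinuousLinearMap.adjoint_inner_right, real_inner_self_eq_norm_sq]
    rw [norm_sub_sq_real, norm_smul, inner_smul_right, h3, Real.norm_of_nonneg (by positivity)]
    have h4 : ((C ^ 2)⁻¹ * ‖adjoint B (B x)‖) ^ 2 ≤ (C ^ 2)⁻¹ * ‖B x‖ ^ 2 := by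
      have : ((C ^ 2)⁻¹ * ‖adjoint B (B x)‖) ^ 2 ≤ ((C ^ 2)⁻¹ * (C * ‖B x‖)) ^ 2 := by gcongr
      refine this.trans (le_of_eq ?_)
      field_simp
    have h5 : c ^ 2 / C ^ 2 * ‖x‖ ^ 2 ≤ (C ^ 2)⁻¹ * ‖B x‖ ^ 2 := by
      have : (c * ‖x‖) ^ 2 ≤ ‖B x‖ ^ 2 := by gcongr; exact hlow x
      calc c ^ 2 / C ^ 2 * ‖x‖ ^ 2 = (C ^ 2)⁻¹ * (c * ‖x‖) ^ 2 := by ring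
        _ ≤ _ := by gcongr
    linarith
  rw [← Real.sqrt_sq (norm_nonneg x), ← Real.sqrt_mul' _ (sq_nonneg _)]
  exact Real.le_sqrt_of_sq_le h1

theorem sqrt_one_sub_lt_one {c C : ℝ} (hc : 0 < c) (hC : 0 < C) : √(1 - c ^ 2 / C ^ 2) < 1 := by
  rw [Real.sqrt_lt' one_pos]
  have : 0 < c ^ 2 / C ^ 2 := by positivity
  linarith

/-- The Neumann series for `1 - K`. -/
theorem exists_eq_add_of_contraction {K : X →L[ℝ] X} {k : ℝ} (hk0 : 0 ≤ k) (hk : k < 1)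
    (hK : ∀ x, ‖K x‖ ≤ k * ‖x‖) (d : X) : ∃ v, v = K v + d ∧ ‖v‖ ≤ ‖d‖ / (1 - k) := by
  have h1 : ‖K‖ < 1 := (K.opNorm_le_bound hk0 hK).trans_lt hk
  obtain ⟨e, he⟩ := isUnit_one_sub_of_norm_lt_one h1
  let v := (e⁻¹ : (X →L[ℝ] X)ˣ).1 d
  have hv : v - K v = d := by
    have : ((e : X →L[ℝ] X) * (e⁻¹ : (X →L[ℝ] X)ˣ).1) d = d := by simp
    rw [he] at this
    simpa [v] using this
  refine ⟨v, by rw [← hv]; abel, ?_⟩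
  rw [le_div_iff₀ (by linarith)]
  have h2 := norm_sub_norm_le v (K v)
  have h3 := hK v
  rw [hv] at h2
  nlinarith

/-- The forcing decays at the same rate `k` as the contraction, so the solution behaves like `n k ^
n`; any ratio `r > k` absorbs the factor `n`. -/
theorem le_geometric_of_recurrence {e : ℕ → ℝ} {k r L : ℝ} (hk : 0 ≤ k) (hkr : k < r)
    (hL : 0 ≤ L) (h0 : 0 ≤ e 0) (he : ∀ n, e (n + 1) ≤ k * e n + L * k ^ n) (n : ℕ) :
    e n ≤ r ^ n * (e 0 + L / (r - k)) := by
  have hd : 0 < r - k := by linarith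
  induction n with
  | zero => have : 0 ≤ L / (r - k) := by positivity
            simpa using this
  | succ n ih =>
    have h1 : k ^ n ≤ r ^ n := by gcongr
    have h2 : 0 ≤ r ^ n := pow_nonneg (hk.trans hkr.le) n
    calc e (n + 1) ≤ k * e n + L * k ^ n := he n
      _ ≤ k * (r ^ n * (e 0 + L / (r - k))) + L * r ^ n := by gcongr
      _ = r ^ n * (k * e 0 + r * (L / (r - k))) := by field_simp; ring
      _ ≤ r ^ n * (r * e 0 + r * (L / (r - k))) := by gcongr
      _ = _ := by ring

variable {N : ℕ} {U : Set (Fin N → ℝ)}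

/-- The Richardson iteration for the normal equation of `B u = f`. -/
noncomputable def richardson (θ : ℝ) (B : (Fin N → ℝ) → X →L[ℝ] Y) (f : (Fin N → ℝ) → Y) :
    ℕ → (Fin N → ℝ) → X
  | 0 => fun _ => 0
  | n + 1 => fun z => richardson θ B f n z + θ • adjoint (B z) (f z - B z (richardson θ B f n z))

/-- The formal derivative of the Richardson iteration. -/
noncomputable def richardsonDeriv (θ : ℝ) (B B' : (Fin N → ℝ) → X →L[ℝ] Y)
    (f f' : (Fin N → ℝ) → Y) : ℕ → (Fin N → ℝ) → X
  | 0 => fun _ => 0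
  | n + 1 => fun z => richardsonDeriv θ B B' f f' n z +
      θ • (adjoint (B' z) (f z - B z (richardson θ B f n z)) +
        adjoint (B z) (f' z -
          (B' z (richardson θ B f n z) + B z (richardsonDeriv θ B B' f f' n z))))

/-- The error is multiplied by `1 - θ B* B` in each step and equals `-x` at the start. -/
theorem norm_richardson_sub_le {B : (Fin N → ℝ) → X →L[ℝ] Y} {f : (Fin N → ℝ) → Y}
    {c C : ℝ} (hc : 0 < c) (hC : 0 < C) {z : Fin N → ℝ} {x : X}
    (hlow : ∀ x, c * ‖x‖ ≤ ‖B z x‖) (hup : ‖B z‖ ≤ C) (hx : B z x = f z) (n : ℕ) :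
    ‖richardson (C ^ 2)⁻¹ B f n z - x‖ ≤ √(1 - c ^ 2 / C ^ 2) ^ n * ‖x‖ := by
  induction n with
  | zero => simp [richardson]
  | succ n ih =>
    have : richardson (C ^ 2)⁻¹ B f (n + 1) z - x = (richardson (C ^ 2)⁻¹ B f n z - x) -
        (C ^ 2)⁻¹ • adjoint (B z) (B z (richardson (C ^ 2)⁻¹ B f n z - x)) := by
      simp only [richardson, ← hx, map_sub, smul_sub]
      abel
    rw [this]
    refine (norm_sub_smul_adjoint_le hc hC hlow hup _).trans ?_
    rw [pow_succ' (√(1 - c ^ 2 / C ^ 2)), mul_assoc]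
    gcongr

theorem tendsto_richardson {B : (Fin N → ℝ) → X →L[ℝ] Y} {f : (Fin N → ℝ) → Y}
    {c C : ℝ} (hc : 0 < c) (hC : 0 < C) {z : Fin N → ℝ} {x : X}
    (hlow : ∀ x, c * ‖x‖ ≤ ‖B z x‖) (hup : ‖B z‖ ≤ C) (hx : B z x = f z) :
    Tendsto (fun n => richardson (C ^ 2)⁻¹ B f n z) atTop (𝓝 x) := by
  rw [tendsto_iff_norm_sub_tendsto_zero]
  refine squeeze_zero (fun n => norm_nonneg _)
    (norm_richardson_sub_le hc hC hlow hup hx) ?_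
  simpa using (tendsto_pow_atTop_nhds_zero_of_lt_one (Real.sqrt_nonneg _)
    (sqrt_one_sub_lt_one hc hC)).mul_const ‖x‖

/-- Solutions of `B u = f` are measurable. -/
theorem IsCoef.aestronglyMeasurable_of_eq [TopologicalSpace.SeparableSpace X]
    [TopologicalSpace.SeparableSpace Y] {B : (Fin N → ℝ) → X →L[ℝ] Y} (hB : IsCoef U B)
    {c C : ℝ} (hc : 0 < c) (hC : 0 < C)
    (hlow : ∀ᵐ z ∂volume.restrict U, ∀ x, c * ‖x‖ ≤ ‖B z x‖)
    (hup : ∀ᵐ z ∂volume.restrict U, ‖B z‖ ≤ C) {u : (Fin N → ℝ) → X} {f : (Fin N → ℝ) → Y}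
    (hf : AEStronglyMeasurable f (volume.restrict U))
    (hu : ∀ᵐ z ∂volume.restrict U, B z (u z) = f z) :
    AEStronglyMeasurable u (volume.restrict U) := by
  have h : ∀ n, AEStronglyMeasurable (richardson (C ^ 2)⁻¹ B f n) (volume.restrict U) := by
    intro n
    induction n with
    | zero => exact aestronglyMeasurable_const
    | succ n ih =>
      exact ih.add ((hB.adjointCoef.aestronglyMeasurable
        (hf.sub (hB.aestronglyMeasurable ih))).const_smul _)
  refine aestronglyMeasurable_of_tendsto_ae atTop h ?_
  filter_upwards [hlow, hup, hu] with z h1 h2 h3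
  exact tendsto_richardson hc hC h1 h2 h3

/-- Solutions of `B u = f` with weakly differentiable `B` and `f` are weakly differentiable. -/
theorem CoefDeriv.exists_hasWeakDeriv_of_eq (hU : IsOpen U) [TopologicalSpace.SeparableSpace X]
    [TopologicalSpace.SeparableSpace Y] {j : Fin N} {B B' : (Fin N → ℝ) → X →L[ℝ] Y}
    (hB : CoefDeriv U j B B') {c C : ℝ} (hc : 0 < c) (hC : 0 < C)
    (hlow : ∀ᵐ z ∂volume.restrict U, ∀ x, c * ‖x‖ ≤ ‖B z x‖)
    (hup : ∀ᵐ z ∂volume.restrict U, ‖B z‖ ≤ C) {u : (Fin N → ℝ) → X} {f f' : (Fin N → ℝ) → Y}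
    (hf : HasWeakDeriv U j f f') (hu : ∀ᵐ z ∂volume.restrict U, B z (u z) = f z) :
    ∃ u', HasWeakDeriv U j u u' := by
  set θ : ℝ := (C ^ 2)⁻¹ with hθ
  have hθ0 : 0 ≤ θ := by positivity
  set k : ℝ := √(1 - c ^ 2 / C ^ 2) with hk
  have hk0 : 0 ≤ k := Real.sqrt_nonneg _
  have hk1 : k < 1 := sqrt_one_sub_lt_one hc hC
  obtain ⟨γ, hγ, hγ'⟩ := hB.right.bdd
  have hder : ∀ n, HasWeakDeriv U j (richardson θ B f n) (richardsonDeriv θ B B' f f' n) := by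
    intro n
    induction n with
    | zero => exact HasWeakDeriv.zero
    | succ n ih =>
      exact ih.add ((hB.adjointCoef.hasWeakDeriv hU (hf.sub (hB.hasWeakDeriv hU ih))).const_smul θ)
  have hum : AEStronglyMeasurable u (volume.restrict U) :=
    hB.left.aestronglyMeasurable_of_eq hc hC hlow hup hf.left.aestronglyMeasurable hu
  have huint : LocallyIntegrableOn u U volume := by
    refine locallyIntegrableOn_of_norm_le (hf.left.norm.smul c⁻¹) hum ?_
    filter_upwards [hlow, hu] with z h1 h2
    have := h1 (u z)
    rw [h2] at this
    simp only [Pi.smul_apply, smul_eq_mul]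
    rw [inv_mul_eq_div, le_div_iff₀ hc]
    linarith
  let κ : (Fin N → ℝ) → X →L[ℝ] X := fun z =>
    ContinuousLinearMap.id ℝ X - θ • (adjoint (B z)).comp (B z)
  -- The candidate for the derivative solves the normal equation B*B v = B*(f' - B'u), written as a
  -- fixed point of the contraction. It is chosen pointwise; its measurability comes later, from the
  -- iterates that converge to it.
  have hex : ∀ z, ∃ v : X, (∀ x, c * ‖x‖ ≤ ‖B z x‖) → ‖B z‖ ≤ C →
      v = κ z v + θ • adjoint (B z) (f' z - B' z (u z)) ∧
      ‖v‖ ≤ ‖θ • adjoint (B z) (f' z - B' z (u z))‖ / (1 - k) := by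
    intro z
    by_cases h : (∀ x, c * ‖x‖ ≤ ‖B z x‖) ∧ ‖B z‖ ≤ C
    · obtain ⟨v, hv⟩ := exists_eq_add_of_contraction (K := κ z) hk0 hk1
        (fun x => norm_sub_smul_adjoint_le hc hC h.1 h.2 x)
        (θ • adjoint (B z) (f' z - B' z (u z)))
      exact ⟨v, fun _ _ => hv⟩
    · exact ⟨0, fun h1 h2 => (h ⟨h1, h2⟩).elim⟩
  choose v hv using hex
  -- Any ratio strictly between `k` and 1 would do.
  set r : ℝ := (1 + k) / 2 with hr
  have hkr : k < r := by rw [hr]; linarith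
  have hr1 : r < 1 := by rw [hr]; linarith
  let D : (Fin N → ℝ) → ℝ := fun z => θ * (C * (‖f' z‖ + γ z * ‖u z‖)) / (1 - k)
  let Λ : (Fin N → ℝ) → ℝ := fun z => θ * (γ z * (C * ‖u z‖) + C * (γ z * ‖u z‖))
  have hmain : ∀ᵐ z ∂volume.restrict U, 0 ≤ D z ∧ 0 ≤ Λ z ∧ ‖v z‖ ≤ D z ∧
      ∀ n, ‖richardsonDeriv θ B B' f f' n z - v z‖ ≤ r ^ n * (D z + Λ z / (r - k)) := by
    filter_upwards [hlow, hup, hu, hγ'] with z h1 h2 h3 h4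
    have hγ0 : 0 ≤ γ z := (norm_nonneg _).trans h4
    have had : ‖adjoint (B z)‖ ≤ C := by simpa using h2
    have had' : ‖adjoint (B' z)‖ ≤ γ z := by simpa using h4
    obtain ⟨hv1, hv2⟩ := hv z h1 h2
    have hD : ‖v z‖ ≤ D z := by
      refine hv2.trans ?_
      have h1k : 0 < 1 - k := by linarith
      simp only [D]
      gcongr
      rw [norm_smul, Real.norm_of_nonneg hθ0]
      gcongr
      refine (adjoint (B z)).le_of_opNorm_le_of_le had ((norm_sub_le _ _).trans ?_)
      gcongr
      exact (B' z).le_of_opNorm_le h4 _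
    have hΛ : 0 ≤ Λ z := by positivity
    refine ⟨(norm_nonneg _).trans hD, hΛ, hD, fun n => ?_⟩
    have hrec : ∀ n, ‖richardsonDeriv θ B B' f f' (n + 1) z - v z‖ ≤
        k * ‖richardsonDeriv θ B B' f f' n z - v z‖ + Λ z * k ^ n := by
      intro n
      -- All terms in which `f - B u` survives have cancelled: `B'` and its adjoint meet only the
      -- error of the Richardson iteration, which is O(k ^ n).
      have hsplit : richardsonDeriv θ B B' f f' (n + 1) z - v z =
          κ z (richardsonDeriv θ B B' f f' n z - v z) -
            θ • (adjoint (B' z) (B z (richardson θ B f n z - u z)) +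
              adjoint (B z) (B' z (richardson θ B f n z - u z))) := by
        nth_rewrite 1 [hv1]
        simp only [richardsonDeriv, κ, ← h3, map_sub, map_add, smul_sub, smul_add,
          sub_apply, ContinuousLinearMap.id_apply,
          smul_apply, ContinuousLinearMap.comp_apply]
        abel
      rw [hsplit]
      have hR : ‖richardson θ B f n z - u z‖ ≤ k ^ n * ‖u z‖ :=
        norm_richardson_sub_le hc hC h1 h2 h3 n
      refine norm_sub_le_of_le (norm_sub_smul_adjoint_le hc hC h1 h2 _) ?_
      rw [norm_smul, Real.norm_of_nonneg hθ0]
      have e1 : ‖adjoint (B' z) (B z (richardson θ B f n z - u z))‖ ≤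
          γ z * (C * (k ^ n * ‖u z‖)) :=
        (adjoint (B' z)).le_of_opNorm_le_of_le had' ((B z).le_of_opNorm_le_of_le h2 hR)
      have e2 : ‖adjoint (B z) (B' z (richardson θ B f n z - u z))‖ ≤
          C * (γ z * (k ^ n * ‖u z‖)) :=
        (adjoint (B z)).le_of_opNorm_le_of_le had ((B' z).le_of_opNorm_le_of_le h4 hR)
      calc θ * ‖_ + _‖ ≤ θ * (γ z * (C * (k ^ n * ‖u z‖)) + C * (γ z * (k ^ n * ‖u z‖))) := by
            gcongr
            exact norm_add_le_of_le e1 e2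
        _ = Λ z * k ^ n := by simp only [Λ]; ring
    have hrn := le_geometric_of_recurrence
      (e := fun n => ‖richardsonDeriv θ B B' f f' n z - v z‖) hk0 hkr hΛ (norm_nonneg _) hrec n
    refine hrn.trans ?_
    have : 0 ≤ r ^ n := pow_nonneg (hk0.trans hkr.le) n
    gcongr
    simpa [richardsonDeriv] using hD
  have hγu : LocallyIntegrableOn (fun z => γ z * ‖u z‖) U volume :=
    huint.norm.continuousOn_mul hγ hU.isLocallyClosed
  have hDint : LocallyIntegrableOn D U volume := by
    refine ((hf.right.norm.add hγu).smul (θ * C / (1 - k))).congr (Eventually.of_forall fun z => ?_)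
    simp only [Pi.smul_apply, Pi.add_apply, smul_eq_mul, D]
    ring
  have hΛint : LocallyIntegrableOn Λ U volume := by
    refine (hγu.smul (2 * θ * C)).congr (Eventually.of_forall fun z => ?_)
    simp only [Pi.smul_apply, smul_eq_mul, Λ]
    ring
  have hrk : 0 < r - k := by linarith
  refine ⟨v, HasWeakDeriv.of_tendsto
    (b := fun z => (2 : ℝ) • D z + ((r - k)⁻¹ • Λ z + (2 : ℝ) • ‖u z‖)) hder
    ((hDint.smul (2 : ℝ)).add ((hΛint.smul (r - k)⁻¹).add (huint.norm.smul (2 : ℝ)))) (fun n => ?_)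
    (fun n => ?_) ?_ ?_⟩
  · filter_upwards [hlow, hup, hu, hmain] with z h1 h2 h3 ⟨h4, h5, _, _⟩
    have hR : ‖richardson θ B f n z - u z‖ ≤ k ^ n * ‖u z‖ :=
      norm_richardson_sub_le hc hC h1 h2 h3 n
    have hkn : k ^ n * ‖u z‖ ≤ 1 * ‖u z‖ := by
      gcongr
      exact pow_le_one₀ hk0 hk1.le
    have h6 : ‖richardson θ B f n z‖ ≤ ‖u z‖ + ‖richardson θ B f n z - u z‖ :=
      norm_le_norm_add_norm_sub' _ _
    have h7 : 0 ≤ (r - k)⁻¹ * Λ z := by positivity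
    simp only [smul_eq_mul]
    linarith
  · filter_upwards [hmain] with z ⟨h4, h5, h6, h7⟩
    have h8 := h7 n
    have h9 : ‖richardsonDeriv θ B B' f f' n z‖ ≤
      ‖v z‖ + ‖richardsonDeriv θ B B' f f' n z - v z‖ := norm_le_norm_add_norm_sub' _ _
    have h10 : r ^ n * (D z + Λ z / (r - k)) ≤ 1 * (D z + Λ z / (r - k)) := by
      gcongr
      exact pow_le_one₀ (hk0.trans hkr.le) hr1.le
    rw [div_eq_inv_mul] at h10 h8
    have := norm_nonneg (u z)
    simp only [smul_eq_mul]
    linarith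
  · filter_upwards [hlow, hup, hu] with z h1 h2 h3
    exact tendsto_richardson hc hC h1 h2 h3
  · filter_upwards [hmain] with z ⟨h4, h5, h6, h7⟩
    rw [tendsto_iff_norm_sub_tendsto_zero]
    refine squeeze_zero (fun n => norm_nonneg _) h7 ?_
    simpa using (tendsto_pow_atTop_nhds_zero_of_lt_one (hk0.trans hkr.le) hr1).mul_const
      (D z + Λ z / (r - k))

end Richardson

/-! ### Iterated weak derivatives along words -/

section Words

/-- All ways to distribute the letters of a word over two words. -/
def splits {ι : Type*} : List ι → List (List ι × List ι)
  | [] => [([], [])]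
  | j :: w => (splits w).map (fun p => (j :: p.1, p.2)) ++ (splits w).map (fun p => (p.1, j :: p.2))

/-- The distributions of letters in which the first word is not empty. -/
def properSplits {ι : Type*} : List ι → List (List ι × List ι)
  | [] => []
  | j :: w =>
    (splits w).map (fun p => (j :: p.1, p.2)) ++ (properSplits w).map (fun p => (p.1, j :: p.2))

variable {ι : Type*}

theorem length_of_mem_splits {w : List ι} {p : List ι × List ι} (h : p ∈ splits w) :
    p.1.length + p.2.length = w.length := by
  induction w generalizing p with
  | nil => simp_all [splits]
  | cons j w ih =>
    simp only [splits, List.mem_append, List.mem_map] at h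
    rcases h with ⟨p', h, rfl⟩ | ⟨p', h, rfl⟩ <;> have := ih h <;>
      simp only [List.length_cons] <;> omega

theorem count_of_mem_splits [DecidableEq ι] {w : List ι} {p : List ι × List ι} (h : p ∈ splits w)
    (i : ι) : p.1.count i + p.2.count i = w.count i := by
  induction w generalizing p with
  | nil => simp_all [splits]
  | cons j w ih =>
    simp only [splits, List.mem_append, List.mem_map] at h
    rcases h with ⟨p', h, rfl⟩ | ⟨p', h, rfl⟩ <;> have := ih h <;>
      simp only [List.count_cons] <;> omega

theorem mem_splits_of_mem_properSplits {w : List ι} {p : List ι × List ι}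
    (h : p ∈ properSplits w) : p ∈ splits w := by
  induction w generalizing p with
  | nil => simp [properSplits] at h
  | cons j w ih =>
    simp only [properSplits, splits, List.mem_append, List.mem_map] at h ⊢
    exact h.imp id fun ⟨p', h1, h2⟩ => ⟨p', ih h1, h2⟩

theorem fst_ne_nil_of_mem_properSplits {w : List ι} {p : List ι × List ι}
    (h : p ∈ properSplits w) : p.1 ≠ [] := by
  induction w generalizing p with
  | nil => simp [properSplits] at h
  | cons j w ih =>
    simp only [properSplits, List.mem_append, List.mem_map] at h
    rcases h with ⟨p', h, rfl⟩ | ⟨p', h, rfl⟩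
    · simp
    · exact ih (p := p') h

theorem length_splits (w : List ι) : (splits w).length = 2 ^ w.length := by
  induction w with
  | nil => simp [splits]
  | cons j w ih => simp [splits, ih, pow_succ]; ring

theorem length_properSplits_le (w : List ι) : (properSplits w).length ≤ 2 ^ w.length := by
  induction w with
  | nil => simp [properSplits]
  | cons j w ih => simp only [properSplits, List.length_append, List.length_map, length_splits,
      List.length_cons, pow_succ]; omega

/-- Isolates the split that puts the whole word on the second factor. In the Leibniz formula this is
the top order term, the one to be solved for. -/
theorem sum_splits {M : Type*} [AddCommMonoid M] (g : List ι × List ι → M) (w : List ι) :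
    ((splits w).map g).sum = g ([], w) + ((properSplits w).map g).sum := by
  induction w generalizing g with
  | nil => simp [splits, properSplits]
  | cons j w ih =>
    simp only [splits, properSplits, List.map_append, List.sum_append, List.map_map]
    rw [ih (g ∘ fun p => (p.1, j :: p.2))]
    simp only [Function.comp_apply]
    abel

end Words

/-! ### Jets of weak derivatives and the Leibniz rule -/

section Jets

variable {N : ℕ} {U : Set (Fin N → ℝ)} {X Y : Type*}

/-- `F w` is the iterated weak derivative of `F []` along the word `w`, for all words of length at
most `q`; the first letter of a word is the last derivative taken. -/
structure IsJet [NormedAddCommGroup X] [NormedSpace ℝ X] (U : Set (Fin N → ℝ)) (q : ℕ)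
    (F : List (Fin N) → (Fin N → ℝ) → X) : Prop where
  loc : ∀ w, w.length ≤ q → LocallyIntegrableOn (F w) U volume
  deriv : ∀ w j, w.length < q → HasWeakDeriv U j (F w) (F (j :: w))

theorem locallyIntegrableOn_list_sum {X : Type*} [NormedAddCommGroup X] {κ : Type*} (l : List κ) {f : κ → (Fin N → ℝ) → X}
    (h : ∀ p ∈ l, LocallyIntegrableOn (f p) U volume) :
    LocallyIntegrableOn (fun z => (l.map fun p => f p z).sum) U volume := by
  induction l with
  | nil => simpa using locallyIntegrableOn_zero
  | cons p l ih =>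
    simp only [List.map_cons, List.sum_cons]
    exact (h p (by simp)).add (ih fun p' hp' => h p' (by simp [hp']))

section Normed

variable [NormedAddCommGroup X] [NormedSpace ℝ X] [NormedAddCommGroup Y] [NormedSpace ℝ Y]
  {q : ℕ} {F G : List (Fin N) → (Fin N → ℝ) → X}

theorem IsJet.mono (h : IsJet U q F) {q' : ℕ} (hq : q' ≤ q) : IsJet U q' F :=
  ⟨fun w hw => h.loc w (hw.trans hq), fun w j hw => h.deriv w j (hw.trans_le hq)⟩

theorem IsJet.sub (hF : IsJet U q F) (hG : IsJet U q G) : IsJet U q fun w z => F w z - G w z :=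
  ⟨fun w hw => (hF.loc w hw).sub (hG.loc w hw),
    fun w j hw => (hF.deriv w j hw).sub (hG.deriv w j hw)⟩

theorem IsJet.clm_comp [CompleteSpace X] [CompleteSpace Y] (hF : IsJet U q F) (L : X →L[ℝ] Y) :
    IsJet U q fun w z => L (F w z) :=
  ⟨fun w hw => LocallyIntegrableOn.clm_comp L (hF.loc w hw),
    fun w j hw => (hF.deriv w j hw).clm_comp L⟩

/-- The last letter of a word is the first derivative taken, so appending `j` gives the jet of the
`j`-th partial derivative. -/
theorem IsJet.shift (hF : IsJet U (q + 1) F) (j : Fin N) : IsJet U q fun w => F (w ++ [j]) :=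
  ⟨fun w hw => hF.loc _ (by simpa using hw), fun w i hw => hF.deriv (w ++ [j]) i (by simpa using hw)⟩

theorem IsJet.ae_eq [CompleteSpace X] (hU : IsOpen U) (hF : IsJet U q F) (hG : IsJet U q G)
    (h0 : F [] =ᵐ[volume.restrict U] G []) :
    ∀ w : List (Fin N), w.length ≤ q → F w =ᵐ[volume.restrict U] G w
  | [], _ => h0
  | j :: w, hw => by
    have hw' : w.length < q := by simpa using hw
    exact ((hF.deriv w j hw').congr (IsJet.ae_eq hU hF hG h0 w hw'.le) EventuallyEq.rfl).unique hU
      (hG.deriv w j hw')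

/-- A nonempty word is looked up in the jet that belongs to its last letter, the first derivative
taken. Words are not identified under permutation, so the jets of different partial derivatives need
no compatibility. -/
theorem IsJet.of_partial {u : (Fin N → ℝ) → X} {G : Fin N → List (Fin N) → (Fin N → ℝ) → X}
    (hu : LocallyIntegrableOn u U volume) (hG : ∀ j, IsJet U q (G j))
    (h : ∀ j, HasWeakDeriv U j u (G j [])) :
    ∃ F, IsJet U (q + 1) F ∧ F [] = u := by
  refine ⟨fun w => if h : w = [] then u else G (w.getLast h) w.dropLast, ⟨fun w hw => ?_,
    fun w j hw => ?_⟩, by simp⟩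
  · by_cases hn : w = []
    · simpa [hn] using hu
    · simp only [hn, dite_false]
      exact (hG _).loc _ (by rw [List.length_dropLast]; omega)
  · by_cases hn : w = []
    · subst hn
      simpa using h j
    · have hpos := List.length_pos_iff.2 hn
      simp only [hn, dite_false, reduceCtorEq, List.getLast_cons hn, List.dropLast_cons_of_ne_nil hn]
      exact (hG _).deriv _ j (by rw [List.length_dropLast]; omega)

theorem HasWeakDeriv.list_sum {κ : Type*} (l : List κ) {f g : κ → (Fin N → ℝ) → X} {j : Fin N}
    (h : ∀ p ∈ l, HasWeakDeriv U j (f p) (g p)) :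
    HasWeakDeriv U j (fun z => (l.map fun p => f p z).sum) fun z => (l.map fun p => g p z).sum := by
  induction l with
  | nil => simpa using HasWeakDeriv.zero
  | cons p l ih =>
    simp only [List.map_cons, List.sum_cons]
    exact (h p (by simp)).add (ih fun p' hp' => h p' (by simp [hp']))

end Normed

variable [NormedAddCommGroup X] [InnerProductSpace ℝ X] [NormedAddCommGroup Y]
  [InnerProductSpace ℝ Y] {q ℓ : ℕ}

/-- `B w` is the iterated derivative of `B []` along the word `w`, for words of length at most
`ℓ`. -/
structure IsCoefJet (U : Set (Fin N → ℝ)) (ℓ : ℕ)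
    (B : List (Fin N) → (Fin N → ℝ) → X →L[ℝ] Y) : Prop where
  coef : ∀ w, w.length ≤ ℓ → IsCoef U (B w)
  deriv : ∀ w j, w.length < ℓ → CoefDeriv U j (B w) (B (j :: w))

theorem IsCoefJet.mono {B : List (Fin N) → (Fin N → ℝ) → X →L[ℝ] Y} (h : IsCoefJet U ℓ B) {ℓ' : ℕ}
    (hℓ : ℓ' ≤ ℓ) : IsCoefJet U ℓ' B :=
  ⟨fun w hw => h.coef w (hw.trans hℓ), fun w j hw => h.deriv w j (hw.trans_le hℓ)⟩

theorem IsCoefJet.shift {B : List (Fin N) → (Fin N → ℝ) → X →L[ℝ] Y} (hB : IsCoefJet U (ℓ + 1) B)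
    (j : Fin N) : IsCoefJet U ℓ fun w => B (w ++ [j]) :=
  ⟨fun w hw => hB.coef _ (by simpa using hw),
    fun w i hw => hB.deriv (w ++ [j]) i (by simpa using hw)⟩

/-- The iterated derivatives of a product. -/
noncomputable def leibniz (B : List (Fin N) → (Fin N → ℝ) → X →L[ℝ] Y)
    (F : List (Fin N) → (Fin N → ℝ) → X) (w : List (Fin N)) (z : Fin N → ℝ) : Y :=
  ((splits w).map fun p => B p.1 z (F p.2 z)).sum

theorem leibniz_nil (B : List (Fin N) → (Fin N → ℝ) → X →L[ℝ] Y)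
    (F : List (Fin N) → (Fin N → ℝ) → X) : leibniz B F [] = fun z => B [] z (F [] z) := by
  ext z
  simp [leibniz, splits]

variable [CompleteSpace X] [TopologicalSpace.SeparableSpace X] [CompleteSpace Y]

/-- The Leibniz rule. -/
theorem IsCoefJet.isJet_leibniz (hU : IsOpen U) {B : List (Fin N) → (Fin N → ℝ) → X →L[ℝ] Y}
    (hB : IsCoefJet U q B) {F : List (Fin N) → (Fin N → ℝ) → X} (hF : IsJet U q F) :
    IsJet U q (leibniz B F) where
  loc w hw := locallyIntegrableOn_list_sum _ fun p hp => by
    have := length_of_mem_splits hp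
    exact (hB.coef _ (by omega)).locallyIntegrableOn hU (hF.loc _ (by omega))
  deriv w j hw := by
    have h : HasWeakDeriv U j (leibniz B F w) (fun z => ((splits w).map fun p =>
        B (j :: p.1) z (F p.2 z) + B p.1 z (F (j :: p.2) z)).sum) :=
      HasWeakDeriv.list_sum _ fun p hp => by
        have := length_of_mem_splits hp
        exact (hB.deriv _ j (by omega)).hasWeakDeriv hU (hF.deriv _ j (by omega))
    refine h.congr EventuallyEq.rfl (Eventually.of_forall fun z => ?_)
    simp only [leibniz, splits, List.map_append, List.sum_append, List.map_map,
      List.sum_map_add]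
    rfl

variable [TopologicalSpace.SeparableSpace Y]

/-- Solutions of `B u = f` are as regular as the data. -/
theorem IsCoefJet.exists_isJet_of_eq (hU : IsOpen U)
    {B : List (Fin N) → (Fin N → ℝ) → X →L[ℝ] Y} {c C : ℝ} (hc : 0 < c) (hC : 0 < C)
    (hlow : ∀ᵐ z ∂volume.restrict U, ∀ x, c * ‖x‖ ≤ ‖B [] z x‖)
    (hup : ∀ᵐ z ∂volume.restrict U, ‖B [] z‖ ≤ C) (hB : IsCoefJet U q B)
    {u : (Fin N → ℝ) → X} {Φ : List (Fin N) → (Fin N → ℝ) → Y} (hΦ : IsJet U q Φ)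
    (hu : ∀ᵐ z ∂volume.restrict U, B [] z (u z) = Φ [] z) :
    ∃ F, IsJet U q F ∧ F [] = u := by
  induction q generalizing u Φ with
  | zero =>
    have hum : AEStronglyMeasurable u (volume.restrict U) :=
      (hB.coef [] le_rfl).aestronglyMeasurable_of_eq hc hC hlow hup
        (hΦ.loc [] le_rfl).aestronglyMeasurable hu
    -- For order 0 only the value at the empty word matters.
    refine ⟨fun _ => u, ⟨fun w _ => ?_, fun w j hw => absurd hw (Nat.not_lt_zero _)⟩, rfl⟩
    refine locallyIntegrableOn_of_norm_le ((hΦ.loc [] le_rfl).norm.smul c⁻¹) hum ?_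
    filter_upwards [hlow, hu] with z h1 h2
    have := h1 (u z)
    rw [h2] at this
    simp only [Pi.smul_apply, smul_eq_mul]
    rw [inv_mul_eq_div, le_div_iff₀ hc]
    linarith
  | succ q ih =>
    have hex : ∀ j, ∃ u', HasWeakDeriv U j u u' := fun j =>
      (hB.deriv [] j (by simp)).exists_hasWeakDeriv_of_eq hU hc hC hlow hup
        (hΦ.deriv [] j (by simp)) hu
    choose u' hu' using hex
    obtain ⟨F₀, hF₀, hF₀u⟩ := ih (hB.mono (by omega)) (hΦ.mono (by omega)) hu
    -- The partial derivative solves an equation with the same operator, B ∂_j u = ∂_j f - (∂_j B)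
    -- u. Its right side has a jet of order `q`: for the product (∂_j B) u this is the Leibniz rule
    -- with the jet `F₀` of `u` that the induction has already produced.
    have hex2 : ∀ j, ∃ G, IsJet U q G ∧ G [] = u' j := by
      intro j
      have hsh : IsCoefJet U q fun w => B (w ++ [j]) := hB.shift j
      refine ih (hB.mono (by omega)) ((hΦ.shift j).sub (hsh.isJet_leibniz hU hF₀)) ?_
      have h1 := ((hB.deriv [] j (by simp)).hasWeakDeriv hU (hu' j)).congr hu EventuallyEq.rfl
      have h2 := h1.unique hU (hΦ.deriv [] j (by simp))
      filter_upwards [h2] with z hz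
      rw [leibniz_nil]
      simp only [List.nil_append, hF₀u, ← hz]
      abel
    choose G hG hG' using hex2
    exact IsJet.of_partial (hF₀u ▸ hF₀.loc [] (Nat.zero_le _)) hG fun j => by rw [hG']; exact hu' j

end Jets

/-! ### Weights -/

section Weights

variable {N : ℕ} (law : Fin N → NoiseLaw)

theorem NoiseLaw.isOpen_interval (l : NoiseLaw) : IsOpen l.interval := by
  cases l <;> simp [NoiseLaw.interval, isOpen_Ioi, isOpen_Ioo]

theorem NoiseLaw.weight_pos (l : NoiseLaw) {x : ℝ} (hx : x ∈ l.interval) : 0 < l.weight x := by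
  cases l <;> simp_all [NoiseLaw.interval, NoiseLaw.weight]

theorem NoiseLaw.continuous_weight (l : NoiseLaw) : Continuous l.weight := by
  cases l <;> simp only [NoiseLaw.weight] <;> fun_prop

theorem isOpen_box : IsOpen (box law) :=
  isOpen_set_pi Set.finite_univ fun j _ => (law j).isOpen_interval

variable {law}

theorem rhoPow_pos (α : Fin N → ℕ) {z : Fin N → ℝ} (hz : z ∈ box law) : 0 < rhoPow law α z :=
  Finset.prod_pos fun j _ => Real.rpow_pos_of_pos ((law j).weight_pos (hz j trivial)) _

/-- The identity that lets the weight of a derivative of a product be shared between the two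
factors. -/
theorem rhoPow_add (α β : Fin N → ℕ) {z : Fin N → ℝ} (hz : z ∈ box law) :
    rhoPow law (α + β) z = rhoPow law α z * rhoPow law β z := by
  simp only [rhoPow, ← Finset.prod_mul_distrib]
  refine Finset.prod_congr rfl fun j _ => ?_
  rw [← Real.rpow_add ((law j).weight_pos (hz j trivial))]
  congr 1
  push_cast [Pi.add_apply]
  ring

theorem continuousOn_rhoPow (α : Fin N → ℕ) : ContinuousOn (rhoPow law α) (box law) := by
  refine continuousOn_finsetProd _ fun j _ => ?_
  refine ContinuousOn.rpow_const ?_ fun z hz => Or.inl ((law j).weight_pos (hz j trivial)).ne'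
  exact ((law j).continuous_weight.comp (continuous_apply j)).continuousOn

theorem aestronglyMeasurable_rhoPow (α : Fin N → ℕ) :
    AEStronglyMeasurable (rhoPow law α) (volume.restrict (box law)) :=
  (continuousOn_rhoPow α).aestronglyMeasurable (isOpen_box law).measurableSet

/-- The multi-index of a word. -/
def letterCount (w : List (Fin N)) : Fin N → ℕ := fun j => w.count j

theorem letterCount_of_mem_splits {w : List (Fin N)} {p : List (Fin N) × List (Fin N)}
    (h : p ∈ splits w) : letterCount p.1 + letterCount p.2 = letterCount w :=
  funext fun i => count_of_mem_splits h i

theorem letterCount_cons (j : Fin N) (w : List (Fin N)) :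
    letterCount (j :: w) = letterCount w + Pi.single j 1 := by
  ext i
  by_cases h : i = j
  · subst h; simp [letterCount]
  · simp [letterCount, h, Ne.symm h]

theorem letterCount_nil : letterCount ([] : List (Fin N)) = 0 := by
  ext; simp [letterCount]

theorem order_letterCount (w : List (Fin N)) : order (letterCount w) = w.length := by
  induction w with
  | nil => simp [letterCount_nil, order]
  | cons j w ih =>
    have : order (letterCount (j :: w)) = order (letterCount w) + 1 := by
      simp only [letterCount_cons, order, Pi.add_apply, Finset.sum_add_distrib]
      simp
    rw [this, ih, List.length_cons]

end Weights

/-! ### Weighted estimates -/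

section Estimates

variable {N : ℕ} {law : Fin N → NoiseLaw} {μ : Measure (Fin N → ℝ)} {X Y Z : Type*}

/-- `F` is a family of iterated weak derivatives up to the order `q` and all its weighted
`L₂`-norms are bounded by `M`. -/
structure SobolevJet [NormedAddCommGroup X] [NormedSpace ℝ X] (law : Fin N → NoiseLaw)
    (μ : Measure (Fin N → ℝ)) (q : ℕ) (F : List (Fin N) → (Fin N → ℝ) → X) (M : ℝ) : Prop where
  jet : IsJet (box law) q F
  bound : ∀ w : List (Fin N), w.length ≤ q →
    eLpNorm (fun z => rhoPow law (letterCount w) z • F w z) 2 μ ≤ ENNReal.ofReal M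

theorem eLpNorm_list_sum_le [NormedAddCommGroup X] {κ : Type*} (l : List κ)
    {f : κ → (Fin N → ℝ) → X} {K : ℝ≥0∞} (hf : ∀ p ∈ l, AEStronglyMeasurable (f p) μ)
    (h : ∀ p ∈ l, eLpNorm (f p) 2 μ ≤ K) :
    AEStronglyMeasurable (fun z => (l.map fun p => f p z).sum) μ ∧
      eLpNorm (fun z => (l.map fun p => f p z).sum) 2 μ ≤ l.length * K := by
  induction l with
  | nil => simpa using aestronglyMeasurable_const
  | cons p l ih =>
    obtain ⟨h1, h2⟩ := ih (fun p' hp' => hf p' (by simp [hp'])) fun p' hp' => h p' (by simp [hp'])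
    have h3 := hf p (by simp)
    simp only [List.map_cons, List.sum_cons, List.length_cons]
    refine ⟨h3.add h1, (eLpNorm_add_le h3 h1 (by norm_num)).trans ?_⟩
    push_cast
    rw [add_mul, one_mul, add_comm]
    exact add_le_add h2 (h p (by simp))

variable [NormedAddCommGroup X] [InnerProductSpace ℝ X] [CompleteSpace X]
  [TopologicalSpace.SeparableSpace X] [NormedAddCommGroup Y]
  [InnerProductSpace ℝ Y] [CompleteSpace Y] {q : ℕ}

theorem aestronglyMeasurable_rhoPow_smul {F : (Fin N → ℝ) → Y} (hμ : μ ≪ volume.restrict (box law))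
    (hF : LocallyIntegrableOn F (box law) volume) (α : Fin N → ℕ) :
    AEStronglyMeasurable (fun z => rhoPow law α z • F z) μ :=
  ((aestronglyMeasurable_rhoPow α).smul hF.aestronglyMeasurable).mono_ac hμ

/-- The weight of the whole word factors along the split: one factor is absorbed by the bound on the
coefficient, the other belongs to the weighted derivative of `F`. -/
theorem SobolevJet.eLpNorm_coef_le (hμ : μ ≪ volume.restrict (box law))
    {B : List (Fin N) → (Fin N → ℝ) → X →L[ℝ] Y} {C : ℝ} {p : List (Fin N) × List (Fin N)}
    {w : List (Fin N)} (hp : p ∈ splits w) {F : List (Fin N) → (Fin N → ℝ) → X}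
    (hBp : IsCoef (box law) (B p.1))
    (hb : ∀ᵐ z ∂volume.restrict (box law), rhoPow law (letterCount p.1) z * ‖B p.1 z‖ ≤ C)
    (hF : LocallyIntegrableOn (F p.2) (box law) volume) :
    AEStronglyMeasurable (fun z => rhoPow law (letterCount w) z • B p.1 z (F p.2 z)) μ ∧
    eLpNorm (fun z => rhoPow law (letterCount w) z • B p.1 z (F p.2 z)) 2 μ ≤
      ENNReal.ofReal C * eLpNorm (fun z => rhoPow law (letterCount p.2) z • F p.2 z) 2 μ := by
  refine ⟨aestronglyMeasurable_rhoPow_smul hμ (hBp.locallyIntegrableOn (isOpen_box law) hF) _, ?_⟩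
  refine eLpNorm_le_mul_eLpNorm_of_ae_le_mul ?_ _
  filter_upwards [hμ.ae_le hb, hμ.ae_le (ae_restrict_mem (isOpen_box law).measurableSet)] with z h1 h2
  rw [← letterCount_of_mem_splits hp, rhoPow_add _ _ h2, norm_smul, norm_smul, norm_mul,
    Real.norm_of_nonneg (rhoPow_pos _ h2).le, Real.norm_of_nonneg (rhoPow_pos _ h2).le]
  have h3 := (rhoPow_pos (letterCount p.2) h2).le
  have h4 := (rhoPow_pos (letterCount p.1) h2).le
  calc _ ≤ rhoPow law (letterCount p.1) z * rhoPow law (letterCount p.2) z *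
        (‖B p.1 z‖ * ‖F p.2 z‖) := by gcongr; exact (B p.1 z).le_opNorm _
    _ = (rhoPow law (letterCount p.1) z * ‖B p.1 z‖) *
        (rhoPow law (letterCount p.2) z * ‖F p.2 z‖) := by ring
    _ ≤ _ := by gcongr

/-- The weighted estimate for products. -/
theorem SobolevJet.leibniz (hμ : μ ≪ volume.restrict (box law))
    {B : List (Fin N) → (Fin N → ℝ) → X →L[ℝ] Y} {C M : ℝ} (hC : 0 ≤ C)
    (hB : IsCoefJet (box law) q B)
    (hb : ∀ w : List (Fin N), w.length ≤ q →
      ∀ᵐ z ∂volume.restrict (box law), rhoPow law (letterCount w) z * ‖B w z‖ ≤ C)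
    {F : List (Fin N) → (Fin N → ℝ) → X} (hF : SobolevJet law μ q F M) :
    SobolevJet law μ q (leibniz B F) (2 ^ q * (C * M)) where
  jet := hB.isJet_leibniz (isOpen_box law) hF.jet
  bound w hw := by
    have h : ∀ p ∈ splits w,
        AEStronglyMeasurable (fun z => rhoPow law (letterCount w) z • B p.1 z (F p.2 z)) μ ∧
        eLpNorm (fun z => rhoPow law (letterCount w) z • B p.1 z (F p.2 z)) 2 μ ≤
          ENNReal.ofReal (C * M) := by
      intro p hp
      have hl := length_of_mem_splits hp
      obtain ⟨h1, h2⟩ := SobolevJet.eLpNorm_coef_le hμ hp (hB.coef _ (by omega))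
        (hb _ (by omega)) (hF.jet.loc _ (by omega))
      refine ⟨h1, h2.trans ?_⟩
      rw [ENNReal.ofReal_mul hC]
      gcongr
      exact hF.bound _ (by omega)
    have h' := (eLpNorm_list_sum_le (splits w) (fun p hp => (h p hp).1) fun p hp => (h p hp).2).2
    rw [length_splits] at h'
    simp only [RandomEvolution.leibniz, List.smul_sum, List.map_map]
    refine h'.trans ?_
    rw [ENNReal.ofReal_mul (p := 2 ^ q) (by positivity)]
    gcongr
    rw [ENNReal.ofReal_pow (by positivity)]
    push_cast
    rw [show ENNReal.ofReal 2 = 2 by simp]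
    exact pow_le_pow_right₀ (by norm_num) hw

/-- The constant of the weighted estimate for solutions. -/
noncomputable def solutionConst (c C : ℝ) : ℕ → ℝ
  | 0 => 1
  | n + 1 => solutionConst c C n + 1 + 2 ^ (n + 1) * (C * (c⁻¹ * solutionConst c C n))

theorem solutionConst_nonneg {c C : ℝ} (hc : 0 < c) (hC : 0 ≤ C) (n : ℕ) :
    0 ≤ solutionConst c C n := by
  induction n with
  | zero => simp [solutionConst]
  | succ n ih => simp only [solutionConst]; positivity

theorem solutionConst_mono {c C : ℝ} (hc : 0 < c) (hC : 0 ≤ C) :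
    Monotone (solutionConst c C) := by
  refine monotone_nat_of_le_succ fun n => ?_
  have := solutionConst_nonneg hc hC n
  simp only [solutionConst]
  have : 0 ≤ 2 ^ (n + 1) * (C * (c⁻¹ * solutionConst c C n)) := by positivity
  linarith

/-- The weighted estimate for solutions of `B u = f`. -/
theorem SobolevJet.eLpNorm_solution_le (hμ : μ ≪ volume.restrict (box law))
    {B : List (Fin N) → (Fin N → ℝ) → X →L[ℝ] Y} {c C M : ℝ} (hc : 0 < c) (hC : 0 ≤ C) (hM : 0 ≤ M)
    (hlow : ∀ᵐ z ∂volume.restrict (box law), ∀ x, c * ‖x‖ ≤ ‖B [] z x‖)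
    (hB : IsCoefJet (box law) q B)
    (hb : ∀ w : List (Fin N), w.length ≤ q → w ≠ [] →
      ∀ᵐ z ∂volume.restrict (box law), rhoPow law (letterCount w) z * ‖B w z‖ ≤ C)
    {F : List (Fin N) → (Fin N → ℝ) → X} (hF : IsJet (box law) q F)
    {Φ : List (Fin N) → (Fin N → ℝ) → Y} (hΦ : SobolevJet law μ q Φ M)
    (h0 : ∀ᵐ z ∂volume.restrict (box law), B [] z (F [] z) = Φ [] z) {w : List (Fin N)}
    (hw : w.length ≤ q) :
    eLpNorm (fun z => rhoPow law (letterCount w) z • B [] z (F w z)) 2 μ ≤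
      ENNReal.ofReal (solutionConst c C q * M) := by
  have hlei : ∀ w : List (Fin N), w.length ≤ q →
      RandomEvolution.leibniz B F w =ᵐ[volume.restrict (box law)] Φ w :=
    (hB.isJet_leibniz (isOpen_box law) hF).ae_eq (isOpen_box law) hΦ.jet
      (by rw [leibniz_nil]; exact h0)
  -- The induction bounds B ∂_w u and not ∂_w u itself. Dividing by the lower bound `c` controls the
  -- lower order derivatives, and no upper bound of `B []` enters. The constant therefore stays
  -- uniform when `B []` contains a spectral parameter.
  have key : ∀ n, ∀ w : List (Fin N), w.length = n → w.length ≤ q →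
      eLpNorm (fun z => rhoPow law (letterCount w) z • B [] z (F w z)) 2 μ ≤
        ENNReal.ofReal (solutionConst c C n * M) := by
    intro n
    induction n using Nat.strong_induction_on with
    | _ n ih =>
    intro w hn hw
    have hF2 : ∀ p ∈ properSplits w, p.2.length < n := fun p hp => by
      have h1 := length_of_mem_splits (mem_splits_of_mem_properSplits hp)
      have h2 := List.length_pos_iff.2 (fst_ne_nil_of_mem_properSplits hp)
      omega
    -- The Leibniz formula for ∂_w f, solved for its top order term. In the remaining splits the
    -- derivative of `u` has order less than `n`.
    have hE : (fun z => rhoPow law (letterCount w) z • B [] z (F w z)) =ᵐ[μ]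
        (fun z => rhoPow law (letterCount w) z • Φ w z) - fun z =>
          ((properSplits w).map fun p =>
            rhoPow law (letterCount w) z • B p.1 z (F p.2 z)).sum := by
      filter_upwards [hμ.ae_le (hlei w hw)] with z hz
      have := sum_splits (fun p => B p.1 z (F p.2 z)) w
      rw [RandomEvolution.leibniz] at hz
      rw [hz] at this
      simp only [Pi.sub_apply, this, smul_add, List.smul_sum, List.map_map]
      symm
      exact add_sub_cancel_right _ _
    obtain ⟨m, hm⟩ | hn0 : (∃ m, n = m + 1) ∨ n = 0 := by
      cases n <;> simp
    · have h : ∀ p ∈ properSplits w,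
          AEStronglyMeasurable (fun z => rhoPow law (letterCount w) z • B p.1 z (F p.2 z)) μ ∧
          eLpNorm (fun z => rhoPow law (letterCount w) z • B p.1 z (F p.2 z)) 2 μ ≤
            ENNReal.ofReal (C * (c⁻¹ * (solutionConst c C m * M))) := by
        intro p hp
        have hps := mem_splits_of_mem_properSplits hp
        have hl := length_of_mem_splits hps
        have hl2 := hF2 p hp
        obtain ⟨h1, h2⟩ := SobolevJet.eLpNorm_coef_le hμ hps (hB.coef _ (by omega))
          (hb _ (by omega) (fst_ne_nil_of_mem_properSplits hp)) (hF.loc _ (by omega))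
        refine ⟨h1, h2.trans ?_⟩
        rw [ENNReal.ofReal_mul hC, ENNReal.ofReal_mul (by positivity)]
        gcongr
        have h3 := ih _ hl2 p.2 rfl (by omega)
        have h4 : eLpNorm (fun z => rhoPow law (letterCount p.2) z • F p.2 z) 2 μ ≤
            ENNReal.ofReal c⁻¹ *
              eLpNorm (fun z => rhoPow law (letterCount p.2) z • B [] z (F p.2 z)) 2 μ := by
          refine eLpNorm_le_mul_eLpNorm_of_ae_le_mul ?_ _
          filter_upwards [hμ.ae_le hlow] with z hz
          rw [norm_smul, norm_smul]
          have := hz (F p.2 z)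
          calc _ = c⁻¹ * (‖rhoPow law (letterCount p.2) z‖ * (c * ‖F p.2 z‖)) := by field_simp
            _ ≤ _ := by gcongr
        refine h4.trans ?_
        gcongr
        refine h3.trans (ENNReal.ofReal_le_ofReal ?_)
        gcongr
        exact solutionConst_mono hc hC (by omega)
      obtain ⟨h5, h6⟩ :=
        eLpNorm_list_sum_le (properSplits w) (fun p hp => (h p hp).1) fun p hp => (h p hp).2
      rw [eLpNorm_congr_ae hE]
      refine (eLpNorm_sub_le (aestronglyMeasurable_rhoPow_smul hμ (hΦ.jet.loc w hw) _) h5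
        (by norm_num)).trans ?_
      -- The number of remaining terms is the source of the power of 2 in `solutionConst`.
      have h7 : ((properSplits w).length : ℝ≥0∞) ≤ ENNReal.ofReal (2 ^ (m + 1)) := by
        rw [ENNReal.ofReal_pow (by positivity), show ENNReal.ofReal 2 = 2 by simp]
        exact_mod_cast (length_properSplits_le w).trans (by rw [hn, hm])
      calc _ ≤ ENNReal.ofReal M + ENNReal.ofReal (2 ^ (m + 1)) *
            ENNReal.ofReal (C * (c⁻¹ * (solutionConst c C m * M))) := by
            gcongr
            · exact hΦ.bound w hw
            · exact h6.trans (by gcongr)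
        _ = ENNReal.ofReal (M + 2 ^ (m + 1) * (C * (c⁻¹ * (solutionConst c C m * M)))) := by
            have := solutionConst_nonneg hc hC m
            rw [ENNReal.ofReal_add hM (by positivity), ENNReal.ofReal_mul (p := 2 ^ (m + 1)) (by positivity)]
        _ ≤ _ := by
            refine ENNReal.ofReal_le_ofReal ?_
            have := solutionConst_nonneg hc hC m
            have h8 : 0 ≤ solutionConst c C m * M := by positivity
            rw [hm, solutionConst]
            linarith
    · subst hn0
      have hw0 : w = [] := List.length_eq_zero_iff.1 hn
      subst hw0
      rw [eLpNorm_congr_ae hE]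
      have : ((fun z => rhoPow law (letterCount []) z • Φ [] z) - fun z =>
          ((properSplits ([] : List (Fin N))).map fun p =>
            rhoPow law (letterCount []) z • B p.1 z (F p.2 z)).sum) =
          fun z => rhoPow law (letterCount []) z • Φ [] z := by
        ext z
        simp [properSplits]
      rw [this]
      simpa [solutionConst] using hΦ.bound [] hw
  refine (key _ w rfl hw).trans (ENNReal.ofReal_le_ofReal ?_)
  gcongr
  exact solutionConst_mono hc hC hw

end Estimates

/-! ### Multi-indices and words -/

section WordDerivative

variable {N : ℕ} {F : Type*} [NormedAddCommGroup F] [NormedSpace ℝ F]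

/-- The classical iterated derivative along a word. -/
noncomputable def wordDeriv (w : List (Fin N)) (f : (Fin N → ℝ) → F) : (Fin N → ℝ) → F :=
  w.foldr coordDeriv f

/-- The word that spells out a multi-index. -/
def wordOf (α : Fin N → ℕ) : List (Fin N) :=
  (List.finRange N).flatMap fun j => List.replicate (α j) j

theorem wordDeriv_append (w w' : List (Fin N)) (f : (Fin N → ℝ) → F) :
    wordDeriv (w ++ w') f = wordDeriv w (wordDeriv w' f) := by
  simp [wordDeriv]

theorem wordDeriv_replicate (n : ℕ) (j : Fin N) (f : (Fin N → ℝ) → F) :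
    wordDeriv (List.replicate n j) f = (coordDeriv j)^[n] f := by
  induction n with
  | zero => rfl
  | succ n ih =>
    rw [List.replicate_succ, Function.iterate_succ_apply', ← ih]
    rfl

theorem partialDeriv_eq_wordDeriv (α : Fin N → ℕ) (f : (Fin N → ℝ) → F) :
    partialDeriv α f = wordDeriv (wordOf α) f := by
  unfold partialDeriv wordOf
  induction List.finRange N with
  | nil => rfl
  | cons j l ih => rw [List.foldr_cons, List.flatMap_cons, wordDeriv_append, wordDeriv_replicate, ih]

theorem letterCount_wordOf (α : Fin N → ℕ) : letterCount (wordOf α) = α := by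
  ext i
  have h : ∀ l : List (Fin N), l.Nodup →
      (l.flatMap fun j => List.replicate (α j) j).count i = if i ∈ l then α i else 0 := by
    intro l hl
    induction l with
    | nil => simp
    | cons j l ih =>
      rw [List.flatMap_cons, List.count_append, ih hl.of_cons, List.count_replicate]
      have := hl.notMem
      by_cases h : j = i
      · subst h; simp [this]
      · simp [h, Ne.symm h]
  simpa [letterCount, wordOf] using h _ (List.nodup_finRange N)

theorem wordOf_letterCount_perm (w : List (Fin N)) : (wordOf (letterCount w)).Perm w :=
  List.perm_iff_count.2 fun i => congrFun (letterCount_wordOf (letterCount w)) i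

theorem length_wordOf (α : Fin N → ℕ) : (wordOf α).length = order α := by
  rw [← order_letterCount, letterCount_wordOf]

theorem contDiff_wordDeriv {n m : ℕ} {f : (Fin N → ℝ) → F} (w : List (Fin N))
    (hf : ContDiff ℝ n f) (h : m + w.length ≤ n) : ContDiff ℝ m (wordDeriv w f) := by
  induction w generalizing m with
  | nil => exact hf.of_le (by exact_mod_cast h)
  | cons j w ih =>
    have h1 : ContDiff ℝ ((m + 1 : ℕ) : WithTop ℕ∞) (wordDeriv w f) :=
      ih (by simp only [List.length_cons] at h; omega)
    exact contDiff_coordDeriv h1 (by push_cast; exact le_rfl) j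

theorem coordDeriv_comm {f : (Fin N → ℝ) → F} (hf : ContDiff ℝ 2 f) (i j : Fin N) :
    coordDeriv i (coordDeriv j f) = coordDeriv j (coordDeriv i f) := by
  ext z
  have h1 : Differentiable ℝ (fderiv ℝ f) :=
    (hf.fderiv_right (m := 1) (by norm_num)).differentiable one_ne_zero
  have h2 : ∀ a b : Fin N, coordDeriv a (coordDeriv b f) z =
      fderiv ℝ (fderiv ℝ f) z (Pi.single a 1) (Pi.single b 1) := by
    intro a b
    have : HasFDerivAt (coordDeriv b f)
        ((ContinuousLinearMap.apply ℝ F (Pi.single b 1)).comp (fderiv ℝ (fderiv ℝ f) z)) z :=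
      (ContinuousLinearMap.apply ℝ F (Pi.single b 1 : Fin N → ℝ)).hasFDerivAt.comp z
        (h1 z).hasFDerivAt
    simp only [coordDeriv] at this ⊢
    rw [this.fderiv]
    rfl
  rw [h2, h2]
  exact (hf.contDiffAt.isSymmSndFDerivAt (by simp)).eq _ _

/-- Permutations are generated by swaps of neighbouring letters, and a swap is the symmetry of
second derivatives. -/
theorem wordDeriv_perm {w w' : List (Fin N)} (h : w.Perm w') :
    ∀ {f : (Fin N → ℝ) → F}, ContDiff ℝ w.length f → wordDeriv w f = wordDeriv w' f := by
  induction h with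
  | nil => intros; rfl
  | cons j _ ih =>
    intro f hf
    have := ih (hf.of_le (by simp))
    simp only [wordDeriv, List.foldr_cons] at this ⊢
    rw [this]
  | swap i j l =>
    intro f hf
    simp only [wordDeriv, List.foldr_cons]
    refine coordDeriv_comm ?_ _ _
    exact contDiff_wordDeriv (m := 2) l hf (by simp; omega)
  | trans h1 _ ih1 ih2 =>
    intro f hf
    rw [ih1 hf, ih2 (h1.length_eq ▸ hf)]

theorem partialDeriv_letterCount {w : List (Fin N)} {f : (Fin N → ℝ) → F}
    (hf : ContDiff ℝ w.length f) : partialDeriv (letterCount w) f = wordDeriv w f := by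
  rw [partialDeriv_eq_wordDeriv]
  have h := wordOf_letterCount_perm w
  exact wordDeriv_perm h (h.length_eq ▸ hf)

theorem IsTest.wordDeriv {U : Set (Fin N → ℝ)} {φ : (Fin N → ℝ) → ℝ} (h : IsTest U φ)
    (w : List (Fin N)) : IsTest U (wordDeriv w φ) := by
  induction w with
  | nil => exact h
  | cons j w ih => exact ih.coordDeriv j

theorem IsTest.partialDeriv {U : Set (Fin N → ℝ)} {φ : (Fin N → ℝ) → ℝ} (h : IsTest U φ)
    (α : Fin N → ℕ) : IsTest U (partialDeriv α φ) := by
  rw [partialDeriv_eq_wordDeriv]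
  exact h.wordDeriv _

theorem IsTest.contDiff_nat {U : Set (Fin N → ℝ)} {φ : (Fin N → ℝ) → ℝ} (h : IsTest U φ) (n : ℕ) :
    ContDiff ℝ n φ :=
  h.contDiff.of_le (by exact_mod_cast le_top)

theorem partialDeriv_coordDeriv {U : Set (Fin N → ℝ)} {φ : (Fin N → ℝ) → ℝ} (h : IsTest U φ)
    (w : List (Fin N)) (j : Fin N) :
    partialDeriv (letterCount w) (coordDeriv j φ) = partialDeriv (letterCount (j :: w)) φ := by
  rw [partialDeriv_letterCount ((h.coordDeriv j).contDiff_nat _),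
    partialDeriv_letterCount (h.contDiff_nat _),
    ← wordDeriv_perm (List.perm_append_singleton j w) (h.contDiff_nat _), wordDeriv_append]
  rfl

/-- Each integration by parts moves the outermost derivative of the test function to the front of
the other word, so the word arrives reversed. -/
theorem IsJet.integral_wordDeriv {U : Set (Fin N → ℝ)} {q : ℕ}
    {G : List (Fin N) → (Fin N → ℝ) → F} (hG : IsJet U q G) {φ : (Fin N → ℝ) → ℝ}
    (hφ : IsTest U φ) (w v : List (Fin N)) (h : w.length + v.length ≤ q) :
    ∫ z in U, RandomEvolution.wordDeriv w φ z • G v z =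
      (-1 : ℝ) ^ w.length • ∫ z in U, φ z • G (w.reverse ++ v) z := by
  induction w generalizing v with
  | nil => simp [RandomEvolution.wordDeriv]
  | cons j w ih =>
    simp only [List.length_cons] at h
    have h1 := (hG.deriv v j (by omega)).eq _ (hφ.wordDeriv w)
    have h2 := ih (j :: v) (by simp only [List.length_cons]; omega)
    rw [h2] at h1
    simp only [List.length_cons, List.reverse_cons, List.append_assoc, List.singleton_append]
    rw [pow_succ, mul_neg_one, neg_smul]
    exact h1

end WordDerivative

/-! ### The Sobolev spaces in terms of iterated weak derivatives -/

section Bridge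

variable {𝕜 : Type*} [RCLike 𝕜] {N : ℕ} {X : Type*} [NormedAddCommGroup X] [InnerProductSpace 𝕜 X]
  [CompleteSpace X] [InnerProductSpace ℝ X] [IsScalarTower ℝ 𝕜 X]

/-- Inner products with all vectors determine a vector, so the scalar identities amount to one
identity between Bochner integrals. The scalar field then enters only through its real multiples. -/
theorem isWeakPartial_iff {U : Set (Fin N → ℝ)} {α : Fin N → ℕ} {f g : (Fin N → ℝ) → X} :
    IsWeakPartial 𝕜 U α f g ↔ LocallyIntegrableOn f U volume ∧ LocallyIntegrableOn g U volume ∧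
      ∀ φ, IsTest U φ → ∫ z in U, partialDeriv α φ z • f z =
        (-1 : ℝ) ^ order α • ∫ z in U, φ z • g z := by
  have key : ∀ (φ : (Fin N → ℝ) → ℝ) (f : (Fin N → ℝ) → X) (x : X),
      IntegrableOn (fun z => φ z • f z) U →
      ∫ z in U, ((φ z : ℝ) : 𝕜) * inner 𝕜 x (f z) = inner 𝕜 x (∫ z in U, φ z • f z) := by
    intro φ f x h
    rw [← integral_inner (𝕜 := 𝕜) h x]
    simp only [RCLike.real_smul_eq_coe_smul (K := 𝕜), inner_smul_right]
  unfold IsWeakPartial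
  refine and_congr_right fun hf => and_congr_right fun hg => ?_
  have hpow : ∀ x y : X, (-1 : 𝕜) ^ order α * inner 𝕜 x y =
      inner 𝕜 x ((-1 : ℝ) ^ order α • y) := by
    intro x y
    rw [RCLike.real_smul_eq_coe_smul (K := 𝕜), inner_smul_right]
    simp
  constructor
  · intro h φ hφ
    refine ext_inner_left 𝕜 fun x => ?_
    rw [← key _ _ _ ((hφ.partialDeriv α).integrableOn hf), h φ hφ.1 hφ.2 hφ.3 x,
      key _ _ _ (hφ.integrableOn hg), hpow]
  · intro h φ h1 h2 h3 x
    have hφ : IsTest U φ := ⟨h1, h2, h3⟩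
    rw [key _ _ _ ((hφ.partialDeriv α).integrableOn hf), h φ hφ, key _ _ _ (hφ.integrableOn hg),
      hpow]

theorem IsWeakPartial.ae_eq {U : Set (Fin N → ℝ)} (hU : IsOpen U) {α : Fin N → ℕ}
    {f f' g g' : (Fin N → ℝ) → X} (h : IsWeakPartial 𝕜 U α f g) (h' : IsWeakPartial 𝕜 U α f' g')
    (hf : f =ᵐ[volume.restrict U] f') : g =ᵐ[volume.restrict U] g' := by
  obtain ⟨-, h2, h3⟩ := isWeakPartial_iff.1 h
  obtain ⟨-, h2', h3'⟩ := isWeakPartial_iff.1 h'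
  have := hU.ae_eq_zero_of_integral_contDiff_smul_eq_zero (μ := volume)
    (f := fun z => g z - g' z) (h2.sub h2') (fun φ e1 e2 e3 => by
      have hφ : IsTest U φ := ⟨e1, e2, e3⟩
      have h0 : ∫ z, φ z • (g z - g' z) = ∫ z in U, φ z • (g z - g' z) := by
        rw [setIntegral_eq_integral_of_forall_compl_eq_zero]
        intro z hz
        rw [image_eq_zero_of_notMem_tsupport fun h => hz (e3 h), zero_smul]
      rw [h0]
      simp only [smul_sub]
      rw [integral_sub (hφ.integrableOn h2) (hφ.integrableOn h2'), sub_eq_zero]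
      have h4 : ∫ z in U, partialDeriv α φ z • f z = ∫ z in U, partialDeriv α φ z • f' z :=
        integral_congr_ae (hf.mono fun z hz => congrArg (partialDeriv α φ z • ·) hz)
      rw [h3 φ hφ, h3' φ hφ] at h4
      exact smul_right_injective X (pow_ne_zero _ (by norm_num)) h4)
  filter_upwards [ae_restrict_of_ae this, ae_restrict_mem hU.measurableSet] with z h1 h2
  exact sub_eq_zero.1 (h1 h2)

theorem weakPartial_spec {U : Set (Fin N → ℝ)} {α : Fin N → ℕ} {f g : (Fin N → ℝ) → X}
    (h : IsWeakPartial 𝕜 U α f g) : IsWeakPartial 𝕜 U α f (weakPartial 𝕜 U α f) := by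
  have hex : ∃ g, IsWeakPartial 𝕜 U α f g := ⟨g, h⟩
  unfold weakPartial
  rw [dif_pos hex]
  exact hex.choose_spec

theorem partialDeriv_zero {F : Type*} [NormedAddCommGroup F] [NormedSpace ℝ F]
    (f : (Fin N → ℝ) → F) : partialDeriv 0 f = f := by
  have := partialDeriv_letterCount (w := []) (f := f)
  rw [letterCount_nil] at this
  rw [partialDeriv_eq_wordDeriv]
  have h : wordOf (0 : Fin N → ℕ) = [] := by
    rw [← List.length_eq_zero_iff, length_wordOf]
    simp [order]
  rw [h]
  rfl

theorem isWeakPartial_zero {U : Set (Fin N → ℝ)} {f : (Fin N → ℝ) → X}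
    (hf : LocallyIntegrableOn f U volume) : IsWeakPartial 𝕜 U 0 f f :=
  isWeakPartial_iff.2 ⟨hf, hf, fun φ _ => by simp [partialDeriv_zero, order]⟩

theorem mem_multiIndices {q : ℕ} {α : Fin N → ℕ} : α ∈ multiIndices N q ↔ order α ≤ q := by
  simp only [multiIndices, Finset.mem_filter, Finset.mem_Iic, and_iff_right_iff_imp]
  intro h j
  exact (Finset.single_le_sum (f := α) (fun _ _ => Nat.zero_le _) (Finset.mem_univ j)).trans h

variable {law : Fin N → NoiseLaw} {μ : Measure (Fin N → ℝ)} {q : ℕ} {f : (Fin N → ℝ) → X}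

theorem MemSobolev.weakPartial (hμ : μ ≪ volume.restrict (box law)) (hf : MemSobolev 𝕜 law μ q f)
    {α : Fin N → ℕ} (hα : order α ≤ q) :
    IsWeakPartial 𝕜 (box law) α f (weakPartial 𝕜 (box law) α f) ∧
      MemLp (fun z => (rhoPow law α z : 𝕜) • weakPartial 𝕜 (box law) α f z) 2 μ := by
  obtain ⟨g, h1, h2⟩ := hf α hα
  have h3 := weakPartial_spec h1
  refine ⟨h3, (memLp_congr_ae ?_).2 h2⟩
  filter_upwards [hμ.ae_le (h3.ae_eq (isOpen_box law) h1 EventuallyEq.rfl)] with z hz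
  rw [hz]

theorem eLpNorm_le_sobolevNorm (hμ : μ ≪ volume.restrict (box law)) (hf : MemSobolev 𝕜 law μ q f)
    {α : Fin N → ℕ} (hα : order α ≤ q) :
    eLpNorm (fun z => (rhoPow law α z : 𝕜) • weakPartial 𝕜 (box law) α f z) 2 μ ≤
      ENNReal.ofReal (sobolevNorm 𝕜 law μ q f) := by
  rw [← ENNReal.ofReal_toReal (hf.weakPartial hμ hα).2.eLpNorm_ne_top]
  refine ENNReal.ofReal_le_ofReal (Real.le_sqrt_of_sq_le ?_)
  exact Finset.single_le_sum (f := fun α => (eLpNorm (fun z => (rhoPow law α z : 𝕜) •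
    weakPartial 𝕜 (box law) α f z) 2 μ).toReal ^ 2) (fun _ _ => sq_nonneg _)
    (mem_multiIndices.2 hα)

theorem sobolevNorm_nonneg : 0 ≤ sobolevNorm 𝕜 law μ q f := Real.sqrt_nonneg _

theorem sobolevNorm_le {M : ℝ} (hM : 0 ≤ M)
    (h : ∀ α : Fin N → ℕ, order α ≤ q →
      eLpNorm (fun z => (rhoPow law α z : 𝕜) • weakPartial 𝕜 (box law) α f z) 2 μ ≤
        ENNReal.ofReal M) :
    sobolevNorm 𝕜 law μ q f ≤ √((multiIndices N q).card) * M := by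
  have h1 : √((multiIndices N q).card) * M = √((multiIndices N q).card • M ^ 2) := by
    rw [nsmul_eq_mul, Real.sqrt_mul (Nat.cast_nonneg _), Real.sqrt_sq hM]
  rw [h1]
  refine Real.sqrt_le_sqrt (Finset.sum_le_card_nsmul _ _ _ fun α hα => ?_)
  have := ENNReal.toReal_mono ENNReal.ofReal_ne_top (h α (mem_multiIndices.1 hα))
  rw [ENNReal.toReal_ofReal hM] at this
  gcongr

/-- To a word is assigned the weak derivative of its multi-index. That one more letter means one
more derivative follows by using ∂_j φ as test function, where the order of differentiation is
irrelevant. -/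
theorem MemSobolev.exists_sobolevJet (hμ : μ ≪ volume.restrict (box law))
    (hf : MemSobolev 𝕜 law μ q f) :
    ∃ F, SobolevJet law μ q F (sobolevNorm 𝕜 law μ q f) ∧ F [] =ᵐ[volume.restrict (box law)] f := by
  have hord : ∀ w : List (Fin N), w.length ≤ q → order (letterCount w) ≤ q := fun w hw => by
    rwa [order_letterCount]
  refine ⟨fun w => RandomEvolution.weakPartial 𝕜 (box law) (letterCount w) f,
    ⟨⟨fun w hw => (hf.weakPartial hμ (hord w hw)).1.2.1, fun w j hw => ?_⟩, fun w hw => ?_⟩, ?_⟩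
  · obtain ⟨-, h2, h3⟩ := isWeakPartial_iff.1 (hf.weakPartial hμ (hord w hw.le)).1
    obtain ⟨-, h4, h5⟩ := isWeakPartial_iff.1 (hf.weakPartial hμ (hord (j :: w) hw)).1
    refine ⟨h2, h4, fun φ hφ => ?_⟩
    have h6 := h3 _ (hφ.coordDeriv j)
    have h7 := h5 _ hφ
    rw [partialDeriv_coordDeriv hφ] at h6
    rw [h6, order_letterCount, order_letterCount, List.length_cons, pow_succ, mul_smul] at h7
    have h8 := smul_right_injective X (pow_ne_zero w.length (by norm_num : (-1 : ℝ) ≠ 0)) h7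
    simpa using h8
  · simpa only [RCLike.real_smul_eq_coe_smul (K := 𝕜)] using
      eLpNorm_le_sobolevNorm hμ hf (hord w hw)
  · have h1 := (hf.weakPartial hμ (α := 0) (by simp [order])).1
    simp only [letterCount_nil]
    exact h1.ae_eq (isOpen_box law) (isWeakPartial_zero h1.1) EventuallyEq.rfl

/-- Integration by parts along the word that spells `α` identifies the entry of the reversed word as
∂^α f. The square root of the number of multi-indices turns bounds of the single terms into a bound
of the norm. -/
theorem SobolevJet.memSobolev (hμ : μ ≪ volume.restrict (box law)) {M : ℝ} (hM : 0 ≤ M)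
    {F : List (Fin N) → (Fin N → ℝ) → X} (hF : SobolevJet law μ q F M)
    (h0 : F [] =ᵐ[volume.restrict (box law)] f) :
    MemSobolev 𝕜 law μ q f ∧ sobolevNorm 𝕜 law μ q f ≤ √((multiIndices N q).card) * M := by
  have hwp : ∀ α : Fin N → ℕ, order α ≤ q →
      IsWeakPartial 𝕜 (box law) α f (F (wordOf α).reverse) := by
    intro α hα
    have hl := length_wordOf α
    refine isWeakPartial_iff.2 ⟨(hF.jet.loc [] (Nat.zero_le _)).congr h0,
      hF.jet.loc _ (by rw [List.length_reverse]; omega), fun φ hφ => ?_⟩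
    have h1 := hF.jet.integral_wordDeriv hφ (wordOf α) [] (by simp; omega)
    rw [List.append_nil, hl, ← partialDeriv_eq_wordDeriv] at h1
    rw [← h1]
    exact integral_congr_ae (h0.mono fun z hz => congrArg (partialDeriv α φ z • ·) hz.symm)
  have hb : ∀ α : Fin N → ℕ, order α ≤ q →
      eLpNorm (fun z => (rhoPow law α z : 𝕜) • F (wordOf α).reverse z) 2 μ ≤
        ENNReal.ofReal M := by
    intro α hα
    have h1 := hF.bound (wordOf α).reverse (by rw [List.length_reverse, length_wordOf]; exact hα)
    have h2 : letterCount (wordOf α).reverse = α := by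
      conv_rhs => rw [← letterCount_wordOf α]
      ext i
      simp [letterCount]
    rw [h2] at h1
    simpa only [RCLike.real_smul_eq_coe_smul (K := 𝕜)] using h1
  have hmem : MemSobolev 𝕜 law μ q f := fun α hα => by
    refine ⟨_, hwp α hα, ?_, (hb α hα).trans_lt ENNReal.ofReal_lt_top⟩
    simp only [← RCLike.real_smul_eq_coe_smul (K := 𝕜)]
    exact aestronglyMeasurable_rhoPow_smul hμ (hwp α hα).2.1 α
  refine ⟨hmem, sobolevNorm_le hM fun α hα => ?_⟩
  refine (eLpNorm_congr_ae ?_).trans_le (hb α hα)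
  filter_upwards [hμ.ae_le ((hmem.weakPartial hμ hα).1.ae_eq (isOpen_box law) (hwp α hα)
    EventuallyEq.rfl)] with z hz
  rw [hz]

end Bridge

/-! ### The density of the noise -/

section Density

/-- A continuous density of the law on its interval. -/
noncomputable def NoiseLaw.density : NoiseLaw → ℝ → ℝ
  | .normal => gaussianPDFReal 0 1
  | .gamma a _ => fun x => 1 ^ (a + 1) / Real.Gamma (a + 1) * x ^ (a + 1 - 1) * Real.exp (-(1 * x))
  | .beta a b _ _ => fun x => Real.Gamma (a + b + 2) /
      ((2 : ℝ) ^ (a + b + 1) * Real.Gamma (a + 1) * Real.Gamma (b + 1)) *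
        ((1 - x) ^ a * (1 + x) ^ b)

theorem NoiseLaw.density_pos (l : NoiseLaw) {x : ℝ} (hx : x ∈ l.interval) : 0 < l.density x := by
  cases l with
  | normal => exact gaussianPDFReal_pos _ _ _ one_ne_zero
  | gamma a ha =>
    simp only [NoiseLaw.interval, mem_Ioi] at hx
    have := Real.Gamma_pos_of_pos (show 0 < a + 1 by linarith)
    simp only [NoiseLaw.density]
    positivity
  | beta a b ha hb =>
    simp only [NoiseLaw.interval, mem_Ioo] at hx
    have h1 := Real.Gamma_pos_of_pos (show 0 < a + 1 by linarith)
    have h2 := Real.Gamma_pos_of_pos (show 0 < b + 1 by linarith)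
    have h3 := Real.Gamma_pos_of_pos (show 0 < a + b + 2 by linarith)
    have h4 : 0 < (1 - x) ^ a := Real.rpow_pos_of_pos (by linarith) _
    have h5 : 0 < (1 + x) ^ b := Real.rpow_pos_of_pos (by linarith) _
    simp only [NoiseLaw.density]
    positivity

theorem NoiseLaw.continuousOn_density (l : NoiseLaw) : ContinuousOn l.density l.interval := by
  cases l with
  | normal =>
    simp only [NoiseLaw.density, gaussianPDFReal_def]
    fun_prop
  | gamma a ha =>
    refine ContinuousOn.mul (continuousOn_const.mul
      (continuousOn_id.rpow_const fun x hx => Or.inl (ne_of_gt hx))) ?_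
    fun_prop
  | beta a b ha hb =>
    refine continuousOn_const.mul (ContinuousOn.mul ?_ ?_)
    · refine ContinuousOn.rpow_const (by fun_prop) fun x hx => Or.inl ?_
      have := hx.2
      linarith
    · refine ContinuousOn.rpow_const (by fun_prop) fun x hx => Or.inl ?_
      have := hx.1
      linarith

theorem NoiseLaw.measure_eq (l : NoiseLaw) :
    l.measure = (volume.restrict l.interval).withDensity fun x => ENNReal.ofReal (l.density x) := by
  cases l with
  | normal =>
    simp only [NoiseLaw.measure, NoiseLaw.interval, Measure.restrict_univ,
      gaussianReal_of_var_ne_zero _ one_ne_zero]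
    rfl
  | gamma a ha =>
    rw [NoiseLaw.interval, ← withDensity_indicator measurableSet_Ioi]
    refine withDensity_congr_ae ?_
    -- `gammaPDF` uses the closed half-line and the interval is open; they differ by the null set
    -- {0}.
    filter_upwards [compl_mem_ae_iff.2 (measure_singleton (0 : ℝ))] with x hx
    have hx0 : x ≠ 0 := hx
    simp only [gammaPDF, gammaPDFReal, NoiseLaw.density]
    by_cases h : 0 < x
    · rw [indicator_of_mem (mem_Ioi.2 h), if_pos h.le]
    · rw [indicator_of_notMem (by simpa using h), if_neg (by
        intro h'
        exact h (lt_of_le_of_ne h' (Ne.symm hx0))), ENNReal.ofReal_zero]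
  | beta a b ha hb =>
    rw [NoiseLaw.interval, ← withDensity_indicator measurableSet_Ioo]
    refine withDensity_congr_ae (Eventually.of_forall fun x => ?_)
    by_cases h : x ∈ Ioo (-1 : ℝ) 1
    · simp only [indicator_of_mem h, NoiseLaw.density]
    · simp only [indicator_of_notMem h]

variable {N : ℕ}

/-- `μ` has the positive continuous density `p` on the box. -/
structure HasDensity (law : Fin N → NoiseLaw) (μ : Measure (Fin N → ℝ)) (p : (Fin N → ℝ) → ℝ) :
    Prop where
  continuousOn : ContinuousOn p (box law)
  pos : ∀ z ∈ box law, 0 < p z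
  eq : μ = (volume.restrict (box law)).withDensity fun z => ENNReal.ofReal (p z)

/-- A product measure is determined by its values on boxes. There the claim is Fubini for a product
of functions of one variable each, carried out with Bochner integrals of the nonnegative densities.
-/
theorem hasDensity_pi (law : Fin N → NoiseLaw) [∀ j, IsFiniteMeasure (law j).measure] :
    HasDensity law (Measure.pi fun j => (law j).measure) fun z => ∏ j, (law j).density (z j) where
  continuousOn := continuousOn_finsetProd _ fun j _ =>
    (law j).continuousOn_density.comp (continuous_apply j).continuousOn fun _ hz => hz j trivial
  pos z hz := Finset.prod_pos fun j _ => (law j).density_pos (hz j trivial)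
  eq := by
    refine Measure.pi_eq fun s hs => ?_
    have hI : ∀ j, MeasurableSet (law j).interval := fun j => (law j).isOpen_interval.measurableSet
    have hm : ∀ j (t : Set ℝ), MeasurableSet t → (law j).measure t =
        ∫⁻ x, ENNReal.ofReal ((law j).density x) ∂(volume.restrict (t ∩ (law j).interval)) := by
      intro j t ht
      rw [(law j).measure_eq, withDensity_apply _ ht, Measure.restrict_restrict ht]
    have hae : ∀ j, AEStronglyMeasurable (law j).density (volume.restrict (law j).interval) :=
      fun j => (law j).continuousOn_density.aestronglyMeasurable (hI j)
    have hint : ∀ j, Integrable (law j).density (volume.restrict (s j ∩ (law j).interval)) := by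
      intro j
      have h1 : Integrable (law j).density (volume.restrict (law j).interval) := by
        refine ⟨hae j, ?_⟩
        rw [hasFiniteIntegral_iff_ofReal]
        · have := hm j univ MeasurableSet.univ
          rw [univ_inter] at this
          rw [← this]
          exact measure_lt_top _ _
        · filter_upwards [ae_restrict_mem (hI j)] with x hx using ((law j).density_pos hx).le
      exact IntegrableOn.mono_set h1 inter_subset_right
    have hnn : ∀ j, 0 ≤ᵐ[volume.restrict (s j ∩ (law j).interval)] (law j).density := fun j => by
      filter_upwards [ae_restrict_mem ((hs j).inter (hI j))] with x hx
        using ((law j).density_pos hx.2).le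
    have hset : univ.pi s ∩ box law = univ.pi fun j => s j ∩ (law j).interval := by
      rw [box, ← Set.pi_inter_distrib]
    rw [withDensity_apply _ (MeasurableSet.univ_pi hs),
      Measure.restrict_restrict (MeasurableSet.univ_pi hs), hset, volume_pi,
      Measure.restrict_pi_pi, ← ofReal_integral_eq_lintegral_ofReal]
    · rw [integral_fintype_prod_eq_prod (𝕜 := ℝ) (fun j => (law j).density),
        ENNReal.ofReal_prod_of_nonneg fun j _ => integral_nonneg_of_ae (hnn j)]
      refine Finset.prod_congr rfl fun j _ => ?_
      rw [ofReal_integral_eq_lintegral_ofReal (hint j) (hnn j), hm j _ (hs j)]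
    · exact Integrable.fintype_prod hint
    · rw [← Measure.restrict_pi_pi, ← volume_pi]
      filter_upwards [ae_restrict_mem (MeasurableSet.univ_pi fun j => (hs j).inter (hI j))]
        with z hz
      exact Finset.prod_nonneg fun j _ => ((law j).density_pos (hz j trivial).2).le

variable {law : Fin N → NoiseLaw} {μ : Measure (Fin N → ℝ)} {p : (Fin N → ℝ) → ℝ} {X : Type*}

theorem HasDensity.aemeasurable (h : HasDensity law μ p) :
    AEMeasurable (fun z => ENNReal.ofReal (p z)) (volume.restrict (box law)) :=
  (h.continuousOn.aestronglyMeasurable (isOpen_box law).measurableSet).aemeasurable.ennreal_ofReal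

theorem HasDensity.absolutelyContinuous (h : HasDensity law μ p) :
    μ ≪ volume.restrict (box law) := by
  rw [h.eq]
  exact withDensity_absolutelyContinuous _ _

/-- Positivity of the density. Together with the converse it makes "almost everywhere" on the box
the same for `μ` and for Lebesgue measure. -/
theorem HasDensity.absolutelyContinuous' (h : HasDensity law μ p) :
    volume.restrict (box law) ≪ μ := by
  rw [h.eq]
  refine withDensity_absolutelyContinuous' h.aemeasurable ?_
  filter_upwards [ae_restrict_mem (isOpen_box law).measurableSet] with z hz
  simpa using h.pos z hz

theorem HasDensity.integral_eq [NormedAddCommGroup X] [NormedSpace ℝ X] (h : HasDensity law μ p)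
    (f : (Fin N → ℝ) → X) : ∫ z, f z ∂μ = ∫ z in box law, p z • f z := by
  rw [h.eq, integral_withDensity_eq_integral_toReal_smul₀ h.aemeasurable
    (Eventually.of_forall fun _ => ENNReal.ofReal_lt_top)]
  refine integral_congr_ae ?_
  filter_upwards [ae_restrict_mem (isOpen_box law).measurableSet] with z hz
  rw [ENNReal.toReal_ofReal (h.pos z hz).le]

/-- `p f` is Lebesgue integrable, and the continuous function `1 / p` is locally bounded on the box.
-/
theorem HasDensity.locallyIntegrableOn [NormedAddCommGroup X] [NormedSpace ℝ X]
    [IsFiniteMeasure μ] (h : HasDensity law μ p) {f : (Fin N → ℝ) → X} (hf : MemLp f 2 μ) :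
    LocallyIntegrableOn f (box law) volume := by
  have h1 : Integrable f μ := hf.integrable (by norm_num)
  rw [h.eq, integrable_withDensity_iff_integrable_smul₀' h.aemeasurable
    (Eventually.of_forall fun _ => ENNReal.ofReal_lt_top)] at h1
  have h2 : LocallyIntegrableOn (fun z => (p z)⁻¹ • (ENNReal.ofReal (p z)).toReal • f z)
      (box law) volume :=
    (IntegrableOn.locallyIntegrableOn h1).continuousOn_smul (isOpen_box law).isLocallyClosed
      (h.continuousOn.inv₀ fun z hz => (h.pos z hz).ne')
  refine h2.congr ?_
  filter_upwards [ae_restrict_mem (isOpen_box law).measurableSet] with z hz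
  rw [ENNReal.toReal_ofReal (h.pos z hz).le, smul_smul, inv_mul_cancel₀ (h.pos z hz).ne', one_smul]

end Density

/-! ### Dual characterization of weighted weak derivatives -/

section Duality

/-- The bound forces `L` to vanish on the kernel of `J`, so `L` descends to a bounded functional on
the range of `J`. Extend it by Hahn–Banach and represent it by Riesz; the range need not be closed
or dense. -/
theorem exists_inner_eq_of_bound {𝓗 W : Type*} [NormedAddCommGroup 𝓗] [InnerProductSpace ℝ 𝓗]
    [CompleteSpace 𝓗] [AddCommGroup W] [Module ℝ W] (J : W →ₗ[ℝ] 𝓗) (L : W →ₗ[ℝ] ℝ) {M : ℝ}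
    (hM : 0 ≤ M) (h : ∀ w, |L w| ≤ M * ‖J w‖) :
    ∃ G : 𝓗, ‖G‖ ≤ M ∧ ∀ w, inner ℝ (J w) G = L w := by
  obtain ⟨s, hs⟩ := J.rangeRestrict.exists_rightInverse_of_surjective J.range_rangeRestrict
  have hs' : ∀ y : LinearMap.range J, J (s y) = y := fun y =>
    congrArg Subtype.val (LinearMap.congr_fun hs y)
  let ℓ : LinearMap.range J →L[ℝ] ℝ := (L ∘ₗ s).mkContinuous M fun y => by
    have := h (s y)
    rwa [hs'] at this
  have hℓ : ‖ℓ‖ ≤ M := LinearMap.mkContinuous_norm_le _ hM _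
  have hℓJ : ∀ w, ℓ ⟨J w, w, rfl⟩ = L w := by
    intro w
    have h1 : |L (s ⟨J w, w, rfl⟩ - w)| ≤ M * ‖J (s ⟨J w, w, rfl⟩ - w)‖ := h _
    rw [map_sub J, hs', sub_self, norm_zero, mul_zero, map_sub] at h1
    exact sub_eq_zero.1 (abs_nonpos_iff.1 h1)
  obtain ⟨g, hg, hgn⟩ := exists_extension_norm_eq (LinearMap.range J) ℓ
  refine ⟨(InnerProductSpace.toDual ℝ 𝓗).symm g, by simpa [hgn] using hℓ, fun w => ?_⟩
  rw [real_inner_comm, InnerProductSpace.toDual_symm_apply, ← hℓJ w]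
  exact hg ⟨J w, w, rfl⟩

variable {N : ℕ} {law : Fin N → NoiseLaw} {μ : Measure (Fin N → ℝ)} {p : (Fin N → ℝ) → ℝ}
  {X : Type*} [NormedAddCommGroup X] [InnerProductSpace ℝ X]

theorem HasDensity.memLp_smul [IsFiniteMeasure μ] (h : HasDensity law μ p)
    {φ : (Fin N → ℝ) → ℝ} (hφ : IsTest (box law) φ) {s : (Fin N → ℝ) → ℝ}
    (hs : ContinuousOn s (box law)) (x : X) :
    MemLp (fun z => (φ z * s z) • x) 2 μ := by
  obtain ⟨C, hC⟩ := hφ.compact.isCompact.exists_bound_of_continuousOn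
    ((hφ.contDiff.continuous.continuousOn.mul hs).mono hφ.support)
  refine MemLp.of_bound (C := max C 0 * ‖x‖) ?_ (Eventually.of_forall fun z => ?_)
  · refine AEStronglyMeasurable.mono_ac h.absolutelyContinuous ?_
    exact ((hφ.contDiff.continuous.continuousOn.mul hs).aestronglyMeasurable
      (isOpen_box law).measurableSet).smul_const x
  · rw [norm_smul]
    gcongr
    by_cases hz : z ∈ tsupport φ
    · exact (hC z hz).trans (le_max_left _ _)
    · simp [image_eq_zero_of_notMem_tsupport hz]

/-- The vector `φ s x` of `L₂(μ; X)` for a test function `φ` and a weight `s`. -/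
noncomputable def HasDensity.testVec [IsFiniteMeasure μ] (h : HasDensity law μ p)
    {s : (Fin N → ℝ) → ℝ} (hs : ContinuousOn s (box law)) {φ : (Fin N → ℝ) → ℝ}
    (hφ : IsTest (box law) φ) (x : X) : Lp X 2 μ :=
  (h.memLp_smul hφ hs x).toLp _

/-- The factor `s` contains `1 / p` and cancels the density, which turns an inner product in L₂(μ)
into a pairing with respect to Lebesgue measure. -/
theorem HasDensity.inner_testVec [CompleteSpace X] [IsFiniteMeasure μ] (h : HasDensity law μ p)
    {s : (Fin N → ℝ) → ℝ} (hs : ContinuousOn s (box law)) {φ : (Fin N → ℝ) → ℝ}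
    (hφ : IsTest (box law) φ) (x : X) (f : Lp X 2 μ) {t : (Fin N → ℝ) → ℝ} {g : (Fin N → ℝ) → X}
    (hst : ∀ z ∈ box law, p z * s z * t z = 1) (hg : LocallyIntegrableOn g (box law) volume)
    (hfg : ∀ᵐ z ∂volume.restrict (box law), f z = t z • g z) :
    inner ℝ (h.testVec hs hφ x) f = inner ℝ x (∫ z in box law, φ z • g z) := by
  rw [L2.inner_def, ← integral_inner (𝕜 := ℝ) (hφ.integrableOn hg), h.integral_eq]
  refine integral_congr_ae ?_
  filter_upwards [h.absolutelyContinuous'.ae_le (h.memLp_smul hφ hs x).coeFn_toLp, hfg,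
    ae_restrict_mem (isOpen_box law).measurableSet] with z h1 h2 h3
  rw [HasDensity.testVec, h1, h2, real_inner_smul_left, inner_smul_right, inner_smul_right,
    smul_eq_mul]
  linear_combination φ z * inner ℝ x (g z) * hst z h3

theorem HasDensity.continuousOn_inv (h : HasDensity law μ p) :
    ContinuousOn (fun z => (p z)⁻¹) (box law) :=
  h.continuousOn.inv₀ fun z hz => (h.pos z hz).ne'

theorem HasDensity.continuousOn_inv_mul (h : HasDensity law μ p) (α : Fin N → ℕ) :
    ContinuousOn (fun z => (p z)⁻¹ * (rhoPow law α z)⁻¹) (box law) :=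
  h.continuousOn_inv.mul ((continuousOn_rhoPow α).inv₀ fun _ hz => (rhoPow_pos α hz).ne')

/-- Test functions with values in `X`, as finite formal sums of elementary tensors. -/
abbrev TestSum (law : Fin N → NoiseLaw) (X : Type*) [NormedAddCommGroup X] : Type _ :=
  ({φ : (Fin N → ℝ) → ℝ // IsTest (box law) φ} × X) →₀ ℝ

variable [IsFiniteMeasure μ]

/-- The vectors `ρ ^ (-α / 2) p⁻¹ Φ`, where `Φ` is a test function. -/
noncomputable def HasDensity.testLow (h : HasDensity law μ p) (α : Fin N → ℕ) :
    TestSum law X →ₗ[ℝ] Lp X 2 μ :=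
  Finsupp.linearCombination ℝ fun i => h.testVec (h.continuousOn_inv_mul α) i.1.2 i.2

/-- The vectors `(-1) ^ |α| p⁻¹ ∂^α Φ`, where `Φ` is a test function. -/
noncomputable def HasDensity.testHigh (h : HasDensity law μ p) (α : Fin N → ℕ) :
    TestSum law X →ₗ[ℝ] Lp X 2 μ :=
  Finsupp.linearCombination ℝ fun i =>
    (-1 : ℝ) ^ order α • h.testVec h.continuousOn_inv (i.1.2.partialDeriv α) i.2

theorem linearCombination_inner_eq {ι 𝓗 : Type*} [NormedAddCommGroup 𝓗] [InnerProductSpace ℝ 𝓗]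
    {j k : ι → 𝓗} {f G : 𝓗} (h : ∀ i, inner ℝ (k i) f = inner ℝ (j i) G) (c : ι →₀ ℝ) :
    inner ℝ (Finsupp.linearCombination ℝ k c) f = inner ℝ (Finsupp.linearCombination ℝ j c) G := by
  simp only [Finsupp.linearCombination_apply, Finsupp.sum, sum_inner, real_inner_smul_left, h]

variable [CompleteSpace X] {𝕜 : Type*} [RCLike 𝕜] [InnerProductSpace 𝕜 X] [IsScalarTower ℝ 𝕜 X]

theorem HasDensity.inner_testHigh (h : HasDensity law μ p) (α : Fin N → ℕ) (f : Lp X 2 μ)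
    {φ : (Fin N → ℝ) → ℝ} (hφ : IsTest (box law) φ) (x : X) :
    inner ℝ ((-1 : ℝ) ^ order α • h.testVec h.continuousOn_inv (hφ.partialDeriv α) x) f =
      inner ℝ x ((-1 : ℝ) ^ order α • ∫ z in box law, partialDeriv α φ z • f z) := by
  rw [real_inner_smul_left, inner_smul_right,
    h.inner_testVec h.continuousOn_inv (hφ.partialDeriv α) x f (t := fun _ => 1) (g := f)
      (fun z hz => by rw [mul_one, mul_inv_cancel₀ (h.pos z hz).ne'])
      (h.locallyIntegrableOn (Lp.memLp f)) (Eventually.of_forall fun z => (one_smul _ _).symm)]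

theorem HasDensity.inner_testLow (h : HasDensity law μ p) (α : Fin N → ℕ) (G : Lp X 2 μ)
    {g : (Fin N → ℝ) → X} (hg : LocallyIntegrableOn g (box law) volume)
    (hG : ∀ᵐ z ∂volume.restrict (box law), G z = rhoPow law α z • g z)
    {φ : (Fin N → ℝ) → ℝ} (hφ : IsTest (box law) φ) (x : X) :
    inner ℝ (h.testVec (h.continuousOn_inv_mul α) hφ x) G =
      inner ℝ x (∫ z in box law, φ z • g z) :=
  h.inner_testVec (h.continuousOn_inv_mul α) hφ x G (fun z hz => by
    have h1 := (h.pos z hz).ne'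
    have h2 := (rhoPow_pos α hz).ne'
    field_simp) hg hG

theorem neg_one_pow_smul_eq_iff (n : ℕ) (a b : X) :
    (-1 : ℝ) ^ n • a = b ↔ a = (-1 : ℝ) ^ n • b := by
  have h : (-1 : ℝ) ^ n * (-1) ^ n = 1 := by rw [← mul_pow]; simp
  constructor
  · rintro rfl
    rw [smul_smul, h, one_smul]
  · rintro rfl
    rw [smul_smul, h, one_smul]

theorem HasDensity.abs_inner_le (h : HasDensity law μ p) {α : Fin N → ℕ} {f : Lp X 2 μ}
    {g : (Fin N → ℝ) → X} (hfg : IsWeakPartial 𝕜 (box law) α f g) {M : ℝ} (hM : 0 ≤ M)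
    (hg : MemLp (fun z => (rhoPow law α z : 𝕜) • g z) 2 μ)
    (hgM : eLpNorm (fun z => (rhoPow law α z : 𝕜) • g z) 2 μ ≤ ENNReal.ofReal M)
    (c : TestSum law X) : |inner ℝ (h.testHigh α c) f| ≤ M * ‖h.testLow (X := X) α c‖ := by
  obtain ⟨-, h2, h3⟩ := isWeakPartial_iff.1 hfg
  have hGn : ‖hg.toLp‖ ≤ M := by
    rw [Lp.norm_toLp]
    exact ENNReal.toReal_le_of_le_ofReal hM hgM
  have hG := h.absolutelyContinuous'.ae_le hg.coeFn_toLp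
  have h4 : inner ℝ (h.testHigh α c) f = inner ℝ (h.testLow α c) hg.toLp := by
    refine linearCombination_inner_eq (fun i => ?_) c
    rw [h.inner_testHigh α f i.1.2, h.inner_testLow α _ h2 (by
      filter_upwards [hG] with z hz
      rw [hz, RCLike.real_smul_eq_coe_smul (K := 𝕜)])]
    congr 1
    rw [neg_one_pow_smul_eq_iff]
    exact h3 _ i.1.2
  rw [h4, mul_comm]
  exact (abs_real_inner_le_norm _ _).trans (by gcongr)

/-- The hypothesis says that Φ ↦ (-1)^|α| ∫ ∂^α Φ · f is bounded in the L₂(μ) norm of ρ^(-α/2) p⁻¹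
Φ. The vector `G` representing this functional has norm at most `M` and plays the role of ρ^(α/2)
∂^α f, so dividing by the weight yields the weak derivative. -/
theorem HasDensity.exists_isWeakPartial (h : HasDensity law μ p) {α : Fin N → ℕ} {f : Lp X 2 μ}
    {M : ℝ} (hM : 0 ≤ M)
    (hb : ∀ c : TestSum law X, |inner ℝ (h.testHigh α c) f| ≤ M * ‖h.testLow (X := X) α c‖) :
    ∃ g, IsWeakPartial 𝕜 (box law) α f g ∧ MemLp (fun z => (rhoPow law α z : 𝕜) • g z) 2 μ ∧
      eLpNorm (fun z => (rhoPow law α z : 𝕜) • g z) 2 μ ≤ ENNReal.ofReal M := by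
  obtain ⟨G, hGM, hG⟩ := exists_inner_eq_of_bound (h.testLow (X := X) α)
    ((innerSL ℝ f).toLinearMap ∘ₗ h.testHigh α) hM (fun c => by
      simpa [real_inner_comm] using hb c)
  let g : (Fin N → ℝ) → X := fun z => (rhoPow law α z)⁻¹ • G z
  have hg : LocallyIntegrableOn g (box law) volume :=
    (h.locallyIntegrableOn (Lp.memLp G)).continuousOn_smul (isOpen_box law).isLocallyClosed
      ((continuousOn_rhoPow α).inv₀ fun _ hz => (rhoPow_pos α hz).ne')
  have hgG : ∀ᵐ z ∂volume.restrict (box law), G z = rhoPow law α z • g z := by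
    filter_upwards [ae_restrict_mem (isOpen_box law).measurableSet] with z hz
    rw [smul_smul, mul_inv_cancel₀ (rhoPow_pos α hz).ne', one_smul]
  have hGae : (fun z => (rhoPow law α z : 𝕜) • g z) =ᵐ[μ] G := by
    filter_upwards [h.absolutelyContinuous.ae_le hgG] with z hz
    rw [hz, RCLike.real_smul_eq_coe_smul (K := 𝕜)]
  refine ⟨g, isWeakPartial_iff.2 ⟨h.locallyIntegrableOn (Lp.memLp f), hg, fun φ hφ => ?_⟩,
    (memLp_congr_ae hGae).2 (Lp.memLp G), ?_⟩
  · rw [← neg_one_pow_smul_eq_iff]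
    refine ext_inner_left ℝ fun x => ?_
    rw [← h.inner_testHigh α f hφ, ← h.inner_testLow α G hg hgG hφ]
    have h1 := hG (Finsupp.single (⟨φ, hφ⟩, x) 1)
    simp only [HasDensity.testLow, HasDensity.testHigh, LinearMap.comp_apply,
      Finsupp.linearCombination_single, one_smul] at h1
    rw [h1]
    exact real_inner_comm _ _
  · rw [eLpNorm_congr_ae hGae, ← ENNReal.ofReal_toReal (Lp.eLpNorm_ne_top G)]
    exact ENNReal.ofReal_le_ofReal hGM

/-- The dual bound of weighted weak derivatives up to the order `q`. -/
def HasDensity.DualBound (h : HasDensity law μ p) (q : ℕ) (f : Lp X 2 μ) (M : ℝ) : Prop :=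
  ∀ α : Fin N → ℕ, order α ≤ q → ∀ c : TestSum law X,
    |inner ℝ (h.testHigh α c) f| ≤ M * ‖h.testLow (X := X) α c‖

theorem HasDensity.DualBound.memSobolev {h : HasDensity law μ p} {q : ℕ} {f : Lp X 2 μ} {M : ℝ}
    (hM : 0 ≤ M) (hf : h.DualBound q f M) :
    MemSobolev 𝕜 law μ q f ∧ sobolevNorm 𝕜 law μ q f ≤ √((multiIndices N q).card) * M := by
  have hμ := h.absolutelyContinuous
  have hmem : MemSobolev 𝕜 law μ q f := fun α hα => by
    obtain ⟨g, h1, h2, -⟩ := h.exists_isWeakPartial (𝕜 := 𝕜) hM (hf α hα)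
    exact ⟨g, h1, h2⟩
  refine ⟨hmem, sobolevNorm_le hM fun α hα => ?_⟩
  obtain ⟨g, h1, -, h3⟩ := h.exists_isWeakPartial (𝕜 := 𝕜) hM (hf α hα)
  refine (eLpNorm_congr_ae ?_).trans_le h3
  filter_upwards [hμ.ae_le ((hmem.weakPartial hμ hα).1.ae_eq (isOpen_box law) h1
    EventuallyEq.rfl)] with z hz
  rw [hz]

theorem HasDensity.dualBound (h : HasDensity law μ p) {q : ℕ} {f : Lp X 2 μ}
    (hf : MemSobolev 𝕜 law μ q f) : h.DualBound q f (sobolevNorm 𝕜 law μ q f) := by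
  intro α hα c
  have h1 := hf.weakPartial h.absolutelyContinuous hα
  exact h.abs_inner_le h1.1 sobolevNorm_nonneg h1.2
    (eLpNorm_le_sobolevNorm h.absolutelyContinuous hf hα) c

end Duality

/-! ### Semigroups generated by maximal monotone operators -/

section Semigroup

variable {𝓗 : Type*} [NormedAddCommGroup 𝓗] [InnerProductSpace ℝ 𝓗]

/-- `Γ` is the graph of a densely defined maximal monotone linear operator. -/
structure IsMaxMonotone (Γ : Submodule ℝ (𝓗 × 𝓗)) : Prop where
  nonneg : ∀ x y, (x, y) ∈ Γ → 0 ≤ inner ℝ y x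
  surj : ∀ l : ℝ, 0 < l → ∀ f, ∃ x y, (x, y) ∈ Γ ∧ l • x + y = f
  dense : Dense {x | ∃ y, (x, y) ∈ Γ}

/-- `T` is a strongly continuous semigroup whose generator has the graph `{(x, -y) | (x, y) ∈ Γ}`. -/
structure GeneratesNeg (Γ : Submodule ℝ (𝓗 × 𝓗)) (T : ℝ≥0 → 𝓗 →L[ℝ] 𝓗) : Prop where
  map_zero : ∀ x, T 0 x = x
  map_add : ∀ s t x, T (s + t) x = T s (T t x)
  continuous : ∀ x, Continuous fun t => T t x
  mem_iff : ∀ x y, (x, y) ∈ Γ ↔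
    Tendsto (fun t : ℝ≥0 => (t : ℝ)⁻¹ • (T t x - x)) (𝓝[>] 0) (𝓝 (-y))

variable {Γ : Submodule ℝ (𝓗 × 𝓗)}

theorem IsMaxMonotone.mul_norm_le (h : IsMaxMonotone Γ) {l : ℝ} {x y : 𝓗}
    (hxy : (x, y) ∈ Γ) : l * ‖x‖ ≤ ‖l • x + y‖ := by
  by_cases hx : ‖x‖ = 0
  · rw [hx, mul_zero]; exact norm_nonneg _
  have h1 : l * ‖x‖ ^ 2 ≤ ‖l • x + y‖ * ‖x‖ := by
    calc l * ‖x‖ ^ 2 ≤ inner ℝ (l • x + y) x := by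
          rw [inner_add_left, real_inner_smul_left, real_inner_self_eq_norm_sq]
          linarith [h.nonneg x y hxy]
      _ ≤ _ := real_inner_le_norm _ _
  have h2 : 0 < ‖x‖ := lt_of_le_of_ne (norm_nonneg _) (Ne.symm hx)
  nlinarith

theorem IsMaxMonotone.exists_resolvent (h : IsMaxMonotone Γ) {l : ℝ} (hl : 0 < l) :
    ∃ J : 𝓗 →L[ℝ] 𝓗, (∀ f, (J f, f - l • J f) ∈ Γ) ∧ (∀ f, ‖J f‖ ≤ l⁻¹ * ‖f‖) ∧
      ∀ x y, (x, y) ∈ Γ → J (l • x + y) = x := by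
  choose u v huv hf using h.surj l hl
  have huniq : ∀ x y x' y', (x, y) ∈ Γ → (x', y') ∈ Γ → l • x + y = l • x' + y' → x = x' := by
    intro x y x' y' h1 h2 h3
    have h4 : l * ‖x - x'‖ ≤ ‖l • (x - x') + (y - y')‖ := h.mul_norm_le (Γ.sub_mem h1 h2)
    have h5 : l • (x - x') + (y - y') = 0 := by
      rw [smul_sub, ← sub_eq_zero.2 h3]; abel
    rw [h5, norm_zero] at h4
    have : ‖x - x'‖ ≤ 0 := by
      by_contra hc
      push Not at hc
      nlinarith
    exact sub_eq_zero.1 (norm_le_zero_iff.1 this)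
  let J : 𝓗 →ₗ[ℝ] 𝓗 :=
    { toFun := u
      map_add' := fun f g => huniq _ _ _ _ (huv _) (Γ.add_mem (huv f) (huv g)) (by
        rw [hf]
        nth_rewrite 1 [← hf f, ← hf g]
        simp only [smul_add]; abel)
      map_smul' := fun c f => huniq _ _ _ _ (huv _) (Γ.smul_mem c (huv f)) (by
        rw [hf]
        nth_rewrite 1 [← hf f]
        simp only [RingHom.id_apply, smul_add, smul_comm l c]) }
  have hb : ∀ f, ‖J f‖ ≤ l⁻¹ * ‖f‖ := by
    intro f
    have := h.mul_norm_le (l := l) (huv f)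
    rw [hf] at this
    change ‖u f‖ ≤ _
    rw [inv_mul_eq_div, le_div_iff₀ hl]
    linarith
  refine ⟨J.mkContinuous l⁻¹ hb, fun f => ?_, hb, fun x y hxy => ?_⟩
  · have : f - l • u f = v f := by
      nth_rewrite 1 [← hf f]; abel
    change (u f, f - l • u f) ∈ Γ
    rw [this]
    exact huv f
  · exact huniq _ _ _ _ (huv _) hxy (hf _)

/-- On the domain x - λ J x = J y, which is O(1/λ). Since the operators λ J are contractions,
density of the domain extends the convergence to all `x`. -/
theorem IsMaxMonotone.tendsto_resolvent (h : IsMaxMonotone Γ) {J : ℕ → 𝓗 →L[ℝ] 𝓗}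
    (hJn : ∀ n f, ‖J n f‖ ≤ ((n : ℝ) + 1)⁻¹ * ‖f‖)
    (hJl : ∀ n x y, (x, y) ∈ Γ → J n (((n : ℝ) + 1) • x + y) = x) (x : 𝓗) :
    Tendsto (fun n : ℕ => ((n : ℝ) + 1) • J n x) atTop (𝓝 x) := by
  have hn : ∀ n : ℕ, (0 : ℝ) < n + 1 := fun n => by positivity
  rw [Metric.tendsto_atTop]
  intro ε hε
  obtain ⟨x', hx', ⟨y', hxy'⟩⟩ := Metric.dense_iff.1 h.dense x (ε / 3) (by positivity)
  obtain ⟨n₀, hn₀⟩ := exists_nat_gt (‖y'‖ / (ε / 3))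
  refine ⟨n₀, fun n hnn => ?_⟩
  have h1 : x' - ((n : ℝ) + 1) • J n x' = J n y' := by
    nth_rewrite 1 [← hJl n x' y' hxy']
    rw [map_add, map_smul]; abel
  have hx'' : ‖x - x'‖ < ε / 3 := by
    rw [← dist_eq_norm, dist_comm]; exact hx'
  have h2 : ‖J n y'‖ < ε / 3 := by
    refine (hJn n y').trans_lt ?_
    rw [inv_mul_lt_iff₀ (hn n)]
    rw [div_lt_iff₀ (by positivity)] at hn₀
    have : (n₀ : ℝ) ≤ n := by exact_mod_cast hnn
    nlinarith
  have h3 : ‖((n : ℝ) + 1) • J n (x - x')‖ ≤ ‖x - x'‖ := by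
    rw [norm_smul, Real.norm_of_nonneg (hn n).le]
    have := hJn n (x - x')
    calc _ ≤ ((n : ℝ) + 1) * (((n : ℝ) + 1)⁻¹ * ‖x - x'‖) := by gcongr
      _ = _ := by rw [← mul_assoc, mul_inv_cancel₀ (hn n).ne', one_mul]
  have h4 : ((n : ℝ) + 1) • J n x - x =
      ((n : ℝ) + 1) • J n (x - x') - (x - x') - J n y' := by
    rw [← h1, map_sub, smul_sub]; abel
  rw [dist_eq_norm, h4]
  have := norm_sub_le (((n : ℝ) + 1) • J n (x - x') - (x - x')) (J n y')
  have := norm_sub_le (((n : ℝ) + 1) • J n (x - x')) (x - x')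
  linarith

/-- The Yosida approximation. -/
theorem IsMaxMonotone.exists_yosida (h : IsMaxMonotone Γ) :
    ∃ Y : ℕ → 𝓗 →L[ℝ] 𝓗, (∀ n x, 0 ≤ inner ℝ (Y n x) x) ∧ (∀ m n, Commute (Y m) (Y n)) ∧
      (∀ x y, (x, y) ∈ Γ → Tendsto (fun n => Y n x) atTop (𝓝 y)) ∧
      ∀ S : 𝓗 →L[ℝ] 𝓗, (∀ x y, (x, y) ∈ Γ → (S x, S y) ∈ Γ) → ∀ n, Commute S (Y n) := by
  have hn : ∀ n : ℕ, (0 : ℝ) < n + 1 := fun n => by positivity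
  choose J hJ hJn hJl using fun n : ℕ => h.exists_resolvent (hn n)
  have hJS : ∀ S : 𝓗 →L[ℝ] 𝓗, (∀ x y, (x, y) ∈ Γ → (S x, S y) ∈ Γ) → ∀ n f,
      J n (S f) = S (J n f) := by
    intro S hS n f
    have h1 := hJl n _ _ (hS _ _ (hJ n f))
    rwa [← map_smul, ← map_add, add_sub_cancel] at h1
  have hJJ : ∀ m n f, J m (J n f) = J n (J m f) := by
    intro m n f
    -- It suffices that the resolvent `J n` preserves the graph. Subtract (J y, y - λ J y) from (x,
    -- y) and divide by λ: the result is (J x, J y).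
    refine hJS (J n) (fun x y hxy => ?_) m f
    have h1 := hJ n y
    have h2 := hJl n x y hxy
    have h4 : J n x = ((n : ℝ) + 1)⁻¹ • (x - J n y) := by
      rw [map_add, map_smul] at h2
      have h3 : x - J n y = ((n : ℝ) + 1) • J n x := sub_eq_of_eq_add h2.symm
      rw [h3, smul_smul, inv_mul_cancel₀ (hn n).ne', one_smul]
    have h5 : J n y = ((n : ℝ) + 1)⁻¹ • (y - (y - ((n : ℝ) + 1) • J n y)) := by
      rw [sub_sub_cancel, smul_smul, inv_mul_cancel₀ (hn n).ne', one_smul]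
    rw [h4]
    nth_rewrite 2 [h5]
    exact Γ.smul_mem _ (Γ.sub_mem hxy h1)
  have hlim := fun x => h.tendsto_resolvent hJn hJl x
  let Y : ℕ → 𝓗 →L[ℝ] 𝓗 := fun n =>
    ((n : ℝ) + 1) • (ContinuousLinearMap.id ℝ 𝓗 - ((n : ℝ) + 1) • J n)
  have hY : ∀ n x, Y n x = ((n : ℝ) + 1) • (x - ((n : ℝ) + 1) • J n x) := fun n x => rfl
  refine ⟨Y, fun n x => ?_, fun m n => ?_, fun x y hxy => ?_, fun S hS n => ?_⟩
  · have h1 := h.nonneg _ _ (hJ n x)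
    rw [hY, real_inner_smul_left]
    refine mul_nonneg (hn n).le ?_
    -- Write x = (x - λJx) + λJx; the second part is monotonicity at the graph point (J x, x - λ J
    -- x).
    have h2 : inner ℝ (x - ((n : ℝ) + 1) • J n x) x = inner ℝ (x - ((n : ℝ) + 1) • J n x)
        (x - ((n : ℝ) + 1) • J n x) + ((n : ℝ) + 1) *
          inner ℝ (x - ((n : ℝ) + 1) • J n x) (J n x) := by
      rw [← real_inner_smul_right, ← inner_add_right, sub_add_cancel]
    rw [h2, real_inner_self_eq_norm_sq]
    have := hn n
    positivity
  · ext f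
    change Y m (Y n f) = Y n (Y m f)
    simp only [hY, map_smul, map_sub, hJJ m n f]
    module
  · have h1 : ∀ n, Y n x = ((n : ℝ) + 1) • J n y := by
      intro n
      rw [hY]
      congr 1
      nth_rewrite 1 [← hJl n x y hxy]
      rw [map_add, map_smul]; abel
    simp only [h1]
    exact hlim y
  · ext f
    change S (Y n f) = Y n (S f)
    simp only [hY, hJS S hS n f, map_smul, map_sub]

end Semigroup

/-! ### Exponentials of bounded monotone operators -/

section Exponential

variable {𝓗 : Type*} [NormedAddCommGroup 𝓗] [InnerProductSpace ℝ 𝓗] [CompleteSpace 𝓗]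

theorem norm_le_of_hasDerivAt_inner_nonpos {w w' : ℝ → 𝓗} (hc : ContinuousOn w (Ici 0))
    (hw : ∀ t, 0 < t → HasDerivAt w (w' t) t) (h : ∀ t, 0 < t → inner ℝ (w' t) (w t) ≤ 0)
    {t : ℝ} (ht : 0 ≤ t) : ‖w t‖ ≤ ‖w 0‖ := by
  have hd : ∀ t, 0 < t → HasDerivAt (fun t => ‖w t‖ ^ 2) (2 * inner ℝ (w t) (w' t)) t :=
    fun t ht => (hw t ht).norm_sq
  have hanti : AntitoneOn (fun t => ‖w t‖ ^ 2) (Ici 0) := by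
    refine antitoneOn_of_deriv_nonpos (convex_Ici 0) (hc.norm.pow 2) ?_ ?_
    · intro t ht
      rw [interior_Ici] at ht
      exact (hd t ht).differentiableAt.differentiableWithinAt
    · intro t ht
      rw [interior_Ici] at ht
      rw [(hd t ht).deriv, real_inner_comm]
      linarith [h t ht]
  have := hanti (mem_Ici.2 le_rfl) (mem_Ici.2 ht) ht
  exact (sq_le_sq₀ (norm_nonneg _) (norm_nonneg _)).1 this

/-- The semigroup generated by a bounded operator `-B`. -/
noncomputable def expNeg (B : 𝓗 →L[ℝ] 𝓗) (t : ℝ) : 𝓗 →L[ℝ] 𝓗 := NormedSpace.exp (t • (-B))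

theorem expNeg_zero (B : 𝓗 →L[ℝ] 𝓗) : expNeg B 0 = 1 := by simp [expNeg]

theorem hasDerivAt_expNeg (B : 𝓗 →L[ℝ] 𝓗) (t : ℝ) :
    HasDerivAt (expNeg B) (expNeg B t * (-B)) t :=
  hasDerivAt_exp_smul_const (𝕂 := ℝ) (-B) t

theorem commute_expNeg {S B : 𝓗 →L[ℝ] 𝓗} (h : Commute S B) (t : ℝ) : Commute S (expNeg B t) :=
  ((h.neg_right).smul_right t).exp_right

theorem expNeg_add (B : 𝓗 →L[ℝ] 𝓗) (s t : ℝ) : expNeg B (s + t) = expNeg B s * expNeg B t := by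
  unfold expNeg
  rw [add_smul]
  let _ : NormedAlgebra ℚ (𝓗 →L[ℝ] 𝓗) := NormedAlgebra.restrictScalars ℚ ℝ _
  exact NormedSpace.exp_add_of_commute
    (((Commute.refl (-B)).smul_left s).smul_right t)

theorem hasDerivAt_expNeg_apply (B : 𝓗 →L[ℝ] 𝓗) (x : 𝓗) (t : ℝ) :
    HasDerivAt (fun t => expNeg B t x) (-(expNeg B t (B x))) t := by
  have := (hasDerivAt_expNeg B t).clm_apply (hasDerivAt_const t x)
  simpa using this

theorem continuous_expNeg_apply (B : 𝓗 →L[ℝ] 𝓗) (x : 𝓗) : Continuous fun t => expNeg B t x :=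
  continuous_iff_continuousAt.2 fun t => (hasDerivAt_expNeg_apply B x t).continuousAt

theorem norm_expNeg_le {B : 𝓗 →L[ℝ] 𝓗} (hB : ∀ x, 0 ≤ inner ℝ (B x) x) {t : ℝ} (ht : 0 ≤ t)
    (x : 𝓗) : ‖expNeg B t x‖ ≤ ‖x‖ := by
  have := norm_le_of_hasDerivAt_inner_nonpos (w := fun t => expNeg B t x)
    (w' := fun t => -(expNeg B t (B x))) (continuous_expNeg_apply B x).continuousOn
    (fun t _ => hasDerivAt_expNeg_apply B x t) (fun t _ => by
      have h1 : expNeg B t (B x) = B (expNeg B t x) :=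
        (congrArg (fun L : 𝓗 →L[ℝ] 𝓗 => L x) (commute_expNeg (Commute.refl B) t)).symm
      rw [h1, inner_neg_left]
      linarith [hB (expNeg B t x)]) ht
  simpa [expNeg_zero] using this

/-- Interpolate by s ↦ e^{-(t-s)C} e^{-sB} x. By commutativity its derivative is a contraction
applied to (C - B) x. -/
theorem norm_expNeg_sub_le {B C : 𝓗 →L[ℝ] 𝓗} (hB : ∀ x, 0 ≤ inner ℝ (B x) x)
    (hC : ∀ x, 0 ≤ inner ℝ (C x) x) (hBC : Commute B C) {t : ℝ} (ht : 0 ≤ t) (x : 𝓗) :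
    ‖expNeg B t x - expNeg C t x‖ ≤ t * ‖B x - C x‖ := by
  let g : ℝ → 𝓗 := fun s => expNeg C (t - s) (expNeg B s x)
  have hg : ∀ s, HasDerivAt g (expNeg C (t - s) (expNeg B s (C x - B x))) s := by
    intro s
    have h1 : HasDerivAt (fun s => expNeg C (t - s)) (-(expNeg C (t - s) * (-C))) s := by
      have := (hasDerivAt_expNeg C (t - s)).scomp s ((hasDerivAt_id s).const_sub t)
      simpa [Function.comp_def] using this
    have h2 := h1.clm_apply (hasDerivAt_expNeg_apply B x s)
    refine h2.congr_deriv ?_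
    have h3 : C (expNeg B s x) = expNeg B s (C x) :=
      congrArg (fun L : 𝓗 →L[ℝ] 𝓗 => L x) (commute_expNeg hBC.symm s)
    have h4 : (-(expNeg C (t - s) * (-C))) (expNeg B s x) =
        expNeg C (t - s) (C (expNeg B s x)) := by
      rw [mul_neg, neg_neg]; rfl
    rw [h4, h3, map_neg, map_sub, map_sub]
    abel
  have hbound : ∀ s ∈ Ico 0 t, ‖expNeg C (t - s) (expNeg B s (C x - B x))‖ ≤ ‖B x - C x‖ := by
    intro s hs
    rw [norm_sub_rev]
    exact (norm_expNeg_le hC (by linarith [hs.2]) _).trans (norm_expNeg_le hB hs.1 _)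
  have := norm_image_sub_le_of_norm_deriv_le_segment' (f := g)
    (fun s _ => (hg s).hasDerivWithinAt) hbound t (right_mem_Icc.2 ht)
  simp only [g, sub_self, sub_zero, expNeg_zero] at this
  rw [mul_comm]
  exact this

end Exponential

/-! ### The Hille–Yosida theorem -/

section HilleYosida

variable {𝓗 : Type*} [NormedAddCommGroup 𝓗] [InnerProductSpace ℝ 𝓗] [CompleteSpace 𝓗]
  {Γ : Submodule ℝ (𝓗 × 𝓗)}

theorem norm_expNeg_sub_expNeg_le {B : 𝓗 →L[ℝ] 𝓗} (hB : ∀ x, 0 ≤ inner ℝ (B x) x) {s t : ℝ}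
    (hs : 0 ≤ s) (hst : s ≤ t) (x : 𝓗) : ‖expNeg B t x - expNeg B s x‖ ≤ (t - s) * ‖B x‖ := by
  rw [mul_comm]
  refine norm_image_sub_le_of_norm_deriv_le_segment' (f := fun t => expNeg B t x)
    (fun r _ => (hasDerivAt_expNeg_apply B x r).hasDerivWithinAt) (fun r hr => ?_) t
    (right_mem_Icc.2 hst)
  rw [norm_neg]
  exact norm_expNeg_le hB (hs.trans hr.1) _

/-- First order Taylor expansion with a remainder that avoids ‖B²x‖, which need not stay bounded
along Yosida approximations. The vector `y` stands for a point of the domain near `B x`, and ‖B y‖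
does stay bounded. -/
theorem norm_expNeg_sub_add_smul_le {B : 𝓗 →L[ℝ] 𝓗} (hB : ∀ x, 0 ≤ inner ℝ (B x) x) {t : ℝ}
    (ht : 0 ≤ t) (x y : 𝓗) :
    ‖expNeg B t x - x + t • B x‖ ≤ (t * ‖B y‖ + 2 * ‖B x - y‖) * t := by
  have hd : ∀ r ∈ Icc 0 t, HasDerivWithinAt (fun r => expNeg B r x + r • B x)
      (-(expNeg B r (B x)) + (1 : ℝ) • B x) (Icc 0 t) r := fun r _ =>
    ((hasDerivAt_expNeg_apply B x r).add ((hasDerivAt_id r).smul_const (B x))).hasDerivWithinAt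
  have h := norm_image_sub_le_of_norm_deriv_le_segment' hd (C := t * ‖B y‖ + 2 * ‖B x - y‖)
    (fun r hr => ?_) t (right_mem_Icc.2 ht)
  · have h1 : expNeg B t x - x + t • B x =
        expNeg B t x + t • B x - (expNeg B 0 x + (0 : ℝ) • B x) := by
      rw [expNeg_zero, zero_smul, add_zero]
      change _ = expNeg B t x + t • B x - x
      abel
    rw [h1]
    simpa using h
  · have h2 : -(expNeg B r (B x)) + (1 : ℝ) • B x =
        (B x - y) - expNeg B r (B x - y) - (expNeg B r y - y) := by
      rw [map_sub, one_smul]; abel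
    have h3 : ‖expNeg B r y - y‖ ≤ r * ‖B y‖ := by
      have := norm_expNeg_sub_expNeg_le hB le_rfl hr.1 y
      rw [expNeg_zero, sub_zero] at this
      exact this
    have h4 := norm_expNeg_le hB hr.1 (B x - y)
    have h5 : r * ‖B y‖ ≤ t * ‖B y‖ := mul_le_mul_of_nonneg_right hr.2.le (norm_nonneg _)
    rw [h2]
    have := norm_sub_le ((B x - y) - expNeg B r (B x - y)) (expNeg B r y - y)
    have := norm_sub_le (B x - y) (expNeg B r (B x - y))
    linarith

/-- The Hille–Yosida theorem for maximal monotone operators in a Hilbert space. -/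
theorem IsMaxMonotone.exists_generatesNeg (h : IsMaxMonotone Γ) :
    ∃ T : ℝ≥0 → 𝓗 →L[ℝ] 𝓗, GeneratesNeg Γ T ∧
      ∀ S : 𝓗 →L[ℝ] 𝓗, (∀ x y, (x, y) ∈ Γ → (S x, S y) ∈ Γ) → ∀ t x, S (T t x) = T t (S x) := by
  obtain ⟨Y, hY, hYY, hYlim, hYS⟩ := h.exists_yosida
  have happrox : ∀ x : 𝓗, ∀ ε > 0, ∃ x' y', (x', y') ∈ Γ ∧ ‖x - x'‖ < ε := by
    intro x ε hε
    obtain ⟨x', hx', ⟨y', hxy'⟩⟩ := Metric.dense_iff.1 h.dense x ε hε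
    exact ⟨x', y', hxy', by rw [← dist_eq_norm, dist_comm]; exact hx'⟩
  have hcauchy : ∀ (t : ℝ≥0) (x : 𝓗), CauchySeq fun n => expNeg (Y n) t x := by
    intro t x
    rw [Metric.cauchySeq_iff']
    intro ε hε
    obtain ⟨x', y', hxy', hx'⟩ := happrox x (ε / 3) (by positivity)
    have hc := (hYlim x' y' hxy').cauchySeq
    obtain ⟨n₀, hn₀⟩ := Metric.cauchySeq_iff'.1 hc (ε / 3 / (t + 1)) (by positivity)
    refine ⟨n₀, fun n hn => ?_⟩
    have h1 := norm_expNeg_sub_le (hY n) (hY n₀) (hYY n n₀) t.2 x'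
    have h2 : (t : ℝ) * ‖Y n x' - Y n₀ x'‖ ≤ ε / 3 := by
      have := hn₀ n hn
      rw [dist_eq_norm, lt_div_iff₀ (by positivity)] at this
      nlinarith [norm_nonneg (Y n x' - Y n₀ x'), t.2]
    have h3 := norm_expNeg_le (hY n) t.2 (x - x')
    have h4 := norm_expNeg_le (hY n₀) t.2 (x - x')
    rw [dist_eq_norm]
    have h5 : expNeg (Y n) t x - expNeg (Y n₀) t x = expNeg (Y n) t (x - x') +
        (expNeg (Y n) t x' - expNeg (Y n₀) t x') - expNeg (Y n₀) t (x - x') := by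
      rw [map_sub, map_sub]; abel
    rw [h5]
    have h6 := norm_sub_le (expNeg (Y n) t (x - x') +
        (expNeg (Y n) t x' - expNeg (Y n₀) t x')) (expNeg (Y n₀) t (x - x'))
    have h7 := norm_add_le (expNeg (Y n) t (x - x')) (expNeg (Y n) t x' - expNeg (Y n₀) t x')
    exact lt_of_le_of_lt (h6.trans (add_le_add (h7.trans (add_le_add h3 (h1.trans h2))) h4))
      (by linarith)
  have hex : ∀ t : ℝ≥0, ∃ L : 𝓗 →L[ℝ] 𝓗, ∀ x,
      Tendsto (fun n => expNeg (Y n) t x) atTop (𝓝 (L x)) := by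
    intro t
    choose f hf using fun x => cauchySeq_tendsto_of_complete (hcauchy t x)
    refine ⟨continuousLinearMapOfTendsto (fun n => expNeg (Y n) t) (f := f)
      (tendsto_pi_nhds.2 hf), hf⟩
  choose T hT using hex
  have hTn : ∀ t x, ‖T t x‖ ≤ ‖x‖ := fun t x =>
    le_of_tendsto (hT t x).norm (Eventually.of_forall fun n => norm_expNeg_le (hY n) t.2 x)
  have h0 : ∀ x, T 0 x = x := by
    intro x
    refine tendsto_nhds_unique (hT 0 x) ?_
    simp only [NNReal.coe_zero, expNeg_zero]
    exact tendsto_const_nhds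
  have hadd : ∀ s t x, T (s + t) x = T s (T t x) := by
    intro s t x
    refine tendsto_nhds_unique (hT (s + t) x) ?_
    have h1 : Tendsto (fun n => expNeg (Y n) s (expNeg (Y n) t x - T t x)) atTop (𝓝 0) := by
      refine squeeze_zero_norm (fun n => norm_expNeg_le (hY n) s.2 _) ?_
      have := ((hT t x).sub_const (T t x)).norm
      rwa [sub_self, norm_zero] at this
    have h2 := h1.add (hT s (T t x))
    rw [zero_add] at h2
    refine h2.congr fun n => ?_
    rw [NNReal.coe_add, expNeg_add, map_sub, sub_add_cancel]
    rfl
  have hlip : ∀ x y, (x, y) ∈ Γ → ∀ s t : ℝ≥0, s ≤ t → ‖T t x - T s x‖ ≤ (t - s) * ‖y‖ := by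
    intro x y hxy s t hst
    exact le_of_tendsto_of_tendsto ((hT t x).sub (hT s x)).norm
      ((hYlim x y hxy).norm.const_mul _)
      (Eventually.of_forall fun n => norm_expNeg_sub_expNeg_le (hY n) s.2 hst x)
  have hcont : ∀ x, Continuous fun t => T t x := by
    intro x
    have hdist : ∀ x' y', (x', y') ∈ Γ → ∀ s t : ℝ≥0,
        ‖T t x - T s x‖ ≤ 2 * ‖x - x'‖ + dist t s * ‖y'‖ := by
      intro x' y' hxy' s t
      have h1 : ‖T t x' - T s x'‖ ≤ dist t s * ‖y'‖ := by
        rw [NNReal.dist_eq]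
        rcases le_total s t with hst | hst
        · rw [abs_of_nonneg (sub_nonneg.2 (by exact_mod_cast hst))]
          exact hlip x' y' hxy' s t hst
        · rw [abs_sub_comm, abs_of_nonneg (sub_nonneg.2 (by exact_mod_cast hst)), norm_sub_rev]
          exact hlip x' y' hxy' t s hst
      have h2 : T t x - T s x = T t (x - x') + (T t x' - T s x') - T s (x - x') := by
        rw [map_sub, map_sub]; abel
      rw [h2]
      have := norm_sub_le (T t (x - x') + (T t x' - T s x')) (T s (x - x'))
      have := norm_add_le (T t (x - x')) (T t x' - T s x')
      have := hTn t (x - x')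
      have := hTn s (x - x')
      linarith
    rw [Metric.continuous_iff]
    intro s ε hε
    obtain ⟨x', y', hxy', hx'⟩ := happrox x (ε / 4) (by positivity)
    refine ⟨ε / 4 / (‖y'‖ + 1), by positivity, fun t ht => ?_⟩
    rw [lt_div_iff₀ (by positivity)] at ht
    rw [dist_eq_norm]
    refine (hdist x' y' hxy' s t).trans_lt ?_
    nlinarith [norm_nonneg y', dist_nonneg (x := t) (y := s)]
  have hgen : ∀ x y, (x, y) ∈ Γ →
      Tendsto (fun t : ℝ≥0 => (t : ℝ)⁻¹ • (T t x - x)) (𝓝[>] 0) (𝓝 (-y)) := by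
    intro x y hxy
    have hest : ∀ y' z', (y', z') ∈ Γ → ∀ t : ℝ≥0,
        ‖T t x - x + (t : ℝ) • y‖ ≤ (t * ‖z'‖ + 2 * ‖y - y'‖) * t := by
      intro y' z' hyz t
      exact le_of_tendsto_of_tendsto
        (((hT t x).sub_const x).add ((hYlim x y hxy).const_smul (t : ℝ))).norm
        ((((hYlim y' z' hyz).norm.const_mul (t : ℝ)).add
          (((hYlim x y hxy).sub_const y').norm.const_mul 2)).mul_const (t : ℝ))
        (Eventually.of_forall fun n => norm_expNeg_sub_add_smul_le (hY n) t.2 x y')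
    rw [Metric.tendsto_nhdsWithin_nhds]
    intro ε hε
    obtain ⟨y', z', hyz, hy'⟩ := happrox y (ε / 4) (by positivity)
    refine ⟨ε / 4 / (‖z'‖ + 1), by positivity, fun {t} ht htd => ?_⟩
    have ht0 : (0 : ℝ) < t := ht
    rw [lt_div_iff₀ (by positivity), NNReal.dist_eq, NNReal.coe_zero, sub_zero, abs_of_pos ht0]
      at htd
    have h1 : (t : ℝ)⁻¹ • (T t x - x) - -y = (t : ℝ)⁻¹ • (T t x - x + (t : ℝ) • y) := by
      rw [smul_add, smul_smul, inv_mul_cancel₀ ht0.ne', one_smul, sub_neg_eq_add]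
    rw [dist_eq_norm, h1, norm_smul, norm_inv, Real.norm_of_nonneg ht0.le, inv_mul_lt_iff₀ ht0,
      mul_comm (t : ℝ)]
    refine (hest y' z' hyz t).trans_lt (mul_lt_mul_of_pos_right ?_ ht0)
    nlinarith [norm_nonneg z']
  refine ⟨T, ⟨h0, hadd, hcont, fun x y => ⟨hgen x y, fun hxy => ?_⟩⟩, fun S hS t x => ?_⟩
  -- The generator cannot be larger than -A: choose a graph point with x' + y' = x + y. Then d = x -
  -- x' is in the domain of the generator with value d itself, and dissipativity of the contractions
  -- gives ‖d‖² ≤ 0.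
  · obtain ⟨x', y', hxy', he⟩ := h.surj 1 one_pos (x + y)
    rw [one_smul] at he
    have h1 := hxy.sub (hgen x' y' hxy')
    have h2 : -y - -y' = x - x' := by
      rw [neg_sub_neg, sub_eq_sub_iff_add_eq_add, add_comm y' x', he]
    rw [h2] at h1
    have h3 : Tendsto (fun t : ℝ≥0 => inner ℝ ((t : ℝ)⁻¹ • (T t (x - x') - (x - x'))) (x - x'))
        (𝓝[>] 0) (𝓝 (inner ℝ (x - x') (x - x'))) := by
      refine Tendsto.inner (h1.congr fun t => ?_) tendsto_const_nhds
      rw [← smul_sub, map_sub]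
      congr 1; abel
    have h4 : inner ℝ (x - x') (x - x') ≤ (0 : ℝ) := by
      refine le_of_tendsto h3 (Eventually.of_forall fun t => ?_)
      rw [real_inner_smul_left, inner_sub_left, real_inner_self_eq_norm_sq]
      refine mul_nonpos_of_nonneg_of_nonpos (inv_nonneg.2 t.2) ?_
      have := real_inner_le_norm (T t (x - x')) (x - x')
      nlinarith [hTn t (x - x'), norm_nonneg (x - x')]
    have h5 : x = x' := by
      rw [real_inner_self_eq_norm_sq] at h4
      exact sub_eq_zero.1 (norm_eq_zero.1 (pow_eq_zero_iff two_ne_zero |>.1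
        (le_antisymm h4 (sq_nonneg _))))
    subst h5
    rwa [add_left_cancel he] at hxy'
  · refine tendsto_nhds_unique (((S.continuous.tendsto _).comp (hT t x))) ((hT t (S x)).congr ?_)
    intro n
    exact (congrArg (fun L : 𝓗 →L[ℝ] 𝓗 => L x) (commute_expNeg (hYS S hS n) t)).symm

end HilleYosida

/-! ### Differentiability and contractivity of trajectories -/

section Trajectories

variable {𝓗 : Type*} [NormedAddCommGroup 𝓗] [InnerProductSpace ℝ 𝓗] [CompleteSpace 𝓗]
  {Γ : Submodule ℝ (𝓗 × 𝓗)} {T : ℝ≥0 → 𝓗 →L[ℝ] 𝓗}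

theorem GeneratesNeg.map_mem (hT : GeneratesNeg Γ T) {x y : 𝓗} (hxy : (x, y) ∈ Γ) (t : ℝ≥0) :
    (T t x, T t y) ∈ Γ := by
  rw [hT.mem_iff]
  have h := ((T t).continuous.tendsto _).comp ((hT.mem_iff x y).1 hxy)
  rw [map_neg] at h
  refine h.congr fun s => ?_
  rw [Function.comp_apply, map_smul, map_sub, ← hT.map_add, ← hT.map_add, add_comm]

theorem GeneratesNeg.continuous_toNNReal (hT : GeneratesNeg Γ T) (x : 𝓗) :
    Continuous fun t : ℝ => T t.toNNReal x :=
  (hT.continuous x).comp continuous_real_toNNReal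

theorem GeneratesNeg.hasDerivWithinAt_Ioi (hT : GeneratesNeg Γ T) {x y : 𝓗} (hxy : (x, y) ∈ Γ)
    {t : ℝ} (ht : 0 ≤ t) :
    HasDerivWithinAt (fun t : ℝ => T t.toNNReal x) (-(T t.toNNReal y)) (Ioi t) t := by
  have h := (hT.mem_iff _ _).1 (hT.map_mem hxy t.toNNReal)
  rw [hasDerivWithinAt_iff_tendsto_slope, show Ioi t \ {t} = Ioi t by
    ext s; simp only [Set.mem_sdiff, mem_Ioi, mem_singleton_iff]; exact ⟨fun h => h.1, fun h => ⟨h, h.ne'⟩⟩]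
  have h1 : Tendsto (fun s : ℝ => (s - t).toNNReal) (𝓝[>] t) (𝓝[>] 0) := by
    refine tendsto_nhdsWithin_iff.2 ⟨?_, ?_⟩
    · have : Continuous fun s : ℝ => (s - t).toNNReal := by fun_prop
      have h2 := this.tendsto t
      rw [sub_self, Real.toNNReal_zero] at h2
      exact h2.mono_left nhdsWithin_le_nhds
    · filter_upwards [self_mem_nhdsWithin] with s hs
      exact Real.toNNReal_pos.2 (sub_pos.2 hs)
  refine (h.comp h1).congr' ?_
  filter_upwards [self_mem_nhdsWithin] with s hs
  have hs' : 0 ≤ s - t := sub_nonneg.2 (le_of_lt hs)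
  rw [Function.comp_apply, Real.coe_toNNReal _ hs', slope_def_module, ← hT.map_add,
    ← Real.toNNReal_add hs' ht, sub_add_cancel]

/-- The semigroup law gives only right derivatives. They are continuous in time, so the trajectory
is the integral of its right derivative and hence differentiable from both sides. -/
theorem GeneratesNeg.hasDerivAt (hT : GeneratesNeg Γ T) {x y : 𝓗} (hxy : (x, y) ∈ Γ)
    {t : ℝ} (ht : 0 < t) :
    HasDerivAt (fun t : ℝ => T t.toNNReal x) (-(T t.toNNReal y)) t := by
  have hc : Continuous fun t : ℝ => -(T t.toNNReal y) := (hT.continuous_toNNReal y).neg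
  have h1 : ∀ s, 0 ≤ s → T s.toNNReal x = x + ∫ r in (0 : ℝ)..s, -(T r.toNNReal y) := by
    intro s hs
    rw [intervalIntegral.integral_eq_sub_of_hasDeriv_right_of_le hs
      (hT.continuous_toNNReal x).continuousOn (fun r hr => hT.hasDerivWithinAt_Ioi hxy hr.1.le)
      (hc.intervalIntegrable _ _), Real.toNNReal_zero, hT.map_zero, add_sub_cancel]
  have h2 : HasDerivAt (fun s => x + ∫ r in (0 : ℝ)..s, -(T r.toNNReal y)) (-(T t.toNNReal y)) t :=
    (intervalIntegral.integral_hasDerivAt_right (hc.intervalIntegrable _ _)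
      hc.stronglyMeasurable.stronglyMeasurableAtFilter hc.continuousAt).const_add x
  refine h2.congr_of_eventuallyEq ?_
  filter_upwards [lt_mem_nhds ht] with s hs
  exact h1 s hs.le

/-- Contractivity is not part of `GeneratesNeg`. On the domain the norm decreases by monotonicity of
the operator, and density gives the rest. -/
theorem GeneratesNeg.norm_le (hT : GeneratesNeg Γ T) (h : IsMaxMonotone Γ) (t : ℝ≥0) (x : 𝓗) :
    ‖T t x‖ ≤ ‖x‖ := by
  have hcl : IsClosed {x : 𝓗 | ‖T t x‖ ≤ ‖x‖} :=
    isClosed_le (T t).continuous.norm continuous_norm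
  refine hcl.closure_subset_iff.2 ?_ (h.dense x)
  rintro x ⟨y, hxy⟩
  have := norm_le_of_hasDerivAt_inner_nonpos (hT.continuous_toNNReal x).continuousOn
    (fun s hs => hT.hasDerivAt hxy hs) (fun s _ => by
      rw [inner_neg_left]
      linarith [h.nonneg _ _ (hT.map_mem hxy s.toNNReal)]) t.2
  simpa [hT.map_zero] using this

end Trajectories

/-! ### Laplace transforms of trajectories and Fourier inversion -/

section Fourier

variable {𝓗 : Type*} [NormedAddCommGroup 𝓗] [InnerProductSpace ℝ 𝓗]

/-- `(λ + A) U = F` for `λ = a + i b` in the complexification of `𝓗`, where `Γ` is the graph of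
`A`. -/
def IsShift (Γ : Submodule ℝ (𝓗 × 𝓗)) (a b : ℝ) (U F : 𝓗 × 𝓗) : Prop :=
  (U.1, F.1 - a • U.1 + b • U.2) ∈ Γ ∧ (U.2, F.2 - b • U.1 - a • U.2) ∈ Γ

/-- The complexification of the functional `⟪w, ·⟫`. -/
noncomputable def cpair (w : 𝓗) (U : 𝓗 × 𝓗) : ℂ :=
  (inner ℝ w U.1 : ℝ) + (inner ℝ w U.2 : ℝ) * Complex.I

theorem norm_cpair_le (w : 𝓗) (U : 𝓗 × 𝓗) : ‖cpair w U‖ ≤ ‖w‖ * (‖U.1‖ + ‖U.2‖) := by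
  refine (norm_add_le _ _).trans ?_
  rw [norm_mul, Complex.norm_I, mul_one, Complex.norm_real, Complex.norm_real, mul_add]
  exact add_le_add (norm_inner_le_norm _ _) (norm_inner_le_norm _ _)

variable [CompleteSpace 𝓗] {Γ : Submodule ℝ (𝓗 × 𝓗)} {T : ℝ≥0 → 𝓗 →L[ℝ] 𝓗}

/-- The complexified trajectory tested against `w`. -/
noncomputable def ctraj (T : ℝ≥0 → 𝓗 →L[ℝ] 𝓗) (w : 𝓗) (U : 𝓗 × 𝓗) (t : ℝ) : ℂ :=
  cpair w (T t.toNNReal U.1, T t.toNNReal U.2)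

theorem GeneratesNeg.continuous_ctraj (hT : GeneratesNeg Γ T) (w : 𝓗) (U : 𝓗 × 𝓗) :
    Continuous (ctraj T w U) := by
  have h1 := hT.continuous_toNNReal U.1
  have h2 := hT.continuous_toNNReal U.2
  exact (Complex.continuous_ofReal.comp (continuous_const.inner h1)).add
    ((Complex.continuous_ofReal.comp (continuous_const.inner h2)).mul continuous_const)

theorem GeneratesNeg.norm_ctraj_le (hT : GeneratesNeg Γ T) (h : IsMaxMonotone Γ) (w : 𝓗)
    (U : 𝓗 × 𝓗) (t : ℝ) : ‖ctraj T w U t‖ ≤ ‖w‖ * (‖U.1‖ + ‖U.2‖) := by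
  refine (norm_cpair_le _ _).trans ?_
  have := hT.norm_le h t.toNNReal U.1
  have := hT.norm_le h t.toNNReal U.2
  gcongr

/-- Since A U = F - λU, the derivative -T(t)AU of the trajectory equals λ T(t)U - T(t)F. -/
theorem GeneratesNeg.hasDerivAt_ctraj (hT : GeneratesNeg Γ T) (w : 𝓗) {a b : ℝ} {U F : 𝓗 × 𝓗}
    (hU : IsShift Γ a b U F) {t : ℝ} (ht : 0 < t) :
    HasDerivAt (ctraj T w U) ((a + b * Complex.I) * ctraj T w U t - ctraj T w F t) t := by
  have h1 := (hasDerivAt_const t w).inner ℝ (hT.hasDerivAt hU.1 ht)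
  have h2 := (hasDerivAt_const t w).inner ℝ (hT.hasDerivAt hU.2 ht)
  have h3 := h1.ofReal_comp.add (h2.ofReal_comp.mul_const Complex.I)
  refine h3.congr_deriv ?_
  simp only [ctraj, cpair, inner_zero_left, add_zero, map_sub, _root_.map_add, map_smul, inner_neg_right,
    inner_sub_right, inner_add_right, real_inner_smul_right, Complex.ofReal_neg, Complex.ofReal_sub,
    Complex.ofReal_add, Complex.ofReal_mul]
  linear_combination (-(b : ℂ) * (inner ℝ w (T t.toNNReal U.2) : ℝ)) * Complex.I_sq

theorem integrableOn_pow_mul_exp_mul {a : ℝ} (ha : 0 < a) (n : ℕ) (b : ℝ) {f : ℝ → ℂ}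
    (hf : Continuous f) {M : ℝ} (hM : ∀ t, ‖f t‖ ≤ M) :
    IntegrableOn (fun t : ℝ => (t : ℂ) ^ n * Complex.exp (-(a + b * Complex.I) * t) * f t)
      (Ioi 0) := by
  have h0 : IntegrableOn (fun t : ℝ => t ^ (n : ℝ) * Real.exp (-a * t)) (Ioi 0) :=
    integrableOn_rpow_mul_exp_neg_mul_rpow (p := 1) (s := n) (b := a)
      (by have : (0 : ℝ) ≤ n := n.cast_nonneg
          linarith) one_pos ha |>.congr_fun (fun t _ => by simp) measurableSet_Ioi
  refine (h0.const_mul M).mono' (Continuous.aestronglyMeasurable (by fun_prop)) ?_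
  filter_upwards [ae_restrict_mem measurableSet_Ioi] with t ht
  have ht0 : (0 : ℝ) < t := ht
  rw [norm_mul, norm_mul, norm_pow, Complex.norm_real, Real.norm_of_nonneg ht0.le,
    Complex.norm_exp, Real.rpow_natCast]
  have : (-(a + b * Complex.I) * t : ℂ).re = -a * t := by simp
  rw [this, mul_comm M]
  gcongr
  exact hM t

theorem tendsto_pow_mul_exp_mul {a : ℝ} (ha : 0 < a) (n : ℕ) (b : ℝ) {f : ℝ → ℂ}
    {M : ℝ} (hM : ∀ t, ‖f t‖ ≤ M) :
    Tendsto (fun t : ℝ => (t : ℂ) ^ n * Complex.exp (-(a + b * Complex.I) * t) * f t) atTop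
      (𝓝 0) := by
  have h0 : Tendsto (fun t : ℝ => t ^ (n : ℝ) * Real.exp (-a * t) * M) atTop (𝓝 0) := by
    have := (tendsto_rpow_mul_exp_neg_mul_atTop_nhds_zero n a ha).mul_const M
    rwa [zero_mul] at this
  refine squeeze_zero_norm' ?_ h0
  filter_upwards [eventually_gt_atTop 0] with t ht0
  rw [norm_mul, norm_mul, norm_pow, Complex.norm_real, Real.norm_of_nonneg ht0.le,
    Complex.norm_exp, Real.rpow_natCast]
  have : (-(a + b * Complex.I) * t : ℂ).re = -a * t := by simp
  rw [this]
  gcongr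
  exact hM t

/-- One step of the computation of the Laplace transform along a chain of resolvents. -/
theorem GeneratesNeg.integral_ctraj_step (hT : GeneratesNeg Γ T) (h : IsMaxMonotone Γ) (w : 𝓗)
    {a b : ℝ} (ha : 0 < a) {U F : 𝓗 × 𝓗} (hU : IsShift Γ a b U F) (n : ℕ) :
    ∫ t in Ioi (0 : ℝ), (t : ℂ) ^ n * Complex.exp (-(a + b * Complex.I) * t) * ctraj T w F t =
      (0 : ℂ) ^ n * cpair w U + n * ∫ t in Ioi (0 : ℝ), (t : ℂ) ^ (n - 1) *
        Complex.exp (-(a + b * Complex.I) * t) * ctraj T w U t := by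
  have hi := fun (k : ℕ) (U : 𝓗 × 𝓗) => integrableOn_pow_mul_exp_mul ha k b
    (hT.continuous_ctraj w U) (hT.norm_ctraj_le h w U)
  -- Integrate the derivative of tⁿ e^{-λt} T(t)U: the λ-terms cancel. The boundary term at 0
  -- carries `0 ^ n`, which is 1 exactly for n = 0; in that case the factor `n` removes the term
  -- with the truncated exponent `n - 1`.
  have hd : ∀ t ∈ Ioi (0 : ℝ), HasDerivAt
      (fun t : ℝ => (t : ℂ) ^ n * Complex.exp (-(a + b * Complex.I) * t) * ctraj T w U t)
      (n * ((t : ℂ) ^ (n - 1) * Complex.exp (-(a + b * Complex.I) * t) * ctraj T w U t) -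
        (t : ℂ) ^ n * Complex.exp (-(a + b * Complex.I) * t) * ctraj T w F t) t := by
    intro t ht
    have h1 : HasDerivAt (fun t : ℝ => (t : ℂ)) 1 t := Complex.ofRealCLM.hasDerivAt
    have h2 := h1.pow n
    have h3 := (h1.const_mul (-(a + b * Complex.I))).cexp
    refine ((h2.mul h3).mul (hT.hasDerivAt_ctraj w hU ht)).congr_deriv ?_
    simp only [Pi.mul_apply, Pi.pow_apply]
    ring
  have h1 := integral_Ioi_of_hasDerivAt_of_tendsto
    (f := fun t : ℝ => (t : ℂ) ^ n * Complex.exp (-(a + b * Complex.I) * t) * ctraj T w U t)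
    (Continuous.continuousWithinAt (by have := hT.continuous_ctraj w U; fun_prop)) hd
    (((hi (n - 1) U).const_mul _).sub (hi n F))
    (tendsto_pow_mul_exp_mul ha n b (hT.norm_ctraj_le h w U))
  rw [integral_sub ((hi (n - 1) U).const_mul _) (hi n F), integral_const_mul] at h1
  have h2 : ctraj T w U 0 = cpair w U := by
    simp [ctraj, hT.map_zero]
  simp only [Complex.ofReal_zero, mul_zero, Complex.exp_zero, mul_one, h2] at h1
  linear_combination -h1

/-- The sequence `U` is the chain of iterated resolvents (λ+A)^{-k} U₀; each integration by parts
trades one power of `t` for one resolvent. -/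
theorem GeneratesNeg.integral_ctraj (hT : GeneratesNeg Γ T) (h : IsMaxMonotone Γ) (w : 𝓗)
    {a b : ℝ} (ha : 0 < a) (n : ℕ) : ∀ U : ℕ → 𝓗 × 𝓗, (∀ k ≤ n, IsShift Γ a b (U (k + 1)) (U k)) →
    ∫ t in Ioi (0 : ℝ), (t : ℂ) ^ n * Complex.exp (-(a + b * Complex.I) * t) * ctraj T w (U 0) t =
      n.factorial * cpair w (U (n + 1)) := by
  induction n with
  | zero =>
    intro U hU
    have := hT.integral_ctraj_step h w ha (hU 0 le_rfl) 0
    simpa using this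
  | succ n ih =>
    intro U hU
    have h1 := hT.integral_ctraj_step h w ha (hU 0 (Nat.zero_le _)) (n + 1)
    have h2 := ih (fun k => U (k + 1)) (fun k hk => hU (k + 1) (by omega))
    rw [h1, Nat.add_sub_cancel, h2, Nat.factorial_succ]
    push_cast
    ring

theorem integral_inv_sq_add_sq {c : ℝ} (hc : 0 < c) :
    Integrable (fun s : ℝ => (c ^ 2 + (2 * Real.pi * s) ^ 2)⁻¹) ∧
      ∫ s : ℝ, (c ^ 2 + (2 * Real.pi * s) ^ 2)⁻¹ = (2 * c)⁻¹ := by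
  have hp := Real.pi_pos
  have h1 : ∀ s : ℝ, (c ^ 2 + (2 * Real.pi * s) ^ 2)⁻¹ =
      (c ^ 2)⁻¹ * (1 + (2 * Real.pi / c * s) ^ 2)⁻¹ := by
    intro s
    rw [← mul_inv]
    congr 1
    field_simp
  simp only [h1]
  have hne : 2 * Real.pi / c ≠ 0 := by positivity
  refine ⟨(integrable_inv_one_add_sq.comp_mul_left' hne).const_mul _, ?_⟩
  rw [integral_const_mul, Measure.integral_comp_mul_left (fun s : ℝ => (1 + s ^ 2)⁻¹),
    integral_univ_inv_one_add_sq, abs_of_pos (by positivity), smul_eq_mul]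
  field_simp

open scoped FourierTransform in
/-- Pointwise bounds for a trajectory from bounds for powers of the resolvent, by Fourier
inversion. -/
theorem GeneratesNeg.pow_mul_abs_inner_le (hT : GeneratesNeg Γ T) (h : IsMaxMonotone Γ) (w x : 𝓗)
    {τ : ℝ≥0} (hτ : 0 < τ) {n : ℕ} (hn : n ≠ 0) {M : ℝ}
    (hres : ∀ b : ℝ, ∃ U : ℕ → 𝓗 × 𝓗, U 0 = (x, 0) ∧
      (∀ k ≤ n, IsShift Γ (τ : ℝ)⁻¹ b (U (k + 1)) (U k)) ∧
      ‖cpair w (U (n + 1))‖ ≤ M * (((τ : ℝ)⁻¹) ^ 2 + b ^ 2)⁻¹) :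
    (τ : ℝ) ^ n * |inner ℝ w (T τ x)| ≤ Real.exp 1 * n.factorial * M * τ / 2 := by
  have hτ0 : (0 : ℝ) < τ := hτ
  -- On the line Re λ = 1/τ the weight e^{-ct} equals e⁻¹ at t = τ, which explains the factor `exp
  -- 1`.
  set c : ℝ := (τ : ℝ)⁻¹ with hcdef
  have hc : 0 < c := inv_pos.2 hτ0
  let g : ℝ → ℂ := (Ioi 0).indicator fun t =>
    (t : ℂ) ^ n * Complex.exp (-(c : ℂ) * t) * ctraj T w (x, 0) t
  have hbd := hT.norm_ctraj_le h w (x, 0)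
  have hct := hT.continuous_ctraj w (x, 0)
  have hgc : Continuous g := by
    -- Because n ≥ 1, the factor tⁿ removes the jump at 0. Continuity is needed for inversion at the
    -- single point τ.
    refine Continuous.indicator (fun t ht => ?_) (by fun_prop)
    rw [frontier_Ioi, mem_singleton_iff] at ht
    simp [ht, hn]
  have hgi : Integrable g := by
    rw [integrable_indicator_iff measurableSet_Ioi]
    have := integrableOn_pow_mul_exp_mul hc n 0 hct hbd
    simpa using this
  have hF : ∀ s : ℝ, ‖𝓕 g s‖ ≤ n.factorial * M * (c ^ 2 + (2 * Real.pi * s) ^ 2)⁻¹ := by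
    intro s
    obtain ⟨U, hU0, hU, hUM⟩ := hres (2 * Real.pi * s)
    have h1 : 𝓕 g s = n.factorial * cpair w (U (n + 1)) := by
      rw [← hT.integral_ctraj h w hc n U hU, Real.fourier_real_eq_integral_exp_smul,
        ← integral_indicator measurableSet_Ioi]
      refine integral_congr_ae (Eventually.of_forall fun t => ?_)
      by_cases ht : t ∈ Ioi (0 : ℝ)
      · simp only [g, indicator_of_mem ht, hU0, smul_eq_mul]
        have : Complex.exp (-(c + (2 * Real.pi * s : ℝ) * Complex.I) * t) =
            Complex.exp ((-2 * Real.pi * t * s : ℝ) * Complex.I) * Complex.exp (-(c : ℂ) * t) := by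
          rw [← Complex.exp_add]
          congr 1
          push_cast
          ring
        rw [this]
        ring
      · simp only [g, indicator_of_notMem ht, smul_zero]
    rw [h1, norm_mul, Complex.norm_natCast, mul_assoc]
    gcongr
  obtain ⟨hi, hint⟩ := integral_inv_sq_add_sq hc
  have hFi : Integrable (𝓕 g) := by
    refine (hi.const_mul (n.factorial * M)).mono' ?_ (Eventually.of_forall hF)
    exact (VectorFourier.fourierIntegral_continuous Real.continuous_fourierChar
      (by exact continuous_inner) hgi).aestronglyMeasurable
  have hinv := congrFun (hgc.fourierInv_fourier_eq hgi hFi) τ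
  have h1 : ‖g τ‖ ≤ n.factorial * M * (2 * c)⁻¹ := by
    rw [← hinv, ← hint, ← integral_const_mul, Real.fourierInv_eq']
    refine (norm_integral_le_integral_norm _).trans (integral_mono_of_nonneg
      (Eventually.of_forall fun s => norm_nonneg _) (hi.const_mul _)
      (Eventually.of_forall fun s => ?_))
    refine le_trans (le_of_eq ?_) (hF s)
    simp only [norm_smul, Complex.norm_exp_ofReal_mul_I, one_mul]
  have h2 : ‖g τ‖ = (τ : ℝ) ^ n * Real.exp (-1) * |inner ℝ w (T τ x)| := by
    simp only [g, indicator_of_mem (show (τ : ℝ) ∈ Ioi (0 : ℝ) from hτ0), ctraj, cpair,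
      Real.toNNReal_coe, _root_.map_zero, inner_zero_right, Complex.ofReal_zero, zero_mul, add_zero]
    rw [norm_mul, norm_mul, norm_pow, Complex.norm_real, Complex.norm_real, Complex.norm_exp,
      Real.norm_of_nonneg hτ0.le, Real.norm_eq_abs]
    have : (-(c : ℂ) * (τ : ℝ)).re = -1 := by
      rw [← Complex.ofReal_neg, ← Complex.ofReal_mul, Complex.ofReal_re, neg_mul, hcdef,
        inv_mul_cancel₀ hτ0.ne']
    rw [this]
  have h3 : (2 * c)⁻¹ = τ / 2 := by
    rw [hcdef, mul_inv, inv_inv]; ring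
  rw [h2, h3] at h1
  have h4 : Real.exp 1 * Real.exp (-1) = 1 := by rw [← Real.exp_add]; simp
  calc (τ : ℝ) ^ n * |inner ℝ w (T τ x)|
      = Real.exp 1 * ((τ : ℝ) ^ n * Real.exp (-1) * |inner ℝ w (T τ x)|) := by
        linear_combination (-(τ : ℝ) ^ n * |inner ℝ w (T τ x)|) * h4
    _ ≤ Real.exp 1 * (n.factorial * M * (τ / 2)) := by gcongr
    _ = _ := by ring

end Fourier

/-! ### Complexification of coefficient families -/

section CoefAdd

variable {N : ℕ} {U : Set (Fin N → ℝ)} {X Y : Type*} [NormedAddCommGroup X] [InnerProductSpace ℝ X]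
  [NormedAddCommGroup Y] [InnerProductSpace ℝ Y]

theorem IsCoef.add {B C : (Fin N → ℝ) → X →L[ℝ] Y} (hB : IsCoef U B) (hC : IsCoef U C) :
    IsCoef U fun z => B z + C z where
  meas x := (hB.meas x).add (hC.meas x)
  bdd := by
    obtain ⟨b, hb, hb'⟩ := hB.bdd
    obtain ⟨c, hc, hc'⟩ := hC.bdd
    refine ⟨fun z => b z + c z, hb.add hc, ?_⟩
    filter_upwards [hb', hc'] with z h1 h2
    exact (norm_add_le _ _).trans (add_le_add h1 h2)

theorem IsCoef.const (L : X →L[ℝ] Y) : IsCoef U fun _ => L where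
  meas _ := aestronglyMeasurable_const
  bdd := ⟨fun _ => ‖L‖, continuousOn_const, Eventually.of_forall fun _ => le_rfl⟩

variable {j : Fin N}

theorem CoefDeriv.add {B B' C C' : (Fin N → ℝ) → X →L[ℝ] Y} (hB : CoefDeriv U j B B')
    (hC : CoefDeriv U j C C') : CoefDeriv U j (fun z => B z + C z) fun z => B' z + C' z where
  left := hB.left.add hC.left
  right := hB.right.add hC.right
  mul x y h h' hh := by
    refine ((hB.mul x y h h' hh).add (hC.mul x y h h' hh)).congr
      (Eventually.of_forall fun z => ?_) (Eventually.of_forall fun z => ?_) <;>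
    · simp only [add_apply, inner_add_right]
      ring

theorem CoefDeriv.const (L : X →L[ℝ] Y) : CoefDeriv U j (fun _ => L) fun _ => 0 where
  left := IsCoef.const L
  right := IsCoef.const 0
  mul x y h h' hh := by
    refine (hh.const_smul (inner ℝ y (L x))).congr
      (Eventually.of_forall fun z => rfl) (Eventually.of_forall fun z => ?_)
    simp

/-- The jet of a constant coefficient. -/
def constJet (L : X →L[ℝ] Y) : List (Fin N) → (Fin N → ℝ) → X →L[ℝ] Y
  | [], _ => L
  | _ :: _, _ => 0

theorem isCoefJet_constJet (L : X →L[ℝ] Y) (ℓ : ℕ) : IsCoefJet U ℓ (constJet (N := N) L) where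
  coef w _ := by cases w <;> exact IsCoef.const _
  deriv w j _ := by cases w <;> exact CoefDeriv.const _

theorem IsCoefJet.add {ℓ : ℕ} {B C : List (Fin N) → (Fin N → ℝ) → X →L[ℝ] Y}
    (hB : IsCoefJet U ℓ B) (hC : IsCoefJet U ℓ C) : IsCoefJet U ℓ fun w z => B w z + C w z where
  coef w hw := (hB.coef w hw).add (hC.coef w hw)
  deriv w j hw := (hB.deriv w j hw).add (hC.deriv w j hw)

end CoefAdd

/-! ### Pairs and block operators -/

section Pairs

variable {X Y : Type*} [NormedAddCommGroup X] [InnerProductSpace ℝ X]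
  [NormedAddCommGroup Y] [InnerProductSpace ℝ Y]

theorem separableSpace_pair [TopologicalSpace.SeparableSpace X] :
    TopologicalSpace.SeparableSpace (WithLp 2 (X × X)) :=
  (WithLp.prodContinuousLinearEquiv 2 ℝ X X).symm.surjective.denseRange.separableSpace
    (WithLp.prodContinuousLinearEquiv 2 ℝ X X).symm.continuous

/-- The embedding of the first component. -/
noncomputable def pairInl : X →L[ℝ] WithLp 2 (X × X) :=
  (WithLp.prodContinuousLinearEquiv 2 ℝ X X).symm.toContinuousLinearMap ∘L
    ContinuousLinearMap.inl ℝ X X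

/-- The embedding of the second component. -/
noncomputable def pairInr : X →L[ℝ] WithLp 2 (X × X) :=
  (WithLp.prodContinuousLinearEquiv 2 ℝ X X).symm.toContinuousLinearMap ∘L
    ContinuousLinearMap.inr ℝ X X

theorem norm_pairInl (x : X) : ‖pairInl x‖ = ‖x‖ := by
  rw [← sq_eq_sq₀ (norm_nonneg _) (norm_nonneg _), WithLp.prod_norm_sq_eq_of_L2]
  simp [pairInl]

theorem norm_pairInr (x : X) : ‖pairInr x‖ = ‖x‖ := by
  rw [← sq_eq_sq₀ (norm_nonneg _) (norm_nonneg _), WithLp.prod_norm_sq_eq_of_L2]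
  simp [pairInr]

theorem pairInl_add_pairInr (x y : X) : pairInl x + pairInr y = WithLp.toLp 2 (x, y) := by
  rw [pairInl, pairInr]
  change WithLp.toLp 2 (x, (0 : X)) + WithLp.toLp 2 ((0 : X), y) = _
  rw [← WithLp.toLp_add, Prod.mk_add_mk, add_zero, zero_add]

theorem norm_fst_le_pair (x : WithLp 2 (X × X)) : ‖x.fst‖ ≤ ‖x‖ := by
  rw [← sq_le_sq₀ (norm_nonneg _) (norm_nonneg _), WithLp.prod_norm_sq_eq_of_L2]
  linarith [sq_nonneg ‖x.snd‖]

theorem norm_snd_le_pair (x : WithLp 2 (X × X)) : ‖x.snd‖ ≤ ‖x‖ := by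
  rw [← sq_le_sq₀ (norm_nonneg _) (norm_nonneg _), WithLp.prod_norm_sq_eq_of_L2]
  linarith [sq_nonneg ‖x.fst‖]

theorem norm_pair_le (x : WithLp 2 (X × X)) : ‖x‖ ≤ ‖x.fst‖ + ‖x.snd‖ := by
  rw [← sq_le_sq₀ (norm_nonneg _) (by positivity), WithLp.prod_norm_sq_eq_of_L2]
  nlinarith [norm_nonneg x.fst, norm_nonneg x.snd]

/-- The complexification of `P + i Q`. -/
noncomputable def block (P Q : X →L[ℝ] Y) : WithLp 2 (X × X) →L[ℝ] WithLp 2 (Y × Y) :=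
  pairInl ∘L (P ∘L WithLp.fstL 2 ℝ X X - Q ∘L WithLp.sndL 2 ℝ X X) +
    pairInr ∘L (Q ∘L WithLp.fstL 2 ℝ X X + P ∘L WithLp.sndL 2 ℝ X X)

theorem block_apply (P Q : X →L[ℝ] Y) (x : WithLp 2 (X × X)) :
    block P Q x = WithLp.toLp 2 (P x.fst - Q x.snd, Q x.fst + P x.snd) :=
  pairInl_add_pairInr _ _

theorem norm_sq_block (P Q : X →L[ℝ] Y) (x : WithLp 2 (X × X)) :
    ‖block P Q x‖ ^ 2 = ‖P x.fst - Q x.snd‖ ^ 2 + ‖Q x.fst + P x.snd‖ ^ 2 := by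
  rw [block_apply, WithLp.prod_norm_sq_eq_of_L2]
  rfl

theorem inner_block (P Q : X →L[ℝ] Y) (x : WithLp 2 (X × X)) (y : WithLp 2 (Y × Y)) :
    inner ℝ y (block P Q x) = inner ℝ y.fst (P x.fst) - inner ℝ y.fst (Q x.snd) +
      (inner ℝ y.snd (Q x.fst) + inner ℝ y.snd (P x.snd)) := by
  rw [block_apply, WithLp.prod_inner_apply]
  simp [inner_sub_right, inner_add_right]

/-- The constant 1 matters: bounds of the derivatives of the coefficients pass to the
complexification unchanged. -/
theorem block_zero_right_norm_le (P : X →L[ℝ] Y) : ‖block P 0‖ ≤ ‖P‖ := by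
  refine ContinuousLinearMap.opNorm_le_bound _ (norm_nonneg _) fun x => ?_
  rw [← sq_le_sq₀ (norm_nonneg _) (by positivity), mul_pow, norm_sq_block,
    WithLp.prod_norm_sq_eq_of_L2 x]
  simp only [zero_apply, sub_zero, zero_add]
  have h1 := pow_le_pow_left₀ (norm_nonneg _) (P.le_opNorm x.fst) 2
  have h2 := pow_le_pow_left₀ (norm_nonneg _) (P.le_opNorm x.snd) 2
  rw [mul_pow] at h1 h2
  linarith

theorem norm_block_le (P Q : X →L[ℝ] Y) : ‖block P Q‖ ≤ 2 * (‖P‖ + ‖Q‖) := by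
  refine ContinuousLinearMap.opNorm_le_bound _ (by positivity) fun x => ?_
  rw [block_apply]
  refine (norm_pair_le _).trans ?_
  change ‖P x.fst - Q x.snd‖ + ‖Q x.fst + P x.snd‖ ≤ _
  have h1 := norm_sub_le (P x.fst) (Q x.snd)
  have h2 := norm_add_le (Q x.fst) (P x.snd)
  have h3 := P.le_opNorm_of_le (norm_fst_le_pair x)
  have h4 := P.le_opNorm_of_le (norm_snd_le_pair x)
  have h5 := Q.le_opNorm_of_le (norm_fst_le_pair x)
  have h6 := Q.le_opNorm_of_le (norm_snd_le_pair x)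
  linarith

variable {N : ℕ} {U : Set (Fin N → ℝ)}

theorem IsCoef.block {P Q : (Fin N → ℝ) → X →L[ℝ] Y} (hP : IsCoef U P) (hQ : IsCoef U Q) :
    IsCoef U fun z => block (P z) (Q z) where
  meas x := by
    have h1 := (hP.meas x.fst).sub (hQ.meas x.snd)
    have h2 := (hQ.meas x.fst).add (hP.meas x.snd)
    exact ((pairInl (X := Y)).continuous.comp_aestronglyMeasurable h1).add
      ((pairInr (X := Y)).continuous.comp_aestronglyMeasurable h2)
  bdd := by
    obtain ⟨b, hb, hb'⟩ := hP.bdd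
    obtain ⟨c, hc, hc'⟩ := hQ.bdd
    refine ⟨fun z => 2 * (b z + c z), continuousOn_const.mul (hb.add hc), ?_⟩
    filter_upwards [hb', hc'] with z h1 h2
    exact (norm_block_le _ _).trans (by linarith)

theorem CoefDeriv.block {j : Fin N} {P P' Q Q' : (Fin N → ℝ) → X →L[ℝ] Y}
    (hP : CoefDeriv U j P P') (hQ : CoefDeriv U j Q Q') :
    CoefDeriv U j (fun z => block (P z) (Q z)) fun z => block (P' z) (Q' z) where
  left := hP.left.block hQ.left
  right := hP.right.block hQ.right
  mul x y h h' hh := by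
    refine (((hP.mul x.fst y.fst h h' hh).sub (hQ.mul x.snd y.fst h h' hh)).add
      ((hQ.mul x.fst y.snd h h' hh).add (hP.mul x.snd y.snd h h' hh))).congr
      (Eventually.of_forall fun z => ?_) (Eventually.of_forall fun z => ?_) <;>
    · simp only [inner_block]
      ring

theorem IsCoefJet.block {ℓ : ℕ} {P Q : List (Fin N) → (Fin N → ℝ) → X →L[ℝ] Y}
    (hP : IsCoefJet U ℓ P) (hQ : IsCoefJet U ℓ Q) :
    IsCoefJet U ℓ fun w z => block (P w z) (Q w z) where
  coef w hw := (hP.coef w hw).block (hQ.coef w hw)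
  deriv w j hw := (hP.deriv w j hw).block (hQ.deriv w j hw)

end Pairs

/-! ### The sector estimate and invertibility of the shifted operator -/

section Sector

variable {D H : Type*} [NormedAddCommGroup D] [InnerProductSpace ℝ D]
  [NormedAddCommGroup H] [InnerProductSpace ℝ H]

/-- The complexification of `λ + A` for `λ = a + i b`, as an operator on the domain `ι : D → H`
of `A`. -/
noncomputable def shiftBlock (ι A : D →L[ℝ] H) (a b : ℝ) :
    WithLp 2 (D × D) →L[ℝ] WithLp 2 (H × H) :=
  block (A + a • ι) (b • ι)

/-- Expand both components. The cross terms with `a b` cancel between the components and those with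
`b` cancel by symmetry; only 2 Re λ times the quadratic form is left. -/
theorem norm_sq_shiftBlock {ι A : D →L[ℝ] H}
    (hs : ∀ u v, inner ℝ (A u) (ι v) = inner ℝ (ι u) (A v)) (a b : ℝ) (u : WithLp 2 (D × D)) :
    ‖shiftBlock ι A a b u‖ ^ 2 = (a ^ 2 + b ^ 2) * ‖block ι 0 u‖ ^ 2 + ‖block A 0 u‖ ^ 2 +
      2 * a * (inner ℝ (A u.fst) (ι u.fst) + inner ℝ (A u.snd) (ι u.snd)) := by
  simp only [norm_sq_block, shiftBlock, add_apply, zero_apply, sub_zero, zero_add]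
  have h1 := hs u.fst u.snd
  have h2 : ∀ p q : H, ‖p + a • q - b • (ι u.snd)‖ ^ 2 = ‖p‖ ^ 2 + a ^ 2 * ‖q‖ ^ 2 +
      b ^ 2 * ‖ι u.snd‖ ^ 2 + 2 * a * inner ℝ p q - 2 * b * inner ℝ p (ι u.snd) -
      2 * a * b * inner ℝ q (ι u.snd) := by
    intro p q
    rw [norm_sub_sq_real, norm_add_sq_real]
    simp only [inner_add_left, real_inner_smul_left, real_inner_smul_right, norm_smul, mul_pow,
      Real.norm_eq_abs, sq_abs]
    ring
  have h3 : ∀ p q : H, ‖b • (ι u.fst) + (p + a • q)‖ ^ 2 = ‖p‖ ^ 2 + a ^ 2 * ‖q‖ ^ 2 +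
      b ^ 2 * ‖ι u.fst‖ ^ 2 + 2 * a * inner ℝ p q + 2 * b * inner ℝ (ι u.fst) p +
      2 * a * b * inner ℝ (ι u.fst) q := by
    intro p q
    rw [norm_add_sq_real, norm_add_sq_real]
    simp only [inner_add_right, real_inner_smul_left, real_inner_smul_right, norm_smul, mul_pow,
      Real.norm_eq_abs, sq_abs]
    ring
  have h4 := h2 (A u.fst) (ι u.fst)
  have h5 := h3 (A u.snd) (ι u.snd)
  simp only [FunLike.coe_smul, Pi.smul_apply] at h4 h5 ⊢
  rw [h4, h5]
  linear_combination -2 * b * h1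

/-- The sector estimate. -/
theorem le_norm_sq_shiftBlock {ι A : D →L[ℝ] H}
    (hs : ∀ u v, inner ℝ (A u) (ι v) = inner ℝ (ι u) (A v)) (hA : ∀ u, 0 ≤ inner ℝ (A u) (ι u))
    {a b δ : ℝ} (hδ : 0 ≤ δ) (ha : -(δ * √(a ^ 2 + b ^ 2)) ≤ a)
    (u : WithLp 2 (D × D)) :
    (1 - δ) * ((a ^ 2 + b ^ 2) * ‖block ι 0 u‖ ^ 2 + ‖block A 0 u‖ ^ 2) ≤
      ‖shiftBlock ι A a b u‖ ^ 2 := by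
  rw [norm_sq_shiftBlock hs]
  set R := √(a ^ 2 + b ^ 2) with hR
  have hR2 : a ^ 2 + b ^ 2 = R ^ 2 := (Real.sq_sqrt (by positivity)).symm
  have hR0 : 0 ≤ R := Real.sqrt_nonneg _
  set s := inner ℝ (A u.fst) (ι u.fst) + inner ℝ (A u.snd) (ι u.snd) with hs'
  have h0 : 0 ≤ s := add_nonneg (hA _) (hA _)
  have h1 : s = inner ℝ (block A 0 u) (block ι 0 u) := by
    rw [inner_block, block_apply]
    simp [hs']
  have h2 : s ≤ ‖block A 0 u‖ * ‖block ι 0 u‖ := h1 ▸ real_inner_le_norm _ _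
  rw [hR2]
  set p := ‖block ι 0 u‖
  set q := ‖block A 0 u‖
  have h3 : -(δ * R * s) ≤ a * s := by nlinarith
  have h4 : δ * R * s ≤ δ * R * (q * p) := mul_le_mul_of_nonneg_left h2 (by positivity)
  -- Absorb the last term by 2Rpq ≤ R²p² + q².
  nlinarith [mul_nonneg hδ (sq_nonneg (R * p - q))]

/-- The two halves of the sector estimate: the term with `A u` gives a bound in the norm of `D`
uniform in λ, the term with `ι u` gives the decay 1/|λ| in `H`. -/
theorem shiftBlock_bounds {ι A : D →L[ℝ] H}
    (hs : ∀ u v, inner ℝ (A u) (ι v) = inner ℝ (ι u) (A v)) (hA : ∀ u, 0 ≤ inner ℝ (A u) (ι u))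
    {c : ℝ} (hc : 0 < c) (hl : ∀ u, c * ‖u‖ ≤ ‖A u‖)
    {a b δ : ℝ} (hδ : 0 ≤ δ) (hδ1 : δ < 1) (ha : -(δ * √(a ^ 2 + b ^ 2)) ≤ a)
    (u : WithLp 2 (D × D)) :
    √(1 - δ) * c * ‖u‖ ≤ ‖shiftBlock ι A a b u‖ ∧
      √(1 - δ) * √(a ^ 2 + b ^ 2) * ‖block ι 0 u‖ ≤ ‖shiftBlock ι A a b u‖ := by
  have h := le_norm_sq_shiftBlock hs hA hδ ha u
  have h1 : 0 ≤ 1 - δ := by linarith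
  have h2 : c ^ 2 * ‖u‖ ^ 2 ≤ ‖block A 0 u‖ ^ 2 := by
    rw [WithLp.prod_norm_sq_eq_of_L2, norm_sq_block]
    simp only [zero_apply, sub_zero, zero_add]
    have h3 := pow_le_pow_left₀ (by positivity) (hl u.fst) 2
    have h4 := pow_le_pow_left₀ (by positivity) (hl u.snd) 2
    rw [mul_pow] at h3 h4
    linarith
  constructor
  · rw [← sq_le_sq₀ (by positivity) (norm_nonneg _), mul_pow, mul_pow, Real.sq_sqrt h1]
    refine le_trans ?_ h
    rw [mul_assoc]
    refine mul_le_mul_of_nonneg_left (h2.trans ?_) h1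
    have : 0 ≤ (a ^ 2 + b ^ 2) * ‖block ι 0 u‖ ^ 2 := by positivity
    linarith
  · rw [← sq_le_sq₀ (by positivity) (norm_nonneg _), mul_pow, mul_pow, Real.sq_sqrt h1,
      Real.sq_sqrt (by positivity)]
    refine le_trans ?_ h
    rw [mul_assoc]
    refine mul_le_mul_of_nonneg_left ?_ h1
    have : 0 ≤ ‖block A 0 u‖ ^ 2 := by positivity
    linarith

theorem surjective_shiftBlock [CompleteSpace D] [CompleteSpace H] {ι A : D →L[ℝ] H}
    (hs : ∀ u v, inner ℝ (A u) (ι v) = inner ℝ (ι u) (A v)) (hA : ∀ u, 0 ≤ inner ℝ (A u) (ι u))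
    {c : ℝ} (hc : 0 < c) (hl : ∀ u, c * ‖u‖ ≤ ‖A u‖) (hsurj : Function.Surjective A)
    {a b δ : ℝ} (hδ : 0 ≤ δ) (hδ1 : δ < 1) (ha : -(δ * √(a ^ 2 + b ^ 2)) ≤ a) :
    Function.Surjective (shiftBlock ι A a b) := by
  have hk : 0 < √(1 - δ) * c := mul_pos (Real.sqrt_pos.2 (by linarith)) hc
  have hb := fun u => (shiftBlock_bounds hs hA hc hl hδ hδ1 ha u).1
  have hcl : IsClosed (LinearMap.range (shiftBlock ι A a b).toLinearMap : Set (WithLp 2 (H × H))) := by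
    have hanti : AntilipschitzWith (Real.toNNReal (√(1 - δ) * c)⁻¹) (shiftBlock ι A a b) := by
      refine AddMonoidHomClass.antilipschitz_of_bound _ fun u => ?_
      rw [Real.coe_toNNReal _ (inv_nonneg.2 hk.le), inv_mul_eq_div, le_div_iff₀ hk, mul_comm]
      exact hb u
    rw [LinearMap.coe_range]
    exact hanti.isClosed_range (shiftBlock ι A a b).uniformContinuous
  suffices hr : LinearMap.range (shiftBlock ι A a b).toLinearMap = ⊤ from
    LinearMap.range_eq_top.1 hr
  rw [← hcl.submodule_topologicalClosure_eq,
    Submodule.topologicalClosure_eq_top_iff, Submodule.eq_bot_iff]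
  -- The range is closed by the lower bound, so it remains to see that its orthogonal complement is
  -- trivial. Write g = A v. Symmetry shows that the conjugate shift applied to `v` is orthogonal to
  -- the range of `A`, which is everything, and the conjugate shift is injective.
  intro g hg
  obtain ⟨v₁, hv₁⟩ := hsurj g.fst
  obtain ⟨v₂, hv₂⟩ := hsurj g.snd
  have hg' : ∀ u : WithLp 2 (D × D), inner ℝ g (shiftBlock ι A a b u) = 0 := fun u =>
    (real_inner_comm _ _).trans (hg _ ⟨u, rfl⟩)
  have hb' := fun u => (shiftBlock_bounds (a := a) (b := -b) hs hA hc hl hδ hδ1 (by rwa [neg_sq]) u).1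
  have key : shiftBlock ι A a (-b) (WithLp.toLp 2 (v₁, v₂)) = 0 := by
    -- Choose `u` such that `A u` is the conjugate shift of `v` itself; orthogonality then makes a
    -- sum of squares vanish.
    obtain ⟨u₁, hu₁⟩ := hsurj (A v₁ + a • ι v₁ + b • ι v₂)
    obtain ⟨u₂, hu₂⟩ := hsurj (-(b • ι v₁) + A v₂ + a • ι v₂)
    have h1 : inner ℝ g.fst ((A + a • ι) u₁) - inner ℝ g.fst ((b • ι) u₂) +
        (inner ℝ g.snd ((b • ι) u₁) + inner ℝ g.snd ((A + a • ι) u₂)) = 0 :=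
      (inner_block _ _ _ _).symm.trans (hg' (WithLp.toLp 2 (u₁, u₂)))
    rw [← hv₁, ← hv₂] at h1
    have h3 := hs v₁ u₁
    have h4 := hs v₁ u₂
    have h5 := hs v₂ u₁
    have h6 := hs v₂ u₂
    simp only [add_apply, FunLike.coe_smul, Pi.smul_apply,
      inner_add_right, real_inner_smul_right, h3, h4, h5, h6] at h1
    have h2 : inner ℝ (A v₁ + a • ι v₁ + b • ι v₂) (A u₁) +
        inner ℝ (-(b • ι v₁) + A v₂ + a • ι v₂) (A u₂) = 0 := by
      simp only [inner_add_left, inner_neg_left, real_inner_smul_left]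
      linarith
    rw [hu₁, hu₂, real_inner_self_eq_norm_sq, real_inner_self_eq_norm_sq] at h2
    have h7 : ‖A v₁ + a • ι v₁ + b • ι v₂‖ = 0 := by
      rw [← sq_eq_zero_iff]; linarith [sq_nonneg ‖A v₁ + a • ι v₁ + b • ι v₂‖,
        sq_nonneg ‖-(b • ι v₁) + A v₂ + a • ι v₂‖]
    have h8 : ‖-(b • ι v₁) + A v₂ + a • ι v₂‖ = 0 := by
      rw [← sq_eq_zero_iff]; linarith [sq_nonneg ‖A v₁ + a • ι v₁ + b • ι v₂‖,
        sq_nonneg ‖-(b • ι v₁) + A v₂ + a • ι v₂‖]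
    rw [norm_eq_zero] at h7 h8
    rw [shiftBlock, block_apply]
    change WithLp.toLp 2 (A v₁ + a • ι v₁ - (-b) • ι v₂, (-b) • ι v₁ + (A v₂ + a • ι v₂)) = 0
    rw [neg_smul, neg_smul, sub_neg_eq_add, ← add_assoc, h7, h8]
    rfl
  have h0 : (WithLp.toLp 2 (v₁, v₂) : WithLp 2 (D × D)) = 0 := by
    have := hb' (WithLp.toLp 2 (v₁, v₂))
    rw [key, norm_zero] at this
    exact norm_le_zero_iff.1 (by
      by_contra hcon
      push Not at hcon
      exact absurd this (not_le.2 (mul_pos hk hcon)))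
  have e1 : v₁ = 0 := congrArg WithLp.fst h0
  have e2 : v₂ = 0 := congrArg WithLp.snd h0
  rw [e1, map_zero] at hv₁
  rw [e2, map_zero] at hv₂
  have : g = WithLp.toLp 2 (g.fst, g.snd) := rfl
  rw [this, ← hv₁, ← hv₂]
  rfl

end Sector

/-! ### Families of symmetric operators and their resolvents -/

section Jets

variable {N : ℕ} {law : Fin N → NoiseLaw} {μ : Measure (Fin N → ℝ)} {X Y : Type*}
  [NormedAddCommGroup X] [InnerProductSpace ℝ X] [CompleteSpace X]
  [NormedAddCommGroup Y] [InnerProductSpace ℝ Y] [CompleteSpace Y] {q : ℕ}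

theorem SobolevJet.clm_comp {F : List (Fin N) → (Fin N → ℝ) → X} {M : ℝ}
    (hF : SobolevJet law μ q F M) (L : X →L[ℝ] Y) (hL : ∀ x, ‖L x‖ ≤ ‖x‖) :
    SobolevJet law μ q (fun w z => L (F w z)) M where
  jet := hF.jet.clm_comp L
  bound w hw := by
    refine le_trans (eLpNorm_mono fun z => ?_) (hF.bound w hw)
    rw [norm_smul, norm_smul]
    gcongr
    exact hL _

theorem SobolevJet.pair (hμ : μ ≪ volume.restrict (box law))
    {F G : List (Fin N) → (Fin N → ℝ) → X} {M M' : ℝ} (hM : 0 ≤ M) (hM' : 0 ≤ M')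
    (hF : SobolevJet law μ q F M) (hG : SobolevJet law μ q G M') :
    SobolevJet law μ q (fun w z => pairInl (F w z) + pairInr (G w z)) (M + M') where
  jet :=
    { loc := fun w hw => ((hF.jet.clm_comp pairInl).loc w hw).add ((hG.jet.clm_comp pairInr).loc w hw)
      deriv := fun w j hw =>
        ((hF.jet.clm_comp pairInl).deriv w j hw).add ((hG.jet.clm_comp pairInr).deriv w j hw) }
  bound w hw := by
    have hF' := hF.clm_comp pairInl fun x => (norm_pairInl x).le
    have hG' := hG.clm_comp pairInr fun x => (norm_pairInr x).le
    simp only [smul_add]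
    rw [ENNReal.ofReal_add hM hM']
    refine (eLpNorm_add_le ?_ ?_ one_le_two).trans (add_le_add (hF'.bound w hw) (hG'.bound w hw))
    · exact aestronglyMeasurable_rhoPow_smul hμ
        (hF'.jet.loc w hw) _
    · exact aestronglyMeasurable_rhoPow_smul hμ
        (hG'.jet.loc w hw) _

end Jets

section Family

variable {N : ℕ} {D H : Type*} [NormedAddCommGroup D] [InnerProductSpace ℝ D]
  [NormedAddCommGroup H] [InnerProductSpace ℝ H]

/-- A family of positive symmetric operators `B [] z` with common domain `ι : D → H`, together with
its derivatives up to the order `ℓ`. -/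
structure IsSymmFamily (law : Fin N → NoiseLaw) (ℓ : ℕ) (ι : D →L[ℝ] H)
    (B : List (Fin N) → (Fin N → ℝ) → D →L[ℝ] H) (c C : ℝ) : Prop where
  inj : Function.Injective ι
  pos : 0 < c
  nonneg : 0 ≤ C
  jet : IsCoefJet (box law) ℓ B
  bound : ∀ w : List (Fin N), w.length ≤ ℓ →
    ∀ᵐ z ∂volume.restrict (box law), rhoPow law (letterCount w) z * ‖B w z‖ ≤ C
  lower : ∀ᵐ z ∂volume.restrict (box law), ∀ u, c * ‖u‖ ≤ ‖B [] z u‖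
  symm : ∀ᵐ z ∂volume.restrict (box law), ∀ u v,
    inner ℝ (B [] z u) (ι v) = inner ℝ (ι u) (B [] z v)
  inner_nonneg : ∀ᵐ z ∂volume.restrict (box law), ∀ u, 0 ≤ inner ℝ (B [] z u) (ι u)
  surj : ∀ᵐ z ∂volume.restrict (box law), Function.Surjective (B [] z)

/-- The jet of the complexification of `λ + B`, where `λ = a + i b`. -/
noncomputable def shiftJet (ι : D →L[ℝ] H) (B : List (Fin N) → (Fin N → ℝ) → D →L[ℝ] H) (a b : ℝ)
    (w : List (Fin N)) (z : Fin N → ℝ) : WithLp 2 (D × D) →L[ℝ] WithLp 2 (H × H) :=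
  block (B w z + constJet (a • ι) w z) (constJet (b • ι) w z)

variable {law : Fin N → NoiseLaw} {ℓ : ℕ} {ι : D →L[ℝ] H}
  {B : List (Fin N) → (Fin N → ℝ) → D →L[ℝ] H} {c C : ℝ}

theorem IsSymmFamily.isCoefJet_shiftJet (h : IsSymmFamily law ℓ ι B c C) (a b : ℝ) :
    IsCoefJet (box law) ℓ (shiftJet ι B a b) :=
  (h.jet.add (isCoefJet_constJet _ _)).block (isCoefJet_constJet _ _)

theorem IsSymmFamily.norm_le (h : IsSymmFamily law ℓ ι B c C) :
    ∀ᵐ z ∂volume.restrict (box law), ‖B [] z‖ ≤ C := by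
  filter_upwards [h.bound [] (Nat.zero_le _)] with z hz
  have h1 : rhoPow law (letterCount ([] : List (Fin N))) z = 1 := by
    rw [letterCount_nil]; simp [rhoPow]
  rwa [h1, one_mul] at hz

theorem IsSymmFamily.norm_shiftJet_le (h : IsSymmFamily law ℓ ι B c C) (a b : ℝ) :
    ∀ᵐ z ∂volume.restrict (box law),
      ‖shiftJet ι B a b [] z‖ ≤ 2 * (C + ‖a • ι‖ + ‖b • ι‖) + 1 := by
  filter_upwards [h.norm_le] with z hz
  have h1 := norm_block_le (B [] z + a • ι) (b • ι)
  have h2 := norm_add_le (B [] z) (a • ι)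
  change ‖block (B [] z + a • ι) (b • ι)‖ ≤ _
  linarith

/-- The spectral parameter is constant in `z` and disappears after one derivative, so the bound does
not depend on it. -/
theorem IsSymmFamily.bound_shiftJet (h : IsSymmFamily law ℓ ι B c C) (a b : ℝ)
    (w : List (Fin N)) (hw : w.length ≤ ℓ) (hw0 : w ≠ []) :
    ∀ᵐ z ∂volume.restrict (box law),
      rhoPow law (letterCount w) z * ‖shiftJet ι B a b w z‖ ≤ C := by
  filter_upwards [h.bound w hw, ae_restrict_mem (isOpen_box law).measurableSet] with z hz hzb
  refine le_trans (mul_le_mul_of_nonneg_left ?_ (rhoPow_pos _ hzb).le) hz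
  cases w with
  | nil => exact absurd rfl hw0
  | cons j w =>
    change ‖block (B (j :: w) z + 0) 0‖ ≤ _
    rw [add_zero]
    exact block_zero_right_norm_le _

variable {a b δ : ℝ}

theorem IsSymmFamily.shiftJet_bounds (h : IsSymmFamily law ℓ ι B c C) (hδ : 0 ≤ δ) (hδ1 : δ < 1)
    (ha : -(δ * √(a ^ 2 + b ^ 2)) ≤ a) :
    ∀ᵐ z ∂volume.restrict (box law), ∀ u,
      √(1 - δ) * c * ‖u‖ ≤ ‖shiftJet ι B a b [] z u‖ ∧
        √(1 - δ) * √(a ^ 2 + b ^ 2) * ‖block ι 0 u‖ ≤ ‖shiftJet ι B a b [] z u‖ := by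
  filter_upwards [h.lower, h.symm, h.inner_nonneg] with z h1 h2 h3 u
  exact shiftBlock_bounds h2 h3 h.pos h1 hδ hδ1 ha u

variable [CompleteSpace D] [CompleteSpace H]

theorem IsSymmFamily.surjective_shiftJet (h : IsSymmFamily law ℓ ι B c C) (hδ : 0 ≤ δ)
    (hδ1 : δ < 1) (ha : -(δ * √(a ^ 2 + b ^ 2)) ≤ a) :
    ∀ᵐ z ∂volume.restrict (box law), Function.Surjective (shiftJet ι B a b [] z) := by
  filter_upwards [h.lower, h.symm, h.inner_nonneg, h.surj] with z h1 h2 h3 h4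
  exact surjective_shiftBlock h2 h3 h.pos h1 h4 hδ hδ1 ha

variable [TopologicalSpace.SeparableSpace D] [TopologicalSpace.SeparableSpace H]

/-- One weighted estimate of (λ+A) ∂_w u, divided by the two lower bounds of the shifted operator:
once for the norm of `D`, once for the norm of `H` with the factor 1/|λ|. -/
theorem IsSymmFamily.sobolevJet_shift (h : IsSymmFamily law ℓ ι B c C) (hδ : 0 ≤ δ)
    (hδ1 : δ < 1) (ha : -(δ * √(a ^ 2 + b ^ 2)) ≤ a) (hab : 0 < √(a ^ 2 + b ^ 2))
    {μ : Measure (Fin N → ℝ)} (hμ : μ ≪ volume.restrict (box law)) {q : ℕ} (hq : q ≤ ℓ)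
    {Φ : List (Fin N) → (Fin N → ℝ) → WithLp 2 (H × H)} {M : ℝ} (hM : 0 ≤ M)
    (hΦ : SobolevJet law μ q Φ M) {u : (Fin N → ℝ) → WithLp 2 (D × D)}
    (hu : ∀ᵐ z ∂volume.restrict (box law), shiftJet ι B a b [] z (u z) = Φ [] z) :
    ∃ F, F [] = u ∧
      SobolevJet law μ q F
        ((√(1 - δ) * c)⁻¹ * (solutionConst (√(1 - δ) * c) C q * M)) ∧
      SobolevJet law μ q (fun w z => block ι 0 (F w z))
        ((√(1 - δ) * √(a ^ 2 + b ^ 2))⁻¹ * (solutionConst (√(1 - δ) * c) C q * M)) := by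
  have := separableSpace_pair (X := D)
  have := separableSpace_pair (X := H)
  have h0 : 0 < √(1 - δ) := Real.sqrt_pos.2 (by linarith)
  have hk : 0 < √(1 - δ) * c := mul_pos h0 h.pos
  have hk' : 0 < √(1 - δ) * √(a ^ 2 + b ^ 2) := mul_pos h0 hab
  have hbd := h.shiftJet_bounds hδ hδ1 ha
  have hlow := hbd.mono fun z hz u => (hz u).1
  have hjet := (h.isCoefJet_shiftJet a b).mono hq
  have hC := h.nonneg
  obtain ⟨F, hF, hF0⟩ := hjet.exists_isJet_of_eq (isOpen_box law) hk
    (show 0 < 2 * (C + ‖a • ι‖ + ‖b • ι‖) + 1 by positivity) hlow (h.norm_shiftJet_le a b)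
    hΦ.jet hu
  have hest : ∀ w : List (Fin N), w.length ≤ q →
      eLpNorm (fun z => rhoPow law (letterCount w) z • shiftJet ι B a b [] z (F w z)) 2 μ ≤
      ENNReal.ofReal (solutionConst (√(1 - δ) * c) C q * M) := fun w hw =>
    SobolevJet.eLpNorm_solution_le hμ hk h.nonneg hM hlow hjet
      (fun w hw hw0 => h.bound_shiftJet a b w (hw.trans hq) hw0) hF hΦ (by rwa [hF0]) hw
  refine ⟨F, hF0, ⟨hF, fun w hw => ?_⟩, ⟨hF.clm_comp _, fun w hw => ?_⟩⟩
  · rw [ENNReal.ofReal_mul (inv_nonneg.2 hk.le)]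
    refine (eLpNorm_le_mul_eLpNorm_of_ae_le_mul (hμ.ae_le ?_) 2).trans
      (mul_le_mul_right (hest w hw) _)
    filter_upwards [hbd] with z hz
    rw [norm_smul, norm_smul, mul_left_comm]
    refine mul_le_mul_of_nonneg_left ?_ (norm_nonneg _)
    rw [inv_mul_eq_div, le_div_iff₀ hk, mul_comm]
    exact (hz _).1
  · rw [ENNReal.ofReal_mul (inv_nonneg.2 hk'.le)]
    refine (eLpNorm_le_mul_eLpNorm_of_ae_le_mul (hμ.ae_le ?_) 2).trans
      (mul_le_mul_right (hest w hw) _)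
    filter_upwards [hbd] with z hz
    rw [norm_smul, norm_smul, mul_left_comm]
    refine mul_le_mul_of_nonneg_left ?_ (norm_nonneg _)
    rw [inv_mul_eq_div, le_div_iff₀ hk', mul_comm]
    exact (hz _).2

end Family

/-! ### The multiplication operator in L₂ and its resolvent -/

section SymbolGraph

variable {E D H : Type*} [MeasurableSpace E] [NormedAddCommGroup D] [InnerProductSpace ℝ D]
  [NormedAddCommGroup H] [InnerProductSpace ℝ H]

/-- The graph in `L₂(μ; H)` of the multiplication operator with the symbol `A z`, an operator with
domain `ι : D → H`. -/
def symbolGraph (μ : Measure E) (ι : D →L[ℝ] H) (A : E → D →L[ℝ] H) :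
    Submodule ℝ (Lp H 2 μ × Lp H 2 μ) where
  carrier := {p | ∀ᵐ z ∂μ, ∃ u, ι u = p.1 z ∧ A z u = p.2 z}
  zero_mem' := by
    filter_upwards [Lp.coeFn_zero H 2 μ] with z hz
    exact ⟨0, by rw [Prod.fst_zero, hz, map_zero]; rfl, by rw [Prod.snd_zero, hz, map_zero]; rfl⟩
  add_mem' := by
    rintro p p' h h'
    filter_upwards [h, h', Lp.coeFn_add p.1 p'.1, Lp.coeFn_add p.2 p'.2] with z h h' h1 h2
    obtain ⟨u, hu, hu'⟩ := h
    obtain ⟨v, hv, hv'⟩ := h'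
    exact ⟨u + v, by rw [Prod.fst_add, h1, map_add, hu, hv]; rfl,
      by rw [Prod.snd_add, h2, map_add, hu', hv']; rfl⟩
  smul_mem' := by
    rintro r p h
    filter_upwards [h, Lp.coeFn_smul r p.1, Lp.coeFn_smul r p.2] with z h h1 h2
    obtain ⟨u, hu, hu'⟩ := h
    exact ⟨r • u, by rw [Prod.smul_fst, h1, map_smul, hu]; rfl,
      by rw [Prod.smul_snd, h2, map_smul, hu']; rfl⟩

end SymbolGraph

section Family

variable {N : ℕ} {D H : Type*} [NormedAddCommGroup D] [InnerProductSpace ℝ D] [CompleteSpace D]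
  [NormedAddCommGroup H] [InnerProductSpace ℝ H] [CompleteSpace H]
  [TopologicalSpace.SeparableSpace D] [TopologicalSpace.SeparableSpace H]
  {law : Fin N → NoiseLaw} {ℓ : ℕ} {ι : D →L[ℝ] H}
  {B : List (Fin N) → (Fin N → ℝ) → D →L[ℝ] H} {c C : ℝ} {μ : Measure (Fin N → ℝ)}
  {p : (Fin N → ℝ) → ℝ}

/-- The preimages in `D` are chosen point by point. They are measurable because they solve `B u =
g`, and square integrable by the lower bound of `B`. -/
theorem IsSymmFamily.exists_lp (h : IsSymmFamily law ℓ ι B c C) (hd : HasDensity law μ p)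
    {f g : Lp H 2 μ} (hfg : (f, g) ∈ symbolGraph μ ι (B [])) :
    ∃ w : Lp D 2 μ, (∀ᵐ z ∂μ, ι (w z) = f z) ∧ ∀ᵐ z ∂μ, B [] z (w z) = g z := by
  classical
  have hμ := hd.absolutelyContinuous
  let u : (Fin N → ℝ) → D := fun z => if h : ∃ u, ι u = f z ∧ B [] z u = g z then h.choose else 0
  have hu : ∀ᵐ z ∂μ, ι (u z) = f z ∧ B [] z (u z) = g z := by
    filter_upwards [hfg] with z hz
    simp only [u, dif_pos hz]
    exact hz.choose_spec
  have hC := h.nonneg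
  have hm : AEStronglyMeasurable u (volume.restrict (box law)) :=
    (h.jet.coef [] (Nat.zero_le _)).aestronglyMeasurable_of_eq h.pos
      (show 0 < C + 1 by positivity) h.lower (h.norm_le.mono fun z hz => by linarith)
      ((Lp.aestronglyMeasurable g).mono_ac hd.absolutelyContinuous')
      (hd.absolutelyContinuous'.ae_le (hu.mono fun z hz => hz.2))
  have hL : MemLp u 2 μ := by
    refine MemLp.of_le_mul (c := c⁻¹) (Lp.memLp g) (hm.mono_ac hμ) ?_
    filter_upwards [hμ.ae_le h.lower, hu] with z h1 h2
    rw [inv_mul_eq_div, le_div_iff₀ h.pos, mul_comm, ← h2.2]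
    exact h1 _
  refine ⟨hL.toLp u, ?_, ?_⟩
  · filter_upwards [hL.coeFn_toLp, hu] with z h1 h2
    rw [h1, h2.1]
  · filter_upwards [hL.coeFn_toLp, hu] with z h1 h2
    rw [h1, h2.2]

theorem mem_symbolGraph_of_ae {A : (Fin N → ℝ) → D →L[ℝ] H} {f g : Lp H 2 μ} {w : (Fin N → ℝ) → D}
    (h1 : ∀ᵐ z ∂μ, ι (w z) = f z) (h2 : ∀ᵐ z ∂μ, A z (w z) = g z) :
    (f, g) ∈ symbolGraph μ ι A := by
  filter_upwards [h1, h2] with z h1 h2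
  exact ⟨w z, h1, h2⟩

theorem IsSymmFamily.exists_mem_symbolGraph (h : IsSymmFamily law ℓ ι B c C)
    (hd : HasDensity law μ p) (w : Lp D 2 μ) :
    ∃ g : Lp H 2 μ, (ι.compLpL 2 μ w, g) ∈ symbolGraph μ ι (B []) ∧
      (∀ᵐ z ∂μ, B [] z (w z) = g z) ∧ ‖g‖ ≤ C * ‖w‖ := by
  have hμ := hd.absolutelyContinuous
  have hm : AEStronglyMeasurable (fun z => B [] z (w z)) μ :=
    ((h.jet.coef [] (Nat.zero_le _)).aestronglyMeasurable
      ((Lp.aestronglyMeasurable w).mono_ac hd.absolutelyContinuous')).mono_ac hμ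
  have hn : ∀ᵐ z ∂μ, ‖B [] z (w z)‖ ≤ C * ‖w z‖ := by
    filter_upwards [hμ.ae_le h.norm_le] with z hz
    exact ContinuousLinearMap.le_of_opNorm_le _ hz _
  have hL := MemLp.of_le_mul (Lp.memLp w) hm hn
  refine ⟨hL.toLp _, mem_symbolGraph_of_ae (w := w) ?_ ?_, ?_, ?_⟩
  · filter_upwards [ι.coeFn_compLpL w] with z hz
    exact hz.symm
  · exact hL.coeFn_toLp.symm
  · exact hL.coeFn_toLp.symm
  · refine Lp.norm_le_mul_norm_of_ae_le_mul ?_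
    filter_upwards [hn, hL.coeFn_toLp] with z h1 h2
    rwa [h2]

variable {a b δ : ℝ}

theorem IsSymmFamily.exists_shift_lp (h : IsSymmFamily law ℓ ι B c C) (hd : HasDensity law μ p)
    {U F : Lp H 2 μ × Lp H 2 μ} (hU : IsShift (symbolGraph μ ι (B [])) a b U F) :
    ∃ w₁ w₂ : Lp D 2 μ, (∀ᵐ z ∂μ, ι (w₁ z) = U.1 z) ∧ (∀ᵐ z ∂μ, ι (w₂ z) = U.2 z) ∧
      ∀ᵐ z ∂μ, shiftJet ι B a b [] z (WithLp.toLp 2 (w₁ z, w₂ z)) =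
        WithLp.toLp 2 (F.1 z, F.2 z) := by
  obtain ⟨w₁, h1, h1'⟩ := h.exists_lp hd hU.1
  obtain ⟨w₂, h2, h2'⟩ := h.exists_lp hd hU.2
  refine ⟨w₁, w₂, h1, h2, ?_⟩
  filter_upwards [h1, h1', h2, h2', Lp.coeFn_add (F.1 - a • U.1) (b • U.2),
    Lp.coeFn_sub F.1 (a • U.1), Lp.coeFn_sub (F.2 - b • U.1) (a • U.2), Lp.coeFn_sub F.2 (b • U.1),
    Lp.coeFn_smul a U.1, Lp.coeFn_smul b U.2, Lp.coeFn_smul b U.1, Lp.coeFn_smul a U.2]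
    with z e1 e2 e3 e4 e5 e6 e7 e8 e9 e10 e11 e12
  rw [e5, Pi.add_apply, e6, Pi.sub_apply, e9, e10] at e2
  rw [e7, Pi.sub_apply, e8, Pi.sub_apply, e11, e12] at e4
  change shiftBlock ι (B [] z) a b _ = _
  rw [shiftBlock, block_apply]
  change WithLp.toLp 2 (B [] z (w₁ z) + a • ι (w₁ z) - b • ι (w₂ z),
    b • ι (w₁ z) + (B [] z (w₂ z) + a • ι (w₂ z))) = _
  simp only [Pi.smul_apply] at e2 e4
  rw [e1, e2, e3, e4]
  congr 2 <;> abel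

theorem norm_le_inv_mul_of_ae_le {E X Y : Type*} [MeasurableSpace E] {μ : Measure E}
    [NormedAddCommGroup X] [NormedAddCommGroup Y] {w : Lp X 2 μ} {f : Lp Y 2 μ} {k : ℝ}
    (hk : 0 < k) (hw : ∀ᵐ z ∂μ, k * ‖w z‖ ≤ ‖f z‖) : ‖w‖ ≤ k⁻¹ * ‖f‖ := by
  refine Lp.norm_le_mul_norm_of_ae_le_mul ?_
  filter_upwards [hw] with z hz
  rw [inv_mul_eq_div, le_div_iff₀ hk, mul_comm]
  exact hz

theorem exists_lp_pair (f g : Lp H 2 μ) : ∃ F : Lp (WithLp 2 (H × H)) 2 μ,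
    (∀ᵐ z ∂μ, F z = WithLp.toLp 2 (f z, g z)) ∧ ‖F‖ ≤ ‖f‖ + ‖g‖ := by
  refine ⟨pairInl.compLp f + pairInr.compLp g, ?_, (norm_add_le _ _).trans (add_le_add ?_ ?_)⟩
  · filter_upwards [Lp.coeFn_add (pairInl.compLp f) (pairInr.compLp g),
      pairInl.coeFn_compLp f, pairInr.coeFn_compLp g] with z e1 e2 e3
    rw [e1, Pi.add_apply, e2, e3, pairInl_add_pairInr]
  · refine Lp.norm_le_norm_of_ae_le ?_
    filter_upwards [pairInl.coeFn_compLp f] with z e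
    rw [e, norm_pairInl]
  · refine Lp.norm_le_norm_of_ae_le ?_
    filter_upwards [pairInr.coeFn_compLp g] with z e
    rw [e, norm_pairInr]

/-- Solve for almost every `z` separately. Measurability of the chosen solutions comes from the
Richardson iteration, square integrability from the lower bound, and both together give an element
of L₂(μ; D). -/
theorem IsSymmFamily.exists_shift (h : IsSymmFamily law ℓ ι B c C) (hd : HasDensity law μ p)
    (hδ : 0 ≤ δ) (hδ1 : δ < 1) (ha : -(δ * √(a ^ 2 + b ^ 2)) ≤ a)
    (F : Lp H 2 μ × Lp H 2 μ) : ∃ U, IsShift (symbolGraph μ ι (B [])) a b U F := by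
  have := separableSpace_pair (X := D)
  have := separableSpace_pair (X := H)
  have hμ := hd.absolutelyContinuous
  have hC := h.nonneg
  have hk : 0 < √(1 - δ) * c := mul_pos (Real.sqrt_pos.2 (by linarith)) h.pos
  have hbd := h.shiftJet_bounds hδ hδ1 ha
  have hsurj := h.surjective_shiftJet hδ hδ1 ha
  obtain ⟨f, hfF, -⟩ := exists_lp_pair F.1 F.2
  obtain ⟨u, hu⟩ : ∃ u : (Fin N → ℝ) → WithLp 2 (D × D),
      ∀ᵐ z ∂volume.restrict (box law), shiftJet ι B a b [] z (u z) = f z := by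
    choose! u hu using fun z (hz : Function.Surjective (shiftJet ι B a b [] z)) => hz (f z)
    exact ⟨u, hsurj.mono hu⟩
  have hm : AEStronglyMeasurable u (volume.restrict (box law)) :=
    ((h.isCoefJet_shiftJet a b).coef [] (Nat.zero_le _)).aestronglyMeasurable_of_eq hk
      (show 0 < 2 * (C + ‖a • ι‖ + ‖b • ι‖) + 1 by positivity) (hbd.mono fun z hz u => (hz u).1)
      (h.norm_shiftJet_le a b) ((Lp.aestronglyMeasurable f).mono_ac hd.absolutelyContinuous') hu
  have hL : MemLp u 2 μ := by
    refine MemLp.of_le_mul (c := (√(1 - δ) * c)⁻¹) (Lp.memLp f) (hm.mono_ac hμ) ?_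
    filter_upwards [hμ.ae_le hbd, hμ.ae_le hu] with z h1 h2
    rw [inv_mul_eq_div, le_div_iff₀ hk, mul_comm, ← h2]
    exact (h1 _).1
  have h1 : MemLp (fun z => (u z).fst) 2 μ := (WithLp.fstL 2 ℝ D D).comp_memLp' hL
  have h2 : MemLp (fun z => (u z).snd) 2 μ := (WithLp.sndL 2 ℝ D D).comp_memLp' hL
  have h1' : MemLp (fun z => ι (u z).fst) 2 μ := ι.comp_memLp' h1
  have h2' : MemLp (fun z => ι (u z).snd) 2 μ := ι.comp_memLp' h2
  obtain ⟨U₁, hc1⟩ : ∃ U₁ : Lp H 2 μ, ∀ᵐ z ∂μ, U₁ z = ι (u z).fst := ⟨h1'.toLp _, h1'.coeFn_toLp⟩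
  obtain ⟨U₂, hc2⟩ : ∃ U₂ : Lp H 2 μ, ∀ᵐ z ∂μ, U₂ z = ι (u z).snd := ⟨h2'.toLp _, h2'.coeFn_toLp⟩
  have heq : ∀ᵐ z ∂μ, B [] z (u z).fst + a • ι (u z).fst - b • ι (u z).snd = F.1 z ∧
      b • ι (u z).fst + (B [] z (u z).snd + a • ι (u z).snd) = F.2 z := by
    filter_upwards [hμ.ae_le hu, hfF] with z hz hzF
    have hz' : shiftBlock ι (B [] z) a b (u z) = f z := hz
    rw [shiftBlock, block_apply, hzF] at hz'
    exact ⟨congrArg WithLp.fst hz', congrArg WithLp.snd hz'⟩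
  refine ⟨(U₁, U₂), mem_symbolGraph_of_ae (w := fun z => (u z).fst) (hc1.mono fun _ hz => hz.symm) ?_,
    mem_symbolGraph_of_ae (w := fun z => (u z).snd) (hc2.mono fun _ hz => hz.symm) ?_⟩
  · filter_upwards [heq, hc1, hc2, Lp.coeFn_add (F.1 - a • U₁) (b • U₂),
      Lp.coeFn_sub F.1 (a • U₁), Lp.coeFn_smul a U₁, Lp.coeFn_smul b U₂] with z e1 e2 e3 e4 e5 e6 e7
    rw [e4, Pi.add_apply, e5, Pi.sub_apply, e6, e7, Pi.smul_apply, Pi.smul_apply, e2, e3, ← e1.1]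
    abel
  · filter_upwards [heq, hc1, hc2, Lp.coeFn_sub (F.2 - b • U₁) (a • U₂),
      Lp.coeFn_sub F.2 (b • U₁), Lp.coeFn_smul b U₁, Lp.coeFn_smul a U₂] with z e1 e2 e3 e4 e5 e6 e7
    rw [e4, Pi.sub_apply, e5, Pi.sub_apply, e6, e7, Pi.smul_apply, Pi.smul_apply, e2, e3, ← e1.2]
    abel

/-- The resolvent estimates in `L₂`. -/
theorem IsSymmFamily.norm_shift_le (h : IsSymmFamily law ℓ ι B c C) (hd : HasDensity law μ p)
    (hδ : 0 ≤ δ) (hδ1 : δ < 1) (ha : -(δ * √(a ^ 2 + b ^ 2)) ≤ a) (hab : 0 < √(a ^ 2 + b ^ 2))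
    {U F : Lp H 2 μ × Lp H 2 μ} (hU : IsShift (symbolGraph μ ι (B [])) a b U F) :
    (∃ w₁ w₂ : Lp D 2 μ, (∀ᵐ z ∂μ, ι (w₁ z) = U.1 z) ∧ (∀ᵐ z ∂μ, ι (w₂ z) = U.2 z) ∧
      ‖w₁‖ ≤ (√(1 - δ) * c)⁻¹ * (‖F.1‖ + ‖F.2‖) ∧ ‖w₂‖ ≤ (√(1 - δ) * c)⁻¹ * (‖F.1‖ + ‖F.2‖)) ∧
      ‖U.1‖ ≤ (√(1 - δ) * √(a ^ 2 + b ^ 2))⁻¹ * (‖F.1‖ + ‖F.2‖) ∧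
      ‖U.2‖ ≤ (√(1 - δ) * √(a ^ 2 + b ^ 2))⁻¹ * (‖F.1‖ + ‖F.2‖) := by
  have hμ := hd.absolutelyContinuous
  have h0 : 0 < √(1 - δ) := Real.sqrt_pos.2 (by linarith)
  have hk : 0 < √(1 - δ) * c := mul_pos h0 h.pos
  have hk' : 0 < √(1 - δ) * √(a ^ 2 + b ^ 2) := mul_pos h0 hab
  obtain ⟨w₁, w₂, h1, h2, h3⟩ := h.exists_shift_lp hd hU
  obtain ⟨f, hf, hnf⟩ := exists_lp_pair F.1 F.2
  have hbd : ∀ᵐ z ∂μ, √(1 - δ) * c * ‖(WithLp.toLp 2 (w₁ z, w₂ z) : WithLp 2 (D × D))‖ ≤ ‖f z‖ ∧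
      √(1 - δ) * √(a ^ 2 + b ^ 2) * ‖block ι 0 (WithLp.toLp 2 (w₁ z, w₂ z))‖ ≤ ‖f z‖ := by
    filter_upwards [hμ.ae_le (h.shiftJet_bounds hδ hδ1 ha), h3, hf] with z e1 e2 e3
    rw [e3, ← e2]
    exact e1 _
  have hbl : ∀ z, block ι 0 (WithLp.toLp 2 (w₁ z, w₂ z)) = WithLp.toLp 2 (ι (w₁ z), ι (w₂ z)) := by
    intro z
    rw [block_apply]
    simp
  refine ⟨⟨w₁, w₂, h1, h2,
    (norm_le_inv_mul_of_ae_le hk ?_).trans (mul_le_mul_of_nonneg_left hnf (inv_nonneg.2 hk.le)), (norm_le_inv_mul_of_ae_le hk ?_).trans (mul_le_mul_of_nonneg_left hnf (inv_nonneg.2 hk.le))⟩, (norm_le_inv_mul_of_ae_le hk' ?_).trans (mul_le_mul_of_nonneg_left hnf (inv_nonneg.2 hk'.le)), (norm_le_inv_mul_of_ae_le hk' ?_).trans (mul_le_mul_of_nonneg_left hnf (inv_nonneg.2 hk'.le))⟩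
  · filter_upwards [hbd] with z hz
    exact (mul_le_mul_of_nonneg_left (norm_fst_le_pair (WithLp.toLp 2 (w₁ z, w₂ z))) hk.le).trans hz.1
  · filter_upwards [hbd] with z hz
    exact (mul_le_mul_of_nonneg_left (norm_snd_le_pair (WithLp.toLp 2 (w₁ z, w₂ z))) hk.le).trans hz.1
  · filter_upwards [hbd, h1] with z hz hz'
    rw [hbl] at hz
    rw [← hz']
    exact (mul_le_mul_of_nonneg_left
      (norm_fst_le_pair (WithLp.toLp 2 (ι (w₁ z), ι (w₂ z)))) hk'.le).trans hz.2
  · filter_upwards [hbd, h2] with z hz hz'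
    rw [hbl] at hz
    rw [← hz']
    exact (mul_le_mul_of_nonneg_left
      (norm_snd_le_pair (WithLp.toLp 2 (ι (w₁ z), ι (w₂ z)))) hk'.le).trans hz.2

theorem IsSymmFamily.shift_unique (h : IsSymmFamily law ℓ ι B c C) (hd : HasDensity law μ p)
    (hδ : 0 ≤ δ) (hδ1 : δ < 1) (ha : -(δ * √(a ^ 2 + b ^ 2)) ≤ a) (hab : 0 < √(a ^ 2 + b ^ 2))
    {U U' F : Lp H 2 μ × Lp H 2 μ} (hU : IsShift (symbolGraph μ ι (B [])) a b U F)
    (hU' : IsShift (symbolGraph μ ι (B [])) a b U' F) : U = U' := by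
  have hs : IsShift (symbolGraph μ ι (B [])) a b (U - U') 0 := by
    constructor
    · convert Submodule.sub_mem _ hU.1 hU'.1 using 1
      ext1
      · rfl
      · change (0 : Lp H 2 μ) - a • (U.1 - U'.1) + b • (U.2 - U'.2) =
          (F.1 - a • U.1 + b • U.2) - (F.1 - a • U'.1 + b • U'.2)
        module
    · convert Submodule.sub_mem _ hU.2 hU'.2 using 1
      ext1
      · rfl
      · change (0 : Lp H 2 μ) - b • (U.1 - U'.1) - a • (U.2 - U'.2) =
          (F.2 - b • U.1 - a • U.2) - (F.2 - b • U'.1 - a • U'.2)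
        module
  have hn := (h.norm_shift_le hd hδ hδ1 ha hab hs).2
  simp only [Prod.fst_zero, Prod.snd_zero, norm_zero, add_zero, mul_zero, norm_le_zero_iff] at hn
  exact sub_eq_zero.1 (Prod.ext hn.1 hn.2)

/-- The multiplication operator is maximal monotone. -/
theorem IsSymmFamily.isMaxMonotone (h : IsSymmFamily law ℓ ι B c C) (hd : HasDensity law μ p) :
    IsMaxMonotone (symbolGraph μ ι (B [])) := by
  have hμ := hd.absolutelyContinuous
  have hnonneg : ∀ x y, (x, y) ∈ symbolGraph μ ι (B []) → 0 ≤ inner ℝ y x := by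
    intro x y hxy
    rw [L2.inner_def]
    refine integral_nonneg_of_ae ?_
    filter_upwards [hxy, hμ.ae_le h.inner_nonneg] with z hz hz'
    obtain ⟨u, hu, hu'⟩ := hz
    have hz'' := hz' u
    rw [hu, hu'] at hz''
    exact hz''
  have hfun : ∀ y, (0, y) ∈ symbolGraph μ ι (B []) → y = 0 := by
    intro y hy
    refine Lp.eq_zero_iff_ae_eq_zero.2 ?_
    filter_upwards [hy, Lp.coeFn_zero H 2 μ] with z hz hz0
    obtain ⟨u, hu, hu'⟩ := hz
    change ι u = _ at hu
    change B [] z u = _ at hu'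
    rw [hz0, Pi.zero_apply] at hu
    have : u = 0 := h.inj (by rw [hu, map_zero])
    rw [← hu', this, map_zero, Pi.zero_apply]
  have hsurj : ∀ l : ℝ, 0 < l → ∀ f, ∃ x y, (x, y) ∈ symbolGraph μ ι (B []) ∧ l • x + y = f := by
    intro l hl f
    obtain ⟨U, hU⟩ := h.exists_shift hd le_rfl one_pos (a := l) (b := 0) (by simpa using hl.le) (f, 0)
    refine ⟨U.1, f - l • U.1 + (0 : ℝ) • U.2, hU.1, ?_⟩
    module
  refine ⟨hnonneg, hsurj, ?_⟩
  let S : Submodule ℝ (Lp H 2 μ) := (symbolGraph μ ι (B [])).map (LinearMap.fst ℝ _ _)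
  have hS : (S : Set (Lp H 2 μ)) = {x | ∃ y, (x, y) ∈ symbolGraph μ ι (B [])} := by
    ext x
    constructor
    · rintro ⟨p, hp, rfl⟩
      exact ⟨p.2, hp⟩
    · rintro ⟨y, hy⟩
      exact ⟨(x, y), hy, rfl⟩
  rw [← hS]
  rw [Submodule.dense_iff_topologicalClosure_eq_top, Submodule.topologicalClosure_eq_top_iff,
    Submodule.eq_bot_iff]
  -- Let `g` be orthogonal to the domain and write g = x + y with (x, y) in the graph. Then 0 = (g |
  -- x) ≥ ‖x‖², so x = 0, hence y = 0 and g = 0.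
  intro g hg
  obtain ⟨x, y, hxy, hg'⟩ := hsurj 1 one_pos g
  have h1 : inner ℝ g x = 0 :=
    (real_inner_comm _ _).trans (hg x ⟨(x, y), hxy, rfl⟩)
  rw [one_smul] at hg'
  rw [← hg', inner_add_left, real_inner_self_eq_norm_sq] at h1
  have hx : x = 0 := by
    have := hnonneg x y hxy
    exact norm_eq_zero.1 (pow_eq_zero_iff two_ne_zero |>.1 (by nlinarith [sq_nonneg ‖x‖]))
  subst hx
  rw [← hg', hfun y hxy, add_zero]

end Family

/-! ### Bounds for semigroups from bounds for resolvents -/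

section Size

variable {𝓗 : Type*} [NormedAddCommGroup 𝓗] [InnerProductSpace ℝ 𝓗] [CompleteSpace 𝓗]
  {Γ : Submodule ℝ (𝓗 × 𝓗)} {T : ℝ≥0 → 𝓗 →L[ℝ] 𝓗}

/-- `S f M` expresses that a size of `f` is at most `M`; the resolvents `(λ + A)⁻¹` of the operator
with the graph `Γ` increase it at most by the factor `k / |λ|` if `λ` has a positive real part. -/
structure ResolventBound (Γ : Submodule ℝ (𝓗 × 𝓗)) (S : 𝓗 → ℝ → Prop) (k : ℝ) : Prop where
  nonneg : 0 ≤ k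
  zero : ∀ M, 0 ≤ M → S 0 M
  smul : ∀ r f M, 0 ≤ r → S f M → S (r • f) (r * M)
  shift : ∀ a b U F M, 0 < a → 0 ≤ M → IsShift Γ a b U F → S F.1 M → S F.2 M →
    S U.1 (k * (√(a ^ 2 + b ^ 2))⁻¹ * M) ∧ S U.2 (k * (√(a ^ 2 + b ^ 2))⁻¹ * M)

theorem IsMaxMonotone.isClosed (h : IsMaxMonotone Γ) {x y : ℕ → 𝓗} {x₀ y₀ : 𝓗}
    (hxy : ∀ n, (x n, y n) ∈ Γ) (hx : Tendsto x atTop (𝓝 x₀)) (hy : Tendsto y atTop (𝓝 y₀)) :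
    (x₀, y₀) ∈ Γ := by
  obtain ⟨J, hJ, -, hJl⟩ := h.exists_resolvent one_pos
  have h1 : J ((1 : ℝ) • x₀ + y₀) = x₀ := by
    refine tendsto_nhds_unique ?_ hx
    have := (J.continuous.tendsto _).comp ((hx.const_smul (1 : ℝ)).add hy)
    refine this.congr fun n => ?_
    exact hJl _ _ (hxy n)
  have h2 := hJ ((1 : ℝ) • x₀ + y₀)
  rwa [h1, one_smul, add_sub_cancel_left] at h2

theorem cpair_norm_le {w : 𝓗} {U : 𝓗 × 𝓗} {R : ℝ} (h1 : |inner ℝ w U.1| ≤ R)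
    (h2 : |inner ℝ w U.2| ≤ R) : ‖cpair w U‖ ≤ 2 * R := by
  refine (norm_add_le _ _).trans ?_
  rw [norm_mul, Complex.norm_I, mul_one, Complex.norm_real, Complex.norm_real, Real.norm_eq_abs,
    Real.norm_eq_abs]
  linarith

theorem ResolventBound.exists_chain {S : 𝓗 → ℝ → Prop} {k : ℝ} (hS : ResolventBound Γ S k)
    (hex : ∀ a b : ℝ, 0 < a → ∀ F, ∃ U, IsShift Γ a b U F) {a : ℝ} (ha : 0 < a) (b : ℝ)
    {x : 𝓗} {M : ℝ} (hM : 0 ≤ M) (hx : S x M) :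
    ∃ U : ℕ → 𝓗 × 𝓗, U 0 = (x, 0) ∧ (∀ n, IsShift Γ a b (U (n + 1)) (U n)) ∧
      ∀ n, S (U n).1 ((k * (√(a ^ 2 + b ^ 2))⁻¹) ^ n * M) ∧
        S (U n).2 ((k * (√(a ^ 2 + b ^ 2))⁻¹) ^ n * M) := by
  choose R hR using hex a b ha
  have hk := hS.nonneg
  refine ⟨fun n => R^[n] (x, 0), rfl, fun n => ?_, fun n => ?_⟩
  · simp only [Function.iterate_succ_apply']
    exact hR _
  · induction n with
    | zero => simpa using ⟨hx, hS.zero M hM⟩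
    | succ n ih =>
      simp only [Function.iterate_succ_apply']
      rw [pow_succ', mul_assoc]
      exact hS.shift a b _ _ _ ha (by positivity) (hR _) ih.1 ih.2

variable {S : 𝓗 → ℝ → Prop} {k : ℝ}

/-- The case n = 1 of Fourier inversion: two resolvents decay like k²/|λ|², which is integrable
along a vertical line. Only resolvents with Re λ > 0 are used. -/
theorem ResolventBound.abs_inner_le (hS : ResolventBound Γ S k) (h : IsMaxMonotone Γ)
    (hT : GeneratesNeg Γ T) (hex : ∀ a b : ℝ, 0 < a → ∀ F, ∃ U, IsShift Γ a b U F)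
    {w : 𝓗} {L : ℝ} (hw : ∀ f M, 0 ≤ M → S f M → |inner ℝ w f| ≤ M * L)
    {x : 𝓗} {M : ℝ} (hM : 0 ≤ M) (hx : S x M) {τ : ℝ≥0} (hτ : 0 < τ) :
    |inner ℝ w (T τ x)| ≤ Real.exp 1 * k ^ 2 * M * L := by
  have hτ0 : (0 : ℝ) < τ := hτ
  have ha : (0 : ℝ) < (τ : ℝ)⁻¹ := inv_pos.2 hτ0
  have hk := hS.nonneg
  have := hT.pow_mul_abs_inner_le h w x hτ one_ne_zero (M := 2 * k ^ 2 * M * L) fun b => by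
    obtain ⟨U, hU0, hU, hUM⟩ := hS.exists_chain hex ha b hM hx
    refine ⟨U, hU0, fun n _ => hU n, ?_⟩
    have h2 := hUM 2
    refine (cpair_norm_le (hw _ _ (by positivity) h2.1) (hw _ _ (by positivity) h2.2)).trans
      (le_of_eq ?_)
    rw [mul_pow, inv_pow, Real.sq_sqrt (by positivity)]
    ring
  simp only [pow_one, Nat.factorial_one, Nat.cast_one, mul_one] at this
  have h3 : (τ : ℝ) * |inner ℝ w (T τ x)| ≤ τ * (Real.exp 1 * k ^ 2 * M * L) := by linarith
  exact le_of_mul_le_mul_left h3 hτ0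

/-- The case n = 2 applied to y = A x. Three resolvents compensate for one `A`, because A(λ+A)⁻³x =
(λ+A)⁻²x - λ(λ+A)⁻³x is again O(|λ|⁻²) in terms of the size of `x` alone. -/
theorem ResolventBound.mul_abs_inner_le (hS : ResolventBound Γ S k) (h : IsMaxMonotone Γ)
    (hT : GeneratesNeg Γ T) (hex : ∀ a b : ℝ, 0 < a → ∀ F, ∃ U, IsShift Γ a b U F)
    {w : 𝓗} {L : ℝ} (hw : ∀ f M, 0 ≤ M → S f M → |inner ℝ w f| ≤ M * L)
    {x y : 𝓗} (hxy : (x, y) ∈ Γ) {M : ℝ} (hM : 0 ≤ M) (hx : S x M) {τ : ℝ≥0} (hτ : 0 < τ) :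
    τ * |inner ℝ w (T τ y)| ≤ 2 * Real.exp 1 * (k ^ 2 + k ^ 3) * M * L := by
  have hτ0 : (0 : ℝ) < τ := hτ
  have ha : (0 : ℝ) < (τ : ℝ)⁻¹ := inv_pos.2 hτ0
  have hk := hS.nonneg
  have := hT.pow_mul_abs_inner_le h w y hτ two_ne_zero (M := 2 * (k ^ 2 + k ^ 3) * M * L)
    fun b => by
    set a : ℝ := (τ : ℝ)⁻¹
    obtain ⟨U, hU0, hU, hUM⟩ := hS.exists_chain hex ha b hM hx
    -- `V n` is A applied to `U n`, written without `A` as U (n - 1) - λ U n for n ≥ 1. It is the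
    -- chain of resolvents that starts at y.
    let V : ℕ → 𝓗 × 𝓗 := fun n => n.casesOn (y, 0) fun n =>
      ((U n).1 - a • (U (n + 1)).1 + b • (U (n + 1)).2,
        (U n).2 - b • (U (n + 1)).1 - a • (U (n + 1)).2)
    have hV : ∀ n, ((U n).1, (V n).1) ∈ Γ ∧ ((U n).2, (V n).2) ∈ Γ := by
      intro n
      cases n with
      | zero => rw [hU0]; exact ⟨hxy, Γ.zero_mem⟩
      | succ n => exact hU n
    refine ⟨V, rfl, fun n _ => ⟨?_, ?_⟩, ?_⟩
    · exact Γ.add_mem (Γ.sub_mem (hV n).1 (Γ.smul_mem a (hV (n + 1)).1))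
        (Γ.smul_mem b (hV (n + 1)).2)
    · exact Γ.sub_mem (Γ.sub_mem (hV n).2 (Γ.smul_mem b (hV (n + 1)).1))
        (Γ.smul_mem a (hV (n + 1)).2)
    · have h2 := hUM 2
      have h3 := hUM 3
      have e2 := cpair_norm_le (hw _ _ (by positivity) h2.1) (hw _ _ (by positivity) h2.2)
      have e3 := cpair_norm_le (hw _ _ (by positivity) h3.1) (hw _ _ (by positivity) h3.2)
      have e4 : cpair w (V 3) = cpair w (U 2) - (a + b * Complex.I) * cpair w (U 3) := by
        change cpair w ((U 2).1 - a • (U 3).1 + b • (U 3).2, (U 2).2 - b • (U 3).1 - a • (U 3).2) = _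
        simp only [cpair, inner_sub_right, inner_add_right, real_inner_smul_right,
          Complex.ofReal_sub, Complex.ofReal_add, Complex.ofReal_mul]
        linear_combination ((b : ℂ) * (inner ℝ w (U 3).2 : ℝ)) * Complex.I_sq
      have e5 : ‖(a + b * Complex.I : ℂ)‖ = √(a ^ 2 + b ^ 2) := Complex.norm_add_mul_I a b
      have hpos : 0 < √(a ^ 2 + b ^ 2) := Real.sqrt_pos.2 (by positivity)
      change ‖cpair w (V 3)‖ ≤ _
      rw [e4]
      refine (norm_sub_le _ _).trans ?_
      rw [norm_mul, e5]
      refine (add_le_add e2 (mul_le_mul_of_nonneg_left e3 hpos.le)).trans (le_of_eq ?_)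
      have e6 : (√(a ^ 2 + b ^ 2))⁻¹ ^ 2 = (a ^ 2 + b ^ 2)⁻¹ := by
        rw [inv_pow, Real.sq_sqrt (by positivity)]
      rw [← e6]
      field_simp
  simp only [Nat.factorial_two, Nat.cast_ofNat] at this
  have h3 : (τ : ℝ) * (τ * |inner ℝ w (T τ y)|) ≤
      τ * (2 * Real.exp 1 * (k ^ 2 + k ^ 3) * M * L) := by
    refine le_trans (le_of_eq (by ring)) (this.trans (le_of_eq (by ring)))
  exact le_of_mul_le_mul_left h3 hτ0

/-- The semigroup maps into the domain of the generator, with the bounds of an analytic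
semigroup. -/
theorem GeneratesNeg.exists_smoothing (hT : GeneratesNeg Γ T) (h : IsMaxMonotone Γ)
    (hex : ∀ a b : ℝ, 0 < a → ∀ F, ∃ U, IsShift Γ a b U F) {k₀ : ℝ}
    (h0 : ResolventBound Γ (fun f M => ‖f‖ ≤ M) k₀) {τ : ℝ≥0} (hτ : 0 < τ) (f : 𝓗) :
    ∃ g, (T τ f, g) ∈ Γ ∧ ∀ (S : 𝓗 → ℝ → Prop) (k : ℝ), ResolventBound Γ S k →
      ∀ M, 0 ≤ M → S f M → ∀ w L, (∀ f M, 0 ≤ M → S f M → |inner ℝ w f| ≤ M * L) →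
        τ * |inner ℝ w g| ≤ 2 * Real.exp 1 * (k ^ 2 + k ^ 3) * (k * M) * L := by
  have hτ0 : (0 : ℝ) < τ := hτ
  have hn : ∀ n : ℕ, (0 : ℝ) < n + 1 := fun n => by positivity
  choose J hJ hJn hJl using fun n : ℕ => h.exists_resolvent (hn n)
  -- Approximate `f` by λ J f, which lies in the domain. The estimate for y = A x involves only the
  -- size of `x`, so T(τ)y converges although y itself need not.
  let x : ℕ → 𝓗 := fun n => ((n : ℝ) + 1) • J n f
  let y : ℕ → 𝓗 := fun n => ((n : ℝ) + 1) • (f - ((n : ℝ) + 1) • J n f)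
  have hx : Tendsto x atTop (𝓝 f) := h.tendsto_resolvent hJn hJl f
  have hxy : ∀ n, (x n, y n) ∈ Γ := fun n => Γ.smul_mem _ (hJ n f)
  set K := 2 * Real.exp 1 * (k₀ ^ 2 + k₀ ^ 3) with hK
  have hk₀ := h0.nonneg
  have hK0 : 0 ≤ K := by positivity
  have hnorm : ∀ x y, (x, y) ∈ Γ → τ * ‖T τ y‖ ≤ K * ‖x‖ := by
    intro x y hxy
    -- Testing T(τ)y with itself recovers its norm.
    have h1 := h0.mul_abs_inner_le h hT hex (w := T τ y) (L := ‖T τ y‖)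
      (fun f M _ hf => (abs_real_inner_le_norm _ _).trans (by
        rw [mul_comm]
        gcongr)) hxy (norm_nonneg x) le_rfl hτ
    rw [real_inner_self_eq_norm_sq, abs_of_nonneg (sq_nonneg _)] at h1
    rcases (norm_nonneg (T τ y)).eq_or_lt with h2 | h2
    · rw [← h2, mul_zero]; positivity
    · refine le_of_mul_le_mul_right ?_ h2
      linarith
  have hc : CauchySeq fun n => T τ (y n) := by
    rw [Metric.cauchySeq_iff']
    intro ε hε
    obtain ⟨n₀, hn₀⟩ := Metric.cauchySeq_iff'.1 hx.cauchySeq (τ * ε / (K + 1)) (by positivity)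
    refine ⟨n₀, fun n hnn => ?_⟩
    have h1 := hnorm (x n - x n₀) (y n - y n₀) (Γ.sub_mem (hxy n) (hxy n₀))
    have h2 := hn₀ n hnn
    rw [dist_eq_norm, lt_div_iff₀ (by positivity)] at h2
    rw [dist_eq_norm, ← map_sub]
    refine lt_of_mul_lt_mul_left ?_ hτ0.le
    nlinarith [norm_nonneg (x n - x n₀)]
  obtain ⟨g, hg⟩ := cauchySeq_tendsto_of_complete hc
  refine ⟨g, h.isClosed (fun n => hT.map_mem (hxy n) τ)
    (((T τ).continuous.tendsto _).comp hx) hg, fun S k hS M hM hf w L hw => ?_⟩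
  have hSx : ∀ n, S (x n) (k * M) := by
    intro n
    -- The resolvent at the real point n + 1 increases the size by at most k/(n + 1), and
    -- multiplication by n + 1 restores it: all `x n` have size at most k M.
    have h1 := hS.shift ((n : ℝ) + 1) 0 (J n f, 0) (f, 0) M (hn n) hM (by
      refine ⟨?_, ?_⟩
      · simpa using hJ n f
      · simp only [sub_zero, smul_zero, zero_smul]
        exact Γ.zero_mem) hf (hS.zero M hM)
    have h2 := hS.smul ((n : ℝ) + 1) _ _ (hn n).le h1.1
    have h3 : ((n : ℝ) + 1) * (k * (√(((n : ℝ) + 1) ^ 2 + 0 ^ 2))⁻¹ * M) = k * M := by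
      rw [zero_pow two_ne_zero, add_zero, Real.sqrt_sq (hn n).le]
      have := (hn n).ne'
      field_simp
    rwa [h3] at h2
  have hk := hS.nonneg
  refine le_of_tendsto ((tendsto_const_nhds.inner hg).abs.const_mul (τ : ℝ))
    (Eventually.of_forall fun n => ?_)
  exact hS.mul_abs_inner_le h hT hex hw (hxy n) (by positivity) (hSx n) hτ

end Size

/-! ### The coefficients defined by a family of forms -/

section WordDeriv

variable {N : ℕ} {F G : Type*} [NormedAddCommGroup F] [NormedSpace ℝ F] [NormedAddCommGroup G]
  [NormedSpace ℝ G]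

theorem wordDeriv_clm_comp (L : F →L[ℝ] G) (w : List (Fin N)) {f : (Fin N → ℝ) → F}
    (hf : ContDiff ℝ w.length f) : wordDeriv w (fun z => L (f z)) = fun z => L (wordDeriv w f z) := by
  induction w with
  | nil => rfl
  | cons j w ih =>
    have hf' : ContDiff ℝ ((w.length + 1 : ℕ) : WithTop ℕ∞) f := hf
    have h1 := ih (hf'.of_le (by exact_mod_cast Nat.le_succ _))
    have h2 : ContDiff ℝ (1 : ℕ) (wordDeriv w f) := contDiff_wordDeriv w hf' (by omega)
    funext z
    change fderiv ℝ (wordDeriv w fun z => L (f z)) z _ = L (fderiv ℝ (wordDeriv w f) z _)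
    rw [h1]
    exact congrArg (fun M : (Fin N → ℝ) →L[ℝ] G => M (Pi.single j 1))
      (L.hasFDerivAt.comp z (h2.differentiable (by simp) z).hasFDerivAt).fderiv

theorem wordDeriv_add (w : List (Fin N)) {f g : (Fin N → ℝ) → F} (hf : ContDiff ℝ w.length f)
    (hg : ContDiff ℝ w.length g) : wordDeriv w (f + g) = wordDeriv w f + wordDeriv w g := by
  have h1 := wordDeriv_clm_comp (ContinuousLinearMap.fst ℝ F F) w (hf.prodMk hg)
  have h2 := wordDeriv_clm_comp (ContinuousLinearMap.snd ℝ F F) w (hf.prodMk hg)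
  have h3 := wordDeriv_clm_comp (ContinuousLinearMap.fst ℝ F F + ContinuousLinearMap.snd ℝ F F) w
    (hf.prodMk hg)
  funext z
  have e1 := congrFun h1 z
  have e2 := congrFun h2 z
  have e3 := congrFun h3 z
  simp only [ContinuousLinearMap.coe_fst', ContinuousLinearMap.coe_snd', add_apply] at e1 e2 e3
  rw [Pi.add_apply, e1, e2, ← e3]
  rfl

theorem wordDeriv_const_smul (w : List (Fin N)) (c : ℝ) {f : (Fin N → ℝ) → F}
    (hf : ContDiff ℝ w.length f) : wordDeriv w (c • f) = c • wordDeriv w f :=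
  wordDeriv_clm_comp (c • ContinuousLinearMap.id ℝ F) w hf

end WordDeriv

/-! ### Operators that represent the derivatives of a form -/

section Coefficients

variable {N : ℕ} {law : Fin N → NoiseLaw} {D H W : Type*}
  [NormedAddCommGroup D] [InnerProductSpace ℝ D]
  [NormedAddCommGroup H] [InnerProductSpace ℝ H] [CompleteSpace H]
  [AddCommGroup W] [Module ℝ W]

/-- Riesz representation for each `u`. As `J` has dense range, the representing vectors are unique,
and therefore they depend linearly on `u`. -/
theorem exists_clm_of_bound {J : W →ₗ[ℝ] H} (hJ : DenseRange J) (g : D →ₗ[ℝ] W →ₗ[ℝ] ℝ) {M : ℝ}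
    (hM : 0 ≤ M) (hg : ∀ u v, |g u v| ≤ M * ‖u‖ * ‖J v‖) :
    ∃ L : D →L[ℝ] H, ‖L‖ ≤ M ∧ ∀ u v, inner ℝ (J v) (L u) = g u v := by
  choose G hGM hG using fun u => exists_inner_eq_of_bound J (g u) (M := M * ‖u‖) (by positivity)
    (hg u)
  have hext : ∀ x y : H, (∀ v, inner ℝ (J v) x = inner ℝ (J v) y) → x = y := by
    intro x y h
    refine ext_inner_left ℝ fun v => ?_
    exact congrFun (hJ.equalizer (g := fun v => inner ℝ v x) (h := fun v => inner ℝ v y)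
      (by fun_prop) (by fun_prop) (funext h)) v
  let L : D →ₗ[ℝ] H :=
    { toFun := G
      map_add' := fun u u' => hext _ _ fun v => by
        rw [inner_add_right, hG, hG, hG, map_add, LinearMap.add_apply]
      map_smul' := fun r u => hext _ _ fun v => by
        rw [RingHom.id_apply, real_inner_smul_right, hG, hG, map_smul, LinearMap.smul_apply,
          smul_eq_mul] }
  exact ⟨L.mkContinuous M hGM, L.mkContinuous_norm_le hM _, fun u v => hG u v⟩

/-- `B w z` represents the derivative of the form along `w`, in the `H`-topology of the second
argument. For test vectors `J v` the matrix elements are classical derivatives, so measurability and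
the product rule are clear. Both pass to arbitrary `y` in `H` by approximation from the range of
`J`. -/
theorem exists_isCoefJet [TopologicalSpace.SeparableSpace H] {ℓ : ℕ} {J : W →ₗ[ℝ] H}
    (hJ : DenseRange J)
    (g : D →ₗ[ℝ] W →ₗ[ℝ] (Fin N → ℝ) → ℝ) (hg : ∀ u v, ContDiff ℝ ℓ (g u v)) {C : ℝ} (hC : 0 ≤ C)
    (hbd : ∀ᵐ z ∂volume.restrict (box law), ∀ w : List (Fin N), w.length ≤ ℓ → ∀ u v,
      |rhoPow law (letterCount w) z * wordDeriv w (g u v) z| ≤ C * ‖u‖ * ‖J v‖) :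
    ∃ B : List (Fin N) → (Fin N → ℝ) → D →L[ℝ] H, IsCoefJet (box law) ℓ B ∧
      (∀ w : List (Fin N), w.length ≤ ℓ → ∀ᵐ z ∂volume.restrict (box law),
        rhoPow law (letterCount w) z * ‖B w z‖ ≤ C) ∧
      ∀ w : List (Fin N), w.length ≤ ℓ → ∀ᵐ z ∂volume.restrict (box law), ∀ u v,
        inner ℝ (J v) (B w z u) = wordDeriv w (g u v) z := by
  have hgw : ∀ w : List (Fin N), w.length ≤ ℓ → ∀ u v, ContDiff ℝ w.length (g u v) :=
    fun w hw u v => (hg u v).of_le (by exact_mod_cast hw)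
  have hex : ∀ (w : List (Fin N)) (z : Fin N → ℝ), ∃ L : D →L[ℝ] H, w.length ≤ ℓ → z ∈ box law →
      (∀ u v, |rhoPow law (letterCount w) z * wordDeriv w (g u v) z| ≤ C * ‖u‖ * ‖J v‖) →
      ‖L‖ ≤ C / rhoPow law (letterCount w) z ∧
        ∀ u v, inner ℝ (J v) (L u) = wordDeriv w (g u v) z := by
    intro w z
    by_cases hw : w.length ≤ ℓ; swap
    · exact ⟨0, fun h => absurd h hw⟩
    by_cases hz : z ∈ box law; swap
    · exact ⟨0, fun _ h => absurd h hz⟩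
    by_cases hb : ∀ u v, |rhoPow law (letterCount w) z * wordDeriv w (g u v) z| ≤ C * ‖u‖ * ‖J v‖
    swap
    · exact ⟨0, fun _ _ h => absurd h hb⟩
    have hρ := rhoPow_pos (law := law) (letterCount w) hz
    let G : D →ₗ[ℝ] W →ₗ[ℝ] ℝ := LinearMap.mk₂ ℝ (fun u v => wordDeriv w (g u v) z)
      (fun u u' v => by
        rw [map_add, LinearMap.add_apply, wordDeriv_add w (hgw w hw _ _) (hgw w hw _ _)]; rfl)
      (fun r u v => by
        rw [map_smul, LinearMap.smul_apply, wordDeriv_const_smul w r (hgw w hw _ _)]; rfl)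
      (fun u v v' => by
        rw [map_add, wordDeriv_add w (hgw w hw _ _) (hgw w hw _ _)]; rfl)
      (fun r u v => by
        rw [map_smul, wordDeriv_const_smul w r (hgw w hw _ _)]; rfl)
    obtain ⟨L, hL, hL'⟩ := exists_clm_of_bound hJ G (M := C / rhoPow law (letterCount w) z)
      (by positivity) (fun u v => by
        have h1 := hb u v
        rw [abs_mul, abs_of_pos hρ] at h1
        rw [div_mul_eq_mul_div, div_mul_eq_mul_div, le_div_iff₀ hρ, mul_comm]
        exact h1)
    exact ⟨L, fun _ _ _ => ⟨hL, hL'⟩⟩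
  choose B hB using hex
  have hae : ∀ w : List (Fin N), w.length ≤ ℓ → ∀ᵐ z ∂volume.restrict (box law),
      ‖B w z‖ ≤ C / rhoPow law (letterCount w) z ∧
        ∀ u v, inner ℝ (J v) (B w z u) = wordDeriv w (g u v) z := by
    intro w hw
    filter_upwards [hbd, ae_restrict_mem (isOpen_box law).measurableSet] with z h1 h2
    exact hB w z hw h2 (h1 w hw)
  have happ : ∀ y : H, ∃ v : ℕ → W, Tendsto (fun n => J (v n)) atTop (𝓝 y) := by
    intro y
    obtain ⟨s, hs, hsy⟩ := mem_closure_iff_seq_limit.1 (hJ y)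
    choose v hv using hs
    exact ⟨v, by simpa only [hv] using hsy⟩
  have hcont : ∀ w : List (Fin N), ContinuousOn (fun z => C / rhoPow law (letterCount w) z) (box law) :=
    fun w => continuousOn_const.div (continuousOn_rhoPow _) fun z hz => (rhoPow_pos _ hz).ne'
  have hweak : ∀ w : List (Fin N), w.length ≤ ℓ → ∀ u y,
      AEStronglyMeasurable (fun z => inner ℝ y (B w z u)) (volume.restrict (box law)) := by
    intro w hw u y
    obtain ⟨v, hv⟩ := happ y
    refine aestronglyMeasurable_of_tendsto_ae atTop (f := fun n z => inner ℝ (J (v n)) (B w z u))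
      (fun n => ?_) (Eventually.of_forall fun z => hv.inner tendsto_const_nhds)
    have h1 : ContDiff ℝ (0 : ℕ) (wordDeriv w (g u (v n))) :=
      contDiff_wordDeriv w (hgw w hw u (v n)) (by omega)
    refine h1.continuous.aestronglyMeasurable.congr ?_
    filter_upwards [hae w hw] with z hz
    exact (hz.2 u (v n)).symm
  have hcoef : ∀ w : List (Fin N), w.length ≤ ℓ → IsCoef (box law) (B w) := by
    intro w hw
    refine ⟨fun u => ?_, _, hcont w, (hae w hw).mono fun z hz => hz.1⟩
    obtain ⟨d, b, hb⟩ := exists_finiteRank_approx H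
    refine aestronglyMeasurable_of_tendsto_ae atTop
      (f := fun n z => ∑ i, inner ℝ (b n i) (B w z u) • b n i)
      (fun n => ?_) (Eventually.of_forall fun z => (hb _).1)
    exact Finset.aestronglyMeasurable_fun_sum _ fun i _ => (hweak w hw u _).smul_const _
  refine ⟨B, ⟨hcoef, fun w j hw => ⟨hcoef w hw.le, hcoef (j :: w) hw, fun u y h h' hh => ?_⟩⟩,
    fun w hw => ?_, fun w hw => (hae w hw).mono fun z hz => hz.2⟩
  · obtain ⟨v, hv⟩ := happ y
    -- A convergent sequence is bounded; `R` enters the function that dominates the approximations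
    -- and their derivatives.
    obtain ⟨R, hR⟩ := hv.norm.bddAbove_range
    have hR' : ∀ n, ‖J (v n)‖ ≤ R := fun n => hR ⟨n, rfl⟩
    have h0 := hae w hw.le
    have h1 := hae (j :: w) hw
    let b : (Fin N → ℝ) → ℝ := fun z =>
      R * ‖u‖ * (C / rhoPow law (letterCount w) z) * ‖h z‖ +
        (R * ‖u‖ * (C / rhoPow law (letterCount (j :: w)) z) * ‖h z‖ +
          R * ‖u‖ * (C / rhoPow law (letterCount w) z) * ‖h' z‖)
    have hloc : ∀ (w : List (Fin N)) {k : (Fin N → ℝ) → ℝ}, LocallyIntegrableOn k (box law) volume →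
        LocallyIntegrableOn (fun z => R * ‖u‖ * (C / rhoPow law (letterCount w) z) * ‖k z‖)
          (box law) volume := fun w k hk =>
      hk.norm.continuousOn_mul (continuousOn_const.mul (hcont w)) (isOpen_box law).isLocallyClosed
    have hbl : LocallyIntegrableOn b (box law) volume :=
      (hloc w hh.left).add ((hloc (j :: w) hh.left).add (hloc w hh.right))
    have hest : ∀ (L : D →L[ℝ] H) (m : ℝ), ‖L‖ ≤ m → ∀ n, |inner ℝ (J (v n)) (L u)| ≤ R * ‖u‖ * m := by
      intro L m hL n
      refine (abs_real_inner_le_norm _ _).trans ?_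
      have e1 := L.le_of_opNorm_le hL u
      have e2 : 0 ≤ m * ‖u‖ := (norm_nonneg _).trans e1
      calc ‖J (v n)‖ * ‖L u‖ ≤ R * (m * ‖u‖) :=
            mul_le_mul (hR' n) e1 (norm_nonneg _) ((norm_nonneg _).trans (hR' n))
        _ = _ := by ring
    refine HasWeakDeriv.of_tendsto
      (F := fun n z => inner ℝ (J (v n)) (B w z u) * h z)
      (G := fun n z => inner ℝ (J (v n)) (B (j :: w) z u) * h z + inner ℝ (J (v n)) (B w z u) * h' z)
      (fun n => ?_) hbl (fun n => ?_) (fun n => ?_)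
      (Eventually.of_forall fun z => (hv.inner tendsto_const_nhds).mul_const _)
      (Eventually.of_forall fun z => ((hv.inner tendsto_const_nhds).mul_const _).add
        ((hv.inner tendsto_const_nhds).mul_const _))
    · have hc : ContDiff ℝ (1 : ℕ) (wordDeriv w (g u (v n))) :=
        contDiff_wordDeriv w (hg u (v n)) (by omega)
      refine (hh.contDiff_mul (isOpen_box law) hc).congr ?_ ?_
      · filter_upwards [h0] with z hz
        rw [hz.2]
      · filter_upwards [h0, h1] with z hz hz'
        rw [hz.2, hz'.2]
        rfl
    · filter_upwards [h0, h1] with z hz hz'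
      have e1 := hest _ _ hz.1 n
      have e2 : 0 ≤ R * ‖u‖ * (C / rhoPow law (letterCount (j :: w)) z) :=
        (abs_nonneg _).trans (hest _ _ hz'.1 n)
      have e3 : 0 ≤ R * ‖u‖ * (C / rhoPow law (letterCount w) z) := (abs_nonneg _).trans e1
      rw [norm_mul, Real.norm_eq_abs]
      have e4 := mul_le_mul_of_nonneg_right e1 (norm_nonneg (h z))
      have e5 := mul_nonneg e2 (norm_nonneg (h z))
      have e6 := mul_nonneg e3 (norm_nonneg (h' z))
      simp only [b]
      linarith
    · filter_upwards [h0, h1] with z hz hz'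
      have e1 := hest _ _ hz.1 n
      have e2 := hest _ _ hz'.1 n
      have e3 : 0 ≤ R * ‖u‖ * (C / rhoPow law (letterCount w) z) := (abs_nonneg _).trans e1
      refine (norm_add_le _ _).trans ?_
      rw [norm_mul, norm_mul, Real.norm_eq_abs (inner ℝ _ _), Real.norm_eq_abs (inner ℝ _ _)]
      have e4 := mul_le_mul_of_nonneg_right e1 (norm_nonneg (h' z))
      have e5 := mul_le_mul_of_nonneg_right e2 (norm_nonneg (h z))
      have e6 := mul_nonneg e3 (norm_nonneg (h z))
      simp only [b]
      linarith
  · filter_upwards [hae w hw, ae_restrict_mem (isOpen_box law).measurableSet] with z hz hzb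
    have hρ := rhoPow_pos (letterCount w) hzb
    have := hz.1
    rw [le_div_iff₀ hρ] at this
    linarith

end Coefficients

/-! ### From the forms to a symmetric family -/

section Forms

variable {𝕜 : Type*} [RCLike 𝕜] {H V D : Type*}
  [NormedAddCommGroup H] [InnerProductSpace 𝕜 H] [InnerProductSpace ℝ H] [IsScalarTower ℝ 𝕜 H]
  [NormedAddCommGroup V] [InnerProductSpace 𝕜 V] [InnerProductSpace ℝ V] [IsScalarTower ℝ 𝕜 V]
  [NormedAddCommGroup D] [InnerProductSpace 𝕜 D] [InnerProductSpace ℝ D] [IsScalarTower ℝ 𝕜 D]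

/-- Both inner products induce the same norm, so polarization identifies them. -/
theorem real_inner_eq_re (x y : H) : inner ℝ x y = RCLike.re (inner 𝕜 x y) := by
  rw [real_inner_eq_norm_add_mul_self_sub_norm_mul_self_sub_norm_mul_self_div_two,
    re_inner_eq_norm_add_mul_self_sub_norm_mul_self_sub_norm_mul_self_div_two]

variable {ιV : V →L[𝕜] H} {ιD : D →L[𝕜] H}

theorem formGraph_functional (hι : Function.Injective ιV) (hd : DenseRange ιV)
    (a : V →ₗ[𝕜] V →ₗ⋆[𝕜] 𝕜) (p : H × H) (hp : p ∈ formGraph ιV a) (h0 : p.1 = 0) : p.2 = 0 := by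
  obtain ⟨u, hu, hp⟩ := hp
  have hu0 : u = 0 := hι (by rw [hu, h0, map_zero])
  subst hu0
  refine ext_inner_left 𝕜 fun v => ?_
  refine congrFun (hd.equalizer (g := fun v => inner 𝕜 v p.2) (h := fun v => inner 𝕜 v 0)
    (by fun_prop) (by fun_prop) (funext fun v => ?_)) v
  simp only [Function.comp_apply]
  rw [← hp v]
  simp

theorem mem_formOperator_graph (hι : Function.Injective ιV) (hd : DenseRange ιV)
    (a : V →ₗ[𝕜] V →ₗ⋆[𝕜] 𝕜) (p : H × H) :
    p ∈ (formOperator ιV a).graph ↔ p ∈ formGraph ιV a := by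
  rw [formOperator, Submodule.toLinearPMap_graph_eq _ (formGraph_functional hι hd a)]

/-- Testing with `I • v` recovers the imaginary part of the identity, so real parts suffice. -/
theorem mem_formGraph_of_re (a : V →ₗ[𝕜] V →ₗ⋆[𝕜] 𝕜) (u : V) (y : H)
    (h : ∀ v, inner ℝ (ιV v) y = RCLike.re (a u v)) : (ιV u, y) ∈ formGraph ιV a := by
  refine ⟨u, rfl, fun v => ?_⟩
  have h1 := h v
  have h2 := h ((RCLike.I : 𝕜) • v)
  rw [real_inner_eq_re (𝕜 := 𝕜)] at h1 h2
  rw [map_smul, inner_smul_left, LinearMap.map_smulₛₗ, smul_eq_mul] at h2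
  simp only [RCLike.conj_I, neg_mul, map_neg, RCLike.mul_re, RCLike.I_re, zero_mul, zero_sub,
    neg_neg] at h2
  refine RCLike.ext h1.symm ?_
  have h3 := RCLike.mul_im_I_ax (K := 𝕜) (inner 𝕜 (ιV v) y)
  have h4 := RCLike.mul_im_I_ax (K := 𝕜) (a u v)
  rw [← h3, ← h4]
  linarith

variable [CompleteSpace V] [CompleteSpace H]

/-- The Lax–Milgram theorem for the operator associated with a form. -/
theorem exists_mem_formGraph (a : V →ₗ[𝕜] V →ₗ⋆[𝕜] 𝕜) {K κ : ℝ} (hκ : 0 < κ)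
    (hK : ∀ u v, ‖a u v‖ ≤ K * ‖u‖ * ‖v‖) (hc : ∀ u, κ * ‖u‖ ^ 2 ≤ RCLike.re (a u u)) (f : H) :
    ∃ u, (ιV u, f) ∈ formGraph ιV a := by
  -- The real part of the form is real bilinear and coercive, so the real Lax–Milgram theorem
  -- applies.
  let b : V →ₗ[ℝ] V →ₗ[ℝ] ℝ := LinearMap.mk₂ ℝ (fun u v => RCLike.re (a u v))
    (fun u u' v => by simp) (fun r u v => by
      rw [RCLike.real_smul_eq_coe_smul (K := 𝕜), map_smul, LinearMap.smul_apply, smul_eq_mul,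
        RCLike.re_ofReal_mul, smul_eq_mul])
    (fun u v v' => by simp) (fun r u v => by
      rw [RCLike.real_smul_eq_coe_smul (K := 𝕜), LinearMap.map_smulₛₗ, RCLike.conj_ofReal,
        smul_eq_mul, RCLike.re_ofReal_mul, smul_eq_mul])
  let b' : V →L[ℝ] V →L[ℝ] ℝ := b.mkContinuous₂ K fun u v => (RCLike.norm_re_le_norm _).trans (hK u v)
  have hb : IsCoercive b' := ⟨κ, hκ, fun u => by
    have := hc u
    rw [mul_assoc, ← sq]
    exact this⟩
  let g : V := ContinuousLinearMap.adjoint (ιV.restrictScalars ℝ) f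
  refine ⟨hb.continuousLinearEquivOfBilin.symm g, mem_formGraph_of_re a _ _ fun v => ?_⟩
  have h1 := hb.continuousLinearEquivOfBilin_apply (hb.continuousLinearEquivOfBilin.symm g) v
  rw [ContinuousLinearEquiv.apply_symm_apply] at h1
  have h2 : b' (hb.continuousLinearEquivOfBilin.symm g) v =
      RCLike.re (a (hb.continuousLinearEquivOfBilin.symm g) v) := rfl
  rw [← h2, ← h1, ContinuousLinearMap.adjoint_inner_left, real_inner_comm]
  rfl

variable [CompleteSpace D] [TopologicalSpace.SeparableSpace H] {N : ℕ} {law : Fin N → NoiseLaw}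
  {μ : Measure (Fin N → ℝ)} {p : (Fin N → ℝ) → ℝ}

/-- The lower bound makes `A` an embedding of `D` into the separable space `H`. -/
theorem separableSpace_of_lower {A : D →L[ℝ] H} {c : ℝ} (hc : 0 < c) (hA : ∀ u, c * ‖u‖ ≤ ‖A u‖) :
    TopologicalSpace.SeparableSpace D := by
  have hanti : AntilipschitzWith (Real.toNNReal c⁻¹) A := by
    refine AddMonoidHomClass.antilipschitz_of_bound _ fun u => ?_
    rw [Real.coe_toNNReal _ (inv_nonneg.2 hc.le), inv_mul_eq_div, le_div_iff₀ hc, mul_comm]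
    exact hA u
  have := UniformSpace.secondCountable_of_separable H
  have := (hanti.isUniformEmbedding A.uniformContinuous).isEmbedding.secondCountableTopology
  infer_instance

/-- The operators associated with a family of forms are a symmetric family. -/
theorem exists_isSymmFamily (hd : HasDensity law μ p) (hμ0 : μ ≠ 0)
    (hιV : Function.Injective ιV) (hVdense : DenseRange ιV) (hιD : Function.Injective ιD)
    {a : (Fin N → ℝ) → V →ₗ[𝕜] V →ₗ⋆[𝕜] 𝕜} (hform : UniformForms μ a)
    (hdom : ConstantDomain μ ιD fun z => formOperator ιV (a z))
    {ℓ : ℕ} (hder : DerivativeBounds law μ ιV ιD a ℓ) :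
    ∃ B c C, IsSymmFamily law ℓ (ιD.restrictScalars ℝ) B c C ∧
      (∀ᵐ z ∂μ, ∀ x y, (x, y) ∈ (formOperator ιV (a z)).graph ↔ ∃ u, ιD u = x ∧ B [] z u = y) ∧
      TopologicalSpace.SeparableSpace D := by
  have hμ' := hd.absolutelyContinuous'
  obtain ⟨K, hK, κ, hκ, hform⟩ := hform
  obtain ⟨c₁, hc₁, C₁, hC₁, hdom⟩ := hdom
  obtain ⟨hsm, C, hC, hder⟩ := hder
  have hne : (ae μ).NeBot := ae_neBot.2 hμ0
  have hmemdom : ∀ z x, x ∈ (formOperator ιV (a z)).domain ↔ ∃ y, (x, y) ∈ formGraph ιV (a z) := by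
    intro z x
    simp only [← mem_formOperator_graph hιV hVdense, ← LinearPMap.mem_domain_iff]
  -- The domain of a form operator lies in `V`. A single good `z`, which exists because `μ ≠ 0`,
  -- therefore embeds `D` into `V`.
  have hj : ∀ u : D, ∃ v : V, ιV v = ιD u := by
    intro u
    obtain ⟨z, hz⟩ := hdom.exists
    have h1 : ιD u ∈ (formOperator ιV (a z)).domain := by
      rw [← SetLike.mem_coe, hz.1]; exact mem_range_self u
    obtain ⟨y, v, hv, -⟩ := (hmemdom z _).1 h1
    exact ⟨v, hv⟩
  choose j hj using hj
  let J : D →ₗ[ℝ] V :=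
    { toFun := j
      map_add' := fun u u' => hιV (by rw [map_add, hj, hj, hj, map_add])
      map_smul' := fun r u => hιV (by
        rw [RingHom.id_apply, RCLike.real_smul_eq_coe_smul (K := 𝕜),
          RCLike.real_smul_eq_coe_smul (K := 𝕜), map_smul, hj, hj, map_smul]) }
  let g : D →ₗ[ℝ] V →ₗ[ℝ] (Fin N → ℝ) → ℝ := LinearMap.mk₂ ℝ (fun u v z => RCLike.re (a z (J u) v))
    (fun u u' v => by ext z; simp) (fun r u v => by
      ext z
      rw [map_smul, RCLike.real_smul_eq_coe_smul (K := 𝕜), map_smul, LinearMap.smul_apply,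
        smul_eq_mul, RCLike.re_ofReal_mul, Pi.smul_apply, smul_eq_mul])
    (fun u v v' => by ext z; simp) (fun r u v => by
      ext z
      rw [RCLike.real_smul_eq_coe_smul (K := 𝕜), LinearMap.map_smulₛₗ, RCLike.conj_ofReal,
        smul_eq_mul, RCLike.re_ofReal_mul, Pi.smul_apply, smul_eq_mul])
  have hg : ∀ u v, ContDiff ℝ ℓ (g u v) := fun u v =>
    (RCLike.reCLM : 𝕜 →L[ℝ] ℝ).contDiff.comp (hsm (J u) v)
  obtain ⟨B, hB, hBb, hBg⟩ := exists_isCoefJet (law := law) (J := (ιV.restrictScalars ℝ).toLinearMap)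
    hVdense g hg hC (by
      filter_upwards [hμ'.ae_le hder] with z hz w hw u v
      have h1 := hz u (J u) v (hj u) (letterCount w) (by rwa [order_letterCount])
      have hcd : ContDiff ℝ w.length fun z' => a z' (J u) v :=
        (hsm (J u) v).of_le (by exact_mod_cast hw)
      rw [partialDeriv_letterCount hcd] at h1
      have h2 : wordDeriv w (g u v) = fun z => RCLike.re (wordDeriv w (fun z' => a z' (J u) v) z) :=
        wordDeriv_clm_comp RCLike.reCLM w hcd
      rw [h2, ← RCLike.re_ofReal_mul (K := 𝕜)]
      exact (RCLike.abs_re_le_norm _).trans h1)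
  have hBg0 : ∀ᵐ z ∂volume.restrict (box law), ∀ u v,
      inner ℝ (ιV v) (B [] z u) = RCLike.re (a z (J u) v) := hBg [] (Nat.zero_le _)
  have hmem : ∀ᵐ z ∂volume.restrict (box law), ∀ u,
      (ιD u, B [] z u) ∈ formGraph ιV (a z) := by
    filter_upwards [hBg0] with z hz u
    have := mem_formGraph_of_re (a z) (J u) (B [] z u) (hz u)
    rwa [show ιV (J u) = ιD u from hj u] at this
  have hiff : ∀ᵐ z ∂volume.restrict (box law), ∀ x y,
      (x, y) ∈ (formOperator ιV (a z)).graph ↔ ∃ u, ιD u = x ∧ B [] z u = y := by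
    filter_upwards [hmem, hμ'.ae_le hdom] with z hz hdz x y
    rw [mem_formOperator_graph hιV hVdense]
    constructor
    · intro hxy
      have h1 : x ∈ ((formOperator ιV (a z)).domain : Set H) := (hmemdom z x).2 ⟨y, hxy⟩
      rw [hdz.1] at h1
      obtain ⟨u, rfl⟩ := h1
      refine ⟨u, rfl, ?_⟩
      exact sub_eq_zero.1 (formGraph_functional hιV hVdense (a z) _
        (Submodule.sub_mem _ (hz u) hxy) (sub_self _))
    · rintro ⟨u, rfl, rfl⟩
      exact hz u
  -- Coercivity gives κ‖u‖_V² ≤ (u | Bu) ≤ ‖u‖_H ‖Bu‖, and ‖u‖_H ≤ (‖ιV‖ + 1)‖u‖_V turns this into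
  -- ‖u‖_H ≤ M‖Bu‖.
  set M : ℝ := (‖ιV‖ + 1) ^ 2 / κ with hM
  have hM0 : 0 ≤ M := by positivity
  have hcoer : ∀ᵐ z ∂volume.restrict (box law), ∀ u,
      0 ≤ inner ℝ (B [] z u) (ιD u) ∧ ‖ιD u‖ ≤ M * ‖B [] z u‖ := by
    filter_upwards [hBg0, hμ'.ae_le hform] with z hz hfz u
    have h1 := hfz.2.1 (J u)
    rw [← hz u (J u), show ιV (J u) = ιD u from hj u] at h1
    have h2 : ‖ιD u‖ ≤ (‖ιV‖ + 1) * ‖J u‖ := by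
      rw [← show ιV (J u) = ιD u from hj u]
      refine (ιV.le_opNorm _).trans ?_
      gcongr
      linarith
    have h3 := real_inner_le_norm (ιD u) (B [] z u)
    refine ⟨by rw [real_inner_comm]; exact (by positivity : 0 ≤ κ * ‖J u‖ ^ 2).trans h1, ?_⟩
    rcases (norm_nonneg (ιD u)).eq_or_lt with h4 | h4
    · rw [← h4]; positivity
    · refine le_of_mul_le_mul_right ?_ h4
      have h5 : ‖ιD u‖ * ‖ιD u‖ ≤ (‖ιV‖ + 1) ^ 2 * ‖J u‖ ^ 2 := by
        rw [← sq, ← mul_pow]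
        exact pow_le_pow_left₀ (norm_nonneg _) h2 2
      rw [hM, div_mul_eq_mul_div, div_mul_eq_mul_div, le_div_iff₀ hκ]
      have h6 : (‖ιV‖ + 1) ^ 2 * (κ * ‖J u‖ ^ 2) ≤ (‖ιV‖ + 1) ^ 2 * (‖ιD u‖ * ‖B [] z u‖) :=
        mul_le_mul_of_nonneg_left (h1.trans h3) (by positivity)
      nlinarith
  -- The graph norm is at most ‖Bu‖ + ‖u‖_H ≤ (1 + M)‖Bu‖ and at least c₁‖u‖_D.
  have hlower : ∀ᵐ z ∂volume.restrict (box law), ∀ u, c₁ / (1 + M) * ‖u‖ ≤ ‖B [] z u‖ := by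
    filter_upwards [hcoer, hμ'.ae_le hdom, hmem] with z hz hdz hmz u
    have hdu : ιD u ∈ (formOperator ιV (a z)).domain := by
      rw [← SetLike.mem_coe, hdz.1]; exact mem_range_self u
    have h1 := (hdz.2 u ⟨ιD u, hdu⟩ rfl).1
    have h2 : formOperator ιV (a z) ⟨ιD u, hdu⟩ = B [] z u := by
      have h3 : (ιD u, formOperator ιV (a z) ⟨ιD u, hdu⟩) ∈ (formOperator ιV (a z)).graph :=
        LinearPMap.mem_graph _ ⟨ιD u, hdu⟩
      rw [mem_formOperator_graph hιV hVdense] at h3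
      exact sub_eq_zero.1 (formGraph_functional hιV hVdense (a z) _
        (Submodule.sub_mem _ h3 (hmz u)) (sub_self _))
    rw [h2] at h1
    have h4 : √(‖B [] z u‖ ^ 2 + ‖ιD u‖ ^ 2) ≤ ‖B [] z u‖ + ‖ιD u‖ :=
      Real.sqrt_le_iff.2 ⟨by positivity, by nlinarith [norm_nonneg (B [] z u), norm_nonneg (ιD u)]⟩
    have h5 := (hz u).2
    rw [div_mul_eq_mul_div, div_le_iff₀ (by positivity)]
    have h6 := h1.trans h4
    linarith
  have hc : 0 < c₁ / (1 + M) := by positivity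
  have hsep : TopologicalSpace.SeparableSpace D := by
    have hbox : ∀ᵐ z ∂μ, ∀ u, c₁ / (1 + M) * ‖u‖ ≤ ‖B [] z u‖ := hd.absolutelyContinuous.ae_le hlower
    obtain ⟨z, hz⟩ := hbox.exists
    exact separableSpace_of_lower hc hz
  refine ⟨B, c₁ / (1 + M), C, ⟨hιD, hc, hC, hB, hBb, hlower, ?_,
    hcoer.mono fun z hz u => (hz u).1, ?_⟩, hd.absolutelyContinuous.ae_le hiff, hsep⟩
  · filter_upwards [hBg0, hμ'.ae_le hform] with z hz hfz u v
    change inner ℝ (B [] z u) (ιD v) = inner ℝ (ιD u) (B [] z v)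
    rw [real_inner_comm, ← show ιV (J v) = ιD v from hj v, ← show ιV (J u) = ιD u from hj u, hz, hz,
      hfz.2.2 (J u) (J v), RCLike.conj_re]
  · filter_upwards [hiff, hμ'.ae_le hform] with z hz hfz f
    obtain ⟨u, hu⟩ := exists_mem_formGraph (ιV := ιV) (a z) hκ hfz.1 hfz.2.1 f
    rw [← mem_formOperator_graph hιV hVdense, hz] at hu
    obtain ⟨w, -, hw⟩ := hu
    exact ⟨w, hw⟩

end Forms

/-! ### Resolvent and semigroup bounds in Sobolev spaces -/

section SobolevBounds

variable {𝕜 : Type*} [RCLike 𝕜] {N : ℕ} {D H : Type*}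
  [NormedAddCommGroup D] [InnerProductSpace 𝕜 D] [InnerProductSpace ℝ D] [IsScalarTower ℝ 𝕜 D]
  [CompleteSpace D] [TopologicalSpace.SeparableSpace D]
  [NormedAddCommGroup H] [InnerProductSpace 𝕜 H] [InnerProductSpace ℝ H] [IsScalarTower ℝ 𝕜 H]
  [CompleteSpace H] [TopologicalSpace.SeparableSpace H]
  {law : Fin N → NoiseLaw} {ℓ : ℕ} {ι : D →L[ℝ] H}
  {B : List (Fin N) → (Fin N → ℝ) → D →L[ℝ] H} {c C : ℝ} {μ : Measure (Fin N → ℝ)}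
  {p : (Fin N → ℝ) → ℝ} {a b δ : ℝ} {q : ℕ}

/-- The constant in the resolvent estimates. -/
noncomputable def resolventConst (N : ℕ) (c C δ : ℝ) (q : ℕ) : ℝ :=
  √((multiIndices N q).card) * ((√(1 - δ))⁻¹ * (solutionConst (√(1 - δ) * c) C q))

theorem IsSymmFamily.resolventConst_nonneg (h : IsSymmFamily law ℓ ι B c C) (hδ1 : δ < 1) :
    0 ≤ resolventConst N c C δ q := by
  have h0 : 0 < √(1 - δ) := Real.sqrt_pos.2 (by linarith)
  have := solutionConst_nonneg (mul_pos h0 h.pos) h.nonneg q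
  unfold resolventConst
  positivity

/-- The two components of the data form one jet of pairs, to which the weighted estimate for the
block operator is applied; the projections to the components do not increase norms. -/
theorem IsSymmFamily.sobolev_shift (h : IsSymmFamily law ℓ ι B c C) (hd : HasDensity law μ p)
    (hδ : 0 ≤ δ) (hδ1 : δ < 1) (ha : -(δ * √(a ^ 2 + b ^ 2)) ≤ a) (hab : 0 < √(a ^ 2 + b ^ 2))
    (hq : q ≤ ℓ) {U F : Lp H 2 μ × Lp H 2 μ} (hU : IsShift (symbolGraph μ ι (B [])) a b U F)
    {M : ℝ} (h1 : MemSobolev 𝕜 law μ q F.1) (h2 : MemSobolev 𝕜 law μ q F.2)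
    (hM : sobolevNorm 𝕜 law μ q F.1 + sobolevNorm 𝕜 law μ q F.2 ≤ M) :
    (∃ w₁ w₂ : Lp D 2 μ, (∀ᵐ z ∂μ, ι (w₁ z) = U.1 z) ∧ (∀ᵐ z ∂μ, ι (w₂ z) = U.2 z) ∧
      (MemSobolev 𝕜 law μ q w₁ ∧
        sobolevNorm 𝕜 law μ q w₁ ≤ resolventConst N c C δ q * c⁻¹ * M) ∧
      (MemSobolev 𝕜 law μ q w₂ ∧
        sobolevNorm 𝕜 law μ q w₂ ≤ resolventConst N c C δ q * c⁻¹ * M)) ∧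
    (MemSobolev 𝕜 law μ q U.1 ∧
      sobolevNorm 𝕜 law μ q U.1 ≤ resolventConst N c C δ q * (√(a ^ 2 + b ^ 2))⁻¹ * M) ∧
    (MemSobolev 𝕜 law μ q U.2 ∧
      sobolevNorm 𝕜 law μ q U.2 ≤ resolventConst N c C δ q * (√(a ^ 2 + b ^ 2))⁻¹ * M) := by
  have hμ := hd.absolutelyContinuous
  have h0 : 0 < √(1 - δ) := Real.sqrt_pos.2 (by linarith)
  have hn1 := sobolevNorm_nonneg (𝕜 := 𝕜) (law := law) (μ := μ) (q := q) (f := F.1)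
  have hn2 := sobolevNorm_nonneg (𝕜 := 𝕜) (law := law) (μ := μ) (q := q) (f := F.2)
  have hM0 : 0 ≤ M := (add_nonneg hn1 hn2).trans hM
  have hK := solutionConst_nonneg (mul_pos h0 h.pos) h.nonneg q
  have hc := h.pos
  obtain ⟨F₁, hF₁, hF₁0⟩ := h1.exists_sobolevJet hμ
  obtain ⟨F₂, hF₂, hF₂0⟩ := h2.exists_sobolevJet hμ
  have hΦ : SobolevJet law μ q (fun w z => pairInl (F₁ w z) + pairInr (F₂ w z)) M := by
    have := hF₁.pair hμ hn1 hn2 hF₂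
    exact ⟨this.jet, fun w hw => (this.bound w hw).trans (ENNReal.ofReal_le_ofReal hM)⟩
  obtain ⟨w₁, w₂, e1, e2, e3⟩ := h.exists_shift_lp hd hU
  have hu : ∀ᵐ z ∂volume.restrict (box law), shiftJet ι B a b [] z (WithLp.toLp 2 (w₁ z, w₂ z)) =
      pairInl (F₁ [] z) + pairInr (F₂ [] z) := by
    filter_upwards [hd.absolutelyContinuous'.ae_le e3, hF₁0, hF₂0] with z hz hz1 hz2
    rw [hz, hz1, hz2, pairInl_add_pairInr]
  obtain ⟨G, hG0, hG, hGι⟩ := h.sobolevJet_shift hδ hδ1 ha hab hμ hq hM0 hΦ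
    (u := fun z => WithLp.toLp 2 (w₁ z, w₂ z)) hu
  have fin1 : √((multiIndices N q).card) *
      ((√(1 - δ) * c)⁻¹ * (solutionConst (√(1 - δ) * c) C q * M)) =
        resolventConst N c C δ q * c⁻¹ * M := by
    rw [resolventConst, mul_inv]; ring
  have fin2 : √((multiIndices N q).card) *
      ((√(1 - δ) * √(a ^ 2 + b ^ 2))⁻¹ * (solutionConst (√(1 - δ) * c) C q * M)) =
        resolventConst N c C δ q * (√(a ^ 2 + b ^ 2))⁻¹ * M := by
    rw [resolventConst, mul_inv]; ring
  refine ⟨⟨w₁, w₂, e1, e2, ?_, ?_⟩, ?_, ?_⟩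
  · rw [← fin1]
    refine (hG.clm_comp (WithLp.fstL 2 ℝ D D) norm_fst_le_pair).memSobolev hμ (by positivity)
      (Eventually.of_forall fun z => ?_)
    rw [hG0]; rfl
  · rw [← fin1]
    refine (hG.clm_comp (WithLp.sndL 2 ℝ D D) norm_snd_le_pair).memSobolev hμ (by positivity)
      (Eventually.of_forall fun z => ?_)
    rw [hG0]; rfl
  · rw [← fin2]
    refine (hGι.clm_comp (WithLp.fstL 2 ℝ H H) norm_fst_le_pair).memSobolev hμ (by positivity) ?_
    filter_upwards [hd.absolutelyContinuous'.ae_le e1] with z hz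
    rw [hG0, ← hz, block_apply]
    exact sub_zero _
  · rw [← fin2]
    refine (hGι.clm_comp (WithLp.sndL 2 ℝ H H) norm_snd_le_pair).memSobolev hμ (by positivity) ?_
    filter_upwards [hd.absolutelyContinuous'.ae_le e2] with z hz
    rw [hG0, ← hz, block_apply]
    exact zero_add _

theorem IsSymmFamily.sobolev_apply (h : IsSymmFamily law ℓ ι B c C) (hd : HasDensity law μ p)
    (hq : q ≤ ℓ) {w : Lp D 2 μ} {g : Lp H 2 μ} (hg : ∀ᵐ z ∂μ, B [] z (w z) = g z)
    (hw : MemSobolev 𝕜 law μ q w) :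
    MemSobolev 𝕜 law μ q g ∧ sobolevNorm 𝕜 law μ q g ≤
      √((multiIndices N q).card) * (2 ^ q * (C * sobolevNorm 𝕜 law μ q w)) := by
  have hμ := hd.absolutelyContinuous
  obtain ⟨F, hF, hF0⟩ := hw.exists_sobolevJet hμ
  have hC := h.nonneg
  have hn := sobolevNorm_nonneg (𝕜 := 𝕜) (law := law) (μ := μ) (q := q) (f := w)
  refine (SobolevJet.leibniz hμ h.nonneg (h.jet.mono hq)
    (fun w hw => h.bound w (hw.trans hq)) hF).memSobolev hμ (by positivity) ?_
  filter_upwards [hF0, hd.absolutelyContinuous'.ae_le hg] with z hz hz'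
  rw [leibniz_nil]
  change B [] z (F [] z) = _
  rw [hz, hz']

variable [IsFiniteMeasure μ]

theorem IsSymmFamily.resolventBound_norm (h : IsSymmFamily law ℓ ι B c C)
    (hd : HasDensity law μ p) :
    ResolventBound (symbolGraph μ ι (B [])) (fun f M => ‖f‖ ≤ M) 2 where
  nonneg := zero_le_two
  zero M hM := by rwa [norm_zero]
  smul r f M hr hf := by
    rw [norm_smul, Real.norm_of_nonneg hr]
    exact mul_le_mul_of_nonneg_left hf hr
  shift a b U F M ha hM hU h1 h2 := by
    have hab : 0 < √(a ^ 2 + b ^ 2) := Real.sqrt_pos.2 (by positivity)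
    have h3 := (h.norm_shift_le hd le_rfl one_pos (by simpa using ha.le) hab hU).2
    rw [sub_zero, Real.sqrt_one, one_mul] at h3
    have h4 : (√(a ^ 2 + b ^ 2))⁻¹ * (‖F.1‖ + ‖F.2‖) ≤ 2 * (√(a ^ 2 + b ^ 2))⁻¹ * M := by
      have h5 : ‖F.1‖ + ‖F.2‖ ≤ 2 * M := by linarith
      have := mul_le_mul_of_nonneg_left h5 (inv_nonneg.2 hab.le)
      linarith
    exact ⟨h3.1.trans h4, h3.2.trans h4⟩

/-- The dual bound is a notion of size that can be tested against vectors of L₂. Going from it to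
the Sobolev norm costs the square root of the number of multi-indices for each of the two
components; going back costs nothing. -/
theorem IsSymmFamily.resolventBound_dualBound (𝕜 : Type*) [RCLike 𝕜] [InnerProductSpace 𝕜 D]
    [IsScalarTower ℝ 𝕜 D] [InnerProductSpace 𝕜 H] [IsScalarTower ℝ 𝕜 H]
    (h : IsSymmFamily law ℓ ι B c C)
    (hd : HasDensity law μ p) (hq : q ≤ ℓ) :
    ResolventBound (symbolGraph μ ι (B [])) (hd.DualBound q)
      (resolventConst N c C 0 q * (2 * √((multiIndices N q).card))) where
  nonneg := mul_nonneg (h.resolventConst_nonneg one_pos) (by positivity)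
  zero M hM α hα e := by
    rw [inner_zero_right, abs_zero]
    positivity
  smul r f M hr hf α hα e := by
    rw [real_inner_smul_right, abs_mul, abs_of_nonneg hr, mul_assoc]
    exact mul_le_mul_of_nonneg_left (hf α hα e) hr
  shift a b U F M ha hM hU h1 h2 := by
    have hab : 0 < √(a ^ 2 + b ^ 2) := Real.sqrt_pos.2 (by positivity)
    have m1 := h1.memSobolev (𝕜 := 𝕜) hM
    have m2 := h2.memSobolev (𝕜 := 𝕜) hM
    have h3 := (h.sobolev_shift (𝕜 := 𝕜) hd le_rfl one_pos (by simpa using ha.le) hab hq hU m1.1 m2.1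
      (add_le_add m1.2 m2.2)).2
    have h4 : resolventConst N c C 0 q * (√(a ^ 2 + b ^ 2))⁻¹ *
        (√((multiIndices N q).card) * M + √((multiIndices N q).card) * M) =
        resolventConst N c C 0 q * (2 * √((multiIndices N q).card)) * (√(a ^ 2 + b ^ 2))⁻¹ * M := by
      ring
    rw [h4] at h3
    exact ⟨fun α hα e => (hd.dualBound h3.1.1 α hα e).trans
        (mul_le_mul_of_nonneg_right h3.1.2 (norm_nonneg _)),
      fun α hα e => (hd.dualBound h3.2.1 α hα e).trans
        (mul_le_mul_of_nonneg_right h3.2.2 (norm_nonneg _))⟩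

/-- The bounds for the semigroup in Sobolev spaces. -/
theorem IsSymmFamily.exists_sobolev_semigroup_bound (𝕜 : Type*) [RCLike 𝕜] [InnerProductSpace 𝕜 D]
    [IsScalarTower ℝ 𝕜 D] [InnerProductSpace 𝕜 H] [IsScalarTower ℝ 𝕜 H]
    (h : IsSymmFamily law ℓ ι B c C) (hd : HasDensity law μ p) (hq : q ≤ ℓ)
    {T : ℝ≥0 → Lp H 2 μ →L[ℝ] Lp H 2 μ} (hT : GeneratesNeg (symbolGraph μ ι (B [])) T) :
    ∃ K ≥ (0 : ℝ), ∀ f : Lp H 2 μ, MemSobolev 𝕜 law μ q f →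
      (∀ t, MemSobolev 𝕜 law μ q (T t f) ∧
        sobolevNorm 𝕜 law μ q (T t f) ≤ K * sobolevNorm 𝕜 law μ q f) ∧
      ∀ τ : ℝ≥0, 0 < τ → ∃ g, (T τ f, g) ∈ symbolGraph μ ι (B []) ∧
        MemSobolev 𝕜 law μ q ((τ : ℝ) • g : Lp H 2 μ) ∧
        sobolevNorm 𝕜 law μ q ((τ : ℝ) • g : Lp H 2 μ) ≤ K * sobolevNorm 𝕜 law μ q f := by
  have hmax := h.isMaxMonotone hd
  have hex : ∀ a b : ℝ, 0 < a → ∀ F, ∃ U, IsShift (symbolGraph μ ι (B [])) a b U F :=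
    fun a b ha F => h.exists_shift hd le_rfl one_pos (by simpa using ha.le) F
  have hS := h.resolventBound_dualBound 𝕜 hd hq
  set k := resolventConst N c C 0 q * (2 * √((multiIndices N q).card)) with hk
  have hk0 : 0 ≤ k := hS.nonneg
  set s := √((multiIndices N q).card)
  -- The summands serve t = 0, where Fourier inversion says nothing, then T(t) for t > 0, then τ A
  -- T(τ).
  refine ⟨1 + s * (Real.exp 1 * k ^ 2) + s * (2 * Real.exp 1 * (k ^ 2 + k ^ 3) * k), by positivity,
    fun f hf => ⟨fun t => ?_, fun τ hτ => ?_⟩⟩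
  · have hn := sobolevNorm_nonneg (𝕜 := 𝕜) (law := law) (μ := μ) (q := q) (f := f)
    rcases eq_or_ne t 0 with rfl | ht
    · rw [hT.map_zero]
      refine ⟨hf, le_mul_of_one_le_left hn ?_⟩
      rw [add_assoc]
      exact le_add_of_nonneg_right (by positivity)
    · have hdb : hd.DualBound q (T t f) (Real.exp 1 * k ^ 2 * sobolevNorm 𝕜 law μ q f) :=
        fun α hα e => hS.abs_inner_le hmax hT hex (fun g M _ hg => hg α hα e) hn
          (hd.dualBound hf) (pos_iff_ne_zero.2 ht)
      have hm := hdb.memSobolev (𝕜 := 𝕜) (by positivity)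
      refine ⟨hm.1, hm.2.trans ?_⟩
      have h1 : s * (Real.exp 1 * k ^ 2 * sobolevNorm 𝕜 law μ q f) =
        s * (Real.exp 1 * k ^ 2) * sobolevNorm 𝕜 law μ q f := by ring
      rw [h1]
      refine mul_le_mul_of_nonneg_right ?_ hn
      have : 0 ≤ s * (2 * Real.exp 1 * (k ^ 2 + k ^ 3) * k) := by positivity
      linarith
  · have hn := sobolevNorm_nonneg (𝕜 := 𝕜) (law := law) (μ := μ) (q := q) (f := f)
    obtain ⟨g, hg, hgb⟩ := hT.exists_smoothing hmax hex (h.resolventBound_norm hd) hτ f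
    have hdb : hd.DualBound q ((τ : ℝ) • g)
        (2 * Real.exp 1 * (k ^ 2 + k ^ 3) * (k * sobolevNorm 𝕜 law μ q f)) := by
      intro α hα e
      rw [real_inner_smul_right, abs_mul, abs_of_nonneg (NNReal.coe_nonneg τ)]
      exact hgb _ k hS _ hn (hd.dualBound hf) _ _ fun g M _ hg => hg α hα e
    have hm := hdb.memSobolev (𝕜 := 𝕜) (by positivity)
    refine ⟨g, hg, hm.1, hm.2.trans ?_⟩
    have h1 : s * (2 * Real.exp 1 * (k ^ 2 + k ^ 3) * (k * sobolevNorm 𝕜 law μ q f)) =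
      s * (2 * Real.exp 1 * (k ^ 2 + k ^ 3) * k) * sobolevNorm 𝕜 law μ q f := by ring
    rw [h1]
    refine mul_le_mul_of_nonneg_right ?_ hn
    have : 0 ≤ s * (Real.exp 1 * k ^ 2) := by positivity
    linarith

end SobolevBounds

/-! ### The curve -/

/-- An argument of modulus at most η has cosine at least cos η, that is, Re λ ≥ -δ|λ| with δ = -cos
η. -/
theorem polar_bounds {η ρ φ : ℝ} (hη : η ≤ Real.pi) (hρ : 0 < ρ) (hφ : |φ| ≤ η) {l : ℂ}
    (hl : l = ρ * Complex.exp (φ * Complex.I)) :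
    0 < √(l.re ^ 2 + l.im ^ 2) ∧ -(-Real.cos η * √(l.re ^ 2 + l.im ^ 2)) ≤ l.re := by
  have hre : l.re = ρ * Real.cos φ := by
    rw [hl, Complex.re_ofReal_mul, Complex.exp_ofReal_mul_I_re]
  have him : l.im = ρ * Real.sin φ := by
    rw [hl, Complex.im_ofReal_mul, Complex.exp_ofReal_mul_I_im]
  have hs : √(l.re ^ 2 + l.im ^ 2) = ρ := by
    rw [hre, him, mul_pow, mul_pow, ← mul_add, Real.cos_sq_add_sin_sq, mul_one,
      Real.sqrt_sq hρ.le]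
  rw [hs]
  refine ⟨hρ, ?_⟩
  have hc := Real.cos_le_cos_of_nonneg_of_le_pi (abs_nonneg φ) hη hφ
  rw [Real.cos_abs] at hc
  rw [hre]
  nlinarith

theorem gammaCurve_bounds {η r : ℝ} (hη : η ∈ Ioo (Real.pi / 2) Real.pi) (hr : 0 < r) {l : ℂ}
    (hl : l ∈ gammaCurve η r) :
    0 < √(l.re ^ 2 + l.im ^ 2) ∧ -(-Real.cos η * √(l.re ^ 2 + l.im ^ 2)) ≤ l.re := by
  have hη0 : 0 ≤ η := by linarith [hη.1, Real.pi_pos]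
  rcases hl with (⟨s, hs, rfl⟩ | ⟨φ, hφ, rfl⟩) | ⟨s, hs, rfl⟩
  · refine polar_bounds (ρ := -s) (φ := -η) hη.2.le ?_ (by rw [abs_neg, abs_of_nonneg hη0]) ?_
    · have : s < -r := hs
      linarith
    · push_cast; rfl
  · exact polar_bounds hη.2.le hr (abs_lt.2 hφ).le rfl
  · exact polar_bounds hη.2.le (hr.trans hs) (abs_of_nonneg hη0).le rfl

theorem neg_cos_mem {η : ℝ} (hη : η ∈ Ioo (Real.pi / 2) Real.pi) :
    0 ≤ -Real.cos η ∧ -Real.cos η < 1 := by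
  have h1 := Real.cos_neg_of_pi_div_two_lt_of_lt hη.1 (by linarith [hη.2, Real.pi_pos])
  have h2 := Real.cos_lt_cos_of_nonneg_of_le_pi (by linarith [hη.1, Real.pi_pos]) le_rfl hη.2
  rw [Real.cos_pi] at h2
  exact ⟨by linarith, by linarith⟩

/-! ### Operators and their graphs -/

section Graphs

variable {𝕜 : Type*} [RCLike 𝕜] {H : Type*} [NormedAddCommGroup H] [InnerProductSpace 𝕜 H]

theorem exists_apply_eq_of_mem_graph {A : H →ₗ.[𝕜] H} {x y : H} (h : (x, y) ∈ A.graph) :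
    ∃ hx : x ∈ A.domain, A ⟨x, hx⟩ = y := by
  obtain ⟨⟨u, hu⟩, rfl, h2⟩ := LinearPMap.mem_graph_iff A |>.1 h
  exact ⟨hu, h2⟩

theorem mem_graph_of_eq {A : H →ₗ.[𝕜] H} {u : A.domain} {y : H} (h : A u = y) :
    ((u : H), y) ∈ A.graph := by
  rw [← h]
  exact A.mem_graph u

theorem mem_neg_graph_iff {A : H →ₗ.[𝕜] H} {x y : H} :
    (x, y) ∈ (-A).graph ↔ (x, -y) ∈ A.graph := by
  simp only [LinearPMap.mem_graph_iff]
  constructor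
  · rintro ⟨u, h1, h2⟩
    exact ⟨u, h1, by rw [← h2]; exact (neg_neg _).symm⟩
  · rintro ⟨u, h1, h2⟩
    exact ⟨u, h1, (neg_eq_iff_eq_neg.2 h2)⟩

theorem mem_randomOperator_graph {E : Type*} [MeasurableSpace E] {μ : Measure E}
    {A : E → H →ₗ.[𝕜] H} (p : Lp H 2 μ × Lp H 2 μ) :
    p ∈ (randomOperator μ A).graph ↔ ∀ᵐ z ∂μ, (p.1 z, p.2 z) ∈ (A z).graph := by
  rw [randomOperator, Submodule.toLinearPMap_graph_eq]
  · rfl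
  · intro p hp h0
    refine (Lp.eq_zero_iff_ae_eq_zero).2 ?_
    have hp' : ∀ᵐ z ∂μ, (p.1 z, p.2 z) ∈ (A z).graph := hp
    filter_upwards [hp', (Lp.eq_zero_iff_ae_eq_zero).1 h0] with z hz hz0
    exact LinearPMap.graph_fst_eq_zero_snd _ hz hz0

end Graphs

/-! ### Real and complex scalars -/

section ScalarShift

variable {𝕜 : Type*} [RCLike 𝕜] {𝓗 : Type*} [NormedAddCommGroup 𝓗] [InnerProductSpace 𝕜 𝓗]
  [InnerProductSpace ℝ 𝓗] [IsScalarTower ℝ 𝕜 𝓗] {A : 𝓗 →ₗ.[𝕜] 𝓗} {Γ : Submodule ℝ (𝓗 × 𝓗)}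

theorem isShift_iff_complexShiftEq (hgr : ∀ x y, (x, y) ∈ A.graph ↔ (x, y) ∈ Γ) {l : ℂ}
    {u : A.domain × A.domain} {f : 𝓗 × 𝓗} :
    IsShift Γ l.re l.im ((u.1 : 𝓗), (u.2 : 𝓗)) f ↔ ComplexShiftEq A l u f := by
  simp only [IsShift, ComplexShiftEq, ← hgr, RCLike.real_smul_eq_coe_smul (K := 𝕜)]
  refine and_congr ⟨fun h => ?_, fun h => mem_graph_of_eq ?_⟩
    ⟨fun h => ?_, fun h => mem_graph_of_eq ?_⟩
  · obtain ⟨_, h⟩ := exists_apply_eq_of_mem_graph h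
    rw [h]; abel
  · rw [← h]; abel
  · obtain ⟨_, h⟩ := exists_apply_eq_of_mem_graph h
    rw [h]; abel
  · rw [← h]; abel

theorem exists_eq_of_isShift (hgr : ∀ x y, (x, y) ∈ A.graph ↔ (x, y) ∈ Γ) {a b : ℝ}
    {U F : 𝓗 × 𝓗} (hU : IsShift Γ a b U F) :
    ∃ u : A.domain × A.domain, ((u.1 : 𝓗), (u.2 : 𝓗)) = U := by
  obtain ⟨h1, -⟩ := exists_apply_eq_of_mem_graph ((hgr _ _).2 hU.1)
  obtain ⟨h2, -⟩ := exists_apply_eq_of_mem_graph ((hgr _ _).2 hU.2)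
  exact ⟨(⟨U.1, h1⟩, ⟨U.2, h2⟩), rfl⟩

/-- Valid for both fields: if `I = 0`, the imaginary part vanishes. -/
theorem im_mul_I_mul_I (l : 𝕜) :
    (RCLike.im l : 𝕜) * (RCLike.I : 𝕜) * (RCLike.I : 𝕜) = -(RCLike.im l : 𝕜) := by
  rcases RCLike.I_mul_I (K := 𝕜) with h | h
  · rw [RCLike.im_eq_zero h]; simp
  · rw [mul_assoc, h, mul_neg_one]

/-- In the complexification, the vectors u + i(-I u) are those on which the given `I` acts as the
new i. There the scalar equation and the complexified equation coincide; if `I = 0` the pair is (u,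
0). -/
theorem isShift_of_scalar (hgr : ∀ x y, (x, y) ∈ A.graph ↔ (x, y) ∈ Γ) {l : 𝕜} {u : A.domain}
    {f : 𝓗} (hu : l • (u : 𝓗) + A u = f) :
    IsShift Γ (RCLike.re l) (RCLike.im l) ((u : 𝓗), -(RCLike.I : 𝕜) • (u : 𝓗))
      (f, -(RCLike.I : 𝕜) • f) := by
  have h0 : ((u : 𝓗), f - l • (u : 𝓗)) ∈ A.graph := mem_graph_of_eq (by rw [← hu]; abel)
  have hl := RCLike.re_add_im l
  have hI := im_mul_I_mul_I l
  simp only [IsShift, ← hgr, RCLike.real_smul_eq_coe_smul (K := 𝕜)]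
  constructor
  · convert h0 using 2
    nth_rewrite 3 [← hl]
    module
  · convert A.graph.smul_mem (-(RCLike.I : 𝕜)) h0 using 1
    refine Prod.ext rfl ?_
    change -(RCLike.I : 𝕜) • f - (RCLike.im l : 𝕜) • (u : 𝓗) -
      (RCLike.re l : 𝕜) • (-(RCLike.I : 𝕜) • (u : 𝓗)) = -(RCLike.I : 𝕜) • (f - l • (u : 𝓗))
    have h1 : (RCLike.im l : 𝕜) • (u : 𝓗) =
        -(((RCLike.im l : 𝕜) * (RCLike.I : 𝕜) * (RCLike.I : 𝕜)) • (u : 𝓗)) := by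
      rw [hI, neg_smul, neg_neg]
    rw [h1]
    nth_rewrite 3 [← hl]
    module

/-- The map (x, y) ↦ x + I y leads back from the complexification and intertwines the new i with
`I`. -/
theorem exists_scalar_of_isShift (hgr : ∀ x y, (x, y) ∈ A.graph ↔ (x, y) ∈ Γ) {l : 𝕜} {f : 𝓗}
    {U : 𝓗 × 𝓗} (hU : IsShift Γ (RCLike.re l) (RCLike.im l) U (f, 0)) :
    ∃ u : A.domain, l • (u : 𝓗) + A u = f := by
  have hl := RCLike.re_add_im l
  have hI := im_mul_I_mul_I l
  simp only [IsShift, ← hgr, RCLike.real_smul_eq_coe_smul (K := 𝕜)] at hU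
  obtain ⟨hx, he⟩ := exists_apply_eq_of_mem_graph
    (A.graph.add_mem hU.1 (A.graph.smul_mem (RCLike.I : 𝕜) hU.2))
  refine ⟨⟨_, hx⟩, ?_⟩
  rw [he]
  have h1 : (RCLike.im l : 𝕜) • U.2 =
      -(((RCLike.im l : 𝕜) * (RCLike.I : 𝕜) * (RCLike.I : 𝕜)) • U.2) := by
    rw [hI, neg_smul, neg_neg]
  have h2 : l • (U.1 + (RCLike.I : 𝕜) • U.2) =
      ((RCLike.re l : 𝕜) + (RCLike.im l : 𝕜) * (RCLike.I : 𝕜)) • (U.1 + (RCLike.I : 𝕜) • U.2) := by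
    rw [hl]
  change l • (U.1 + (RCLike.I : 𝕜) • U.2) + (f - (RCLike.re l : 𝕜) • U.1 + (RCLike.im l : 𝕜) • U.2 +
    (RCLike.I : 𝕜) • (0 - (RCLike.im l : 𝕜) • U.1 - (RCLike.re l : 𝕜) • U.2)) = f
  rw [h1, h2]
  module

/-- Generation of a semigroup in terms of the underlying real Hilbert space. -/
theorem Generates.generatesNeg (hgr : ∀ x y, (x, y) ∈ A.graph ↔ (x, y) ∈ Γ)
    {T : ℝ≥0 → 𝓗 →L[𝕜] 𝓗} (hT : Generates (-A) T) :
    GeneratesNeg Γ fun t => (T t).restrictScalars ℝ where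
  map_zero x := by simp [hT.1.map_zero]
  map_add s t x := by simp [hT.1.map_add]
  continuous x := hT.1.continuous x
  mem_iff x y := by
    rw [← hgr]
    have := hT.2 x (-y)
    rw [mem_neg_graph_iff, neg_neg] at this
    simp only [RCLike.real_smul_eq_coe_smul (K := 𝕜)]
    exact this

/-- The real semigroup commutes with every bounded operator that preserves the graph, in particular
with multiplication by scalars of `𝕜`. This makes it `𝕜`-linear. -/
theorem IsMaxMonotone.exists_generates (hΓ : IsMaxMonotone Γ) [CompleteSpace 𝓗]
    (hgr : ∀ x y, (x, y) ∈ A.graph ↔ (x, y) ∈ Γ) :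
    ∃ T : ℝ≥0 → 𝓗 →L[𝕜] 𝓗, Generates (-A) T := by
  obtain ⟨T, hT, hTS⟩ := hΓ.exists_generatesNeg
  have hsm : ∀ t (k : 𝕜) x, T t (k • x) = k • T t x := fun t k x =>
    (hTS ((k • ContinuousLinearMap.id 𝕜 𝓗).restrictScalars ℝ) (fun x y hxy => by
      rw [← hgr] at hxy ⊢
      exact A.graph.smul_mem k hxy) t x).symm
  refine ⟨fun t => { T t with map_smul' := hsm t }, ⟨?_, ?_, hT.continuous⟩, fun x y => ?_⟩
  · ext x
    exact hT.map_zero x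
  · intro s t
    ext x
    exact hT.map_add s t x
  · rw [mem_neg_graph_iff, hgr, hT.mem_iff, neg_neg]
    simp only [RCLike.real_smul_eq_coe_smul (K := 𝕜)]
    rfl

end ScalarShift

theorem norm_neg_I_le {𝕜 : Type*} [RCLike 𝕜] : ‖-(RCLike.I : 𝕜)‖ ≤ 1 := by
  rw [norm_neg]
  by_cases h : (RCLike.I : 𝕜) = 0
  · rw [h, norm_zero]; exact zero_le_one
  · exact (RCLike.norm_I_of_ne_zero h).le

/-! ### The estimates for the operator over the original scalar field -/

section Realization

variable {𝕜 : Type*} [RCLike 𝕜] {N : ℕ} {D H : Type*}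
  [NormedAddCommGroup D] [InnerProductSpace 𝕜 D] [InnerProductSpace ℝ D] [IsScalarTower ℝ 𝕜 D]
  [CompleteSpace D] [TopologicalSpace.SeparableSpace D]
  [NormedAddCommGroup H] [InnerProductSpace 𝕜 H] [InnerProductSpace ℝ H] [IsScalarTower ℝ 𝕜 H]
  [CompleteSpace H] [TopologicalSpace.SeparableSpace H]
  {law : Fin N → NoiseLaw} {ℓ : ℕ} {ι : D →L[𝕜] H}
  {B : List (Fin N) → (Fin N → ℝ) → D →L[ℝ] H} {c C : ℝ} {μ : Measure (Fin N → ℝ)}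
  {p : (Fin N → ℝ) → ℝ} {q : ℕ} {A : Lp H 2 μ →ₗ.[𝕜] Lp H 2 μ}

theorem compLpL_eq_of_ae {w : Lp D 2 μ} {x : Lp H 2 μ} (hw : ∀ᵐ z ∂μ, ι (w z) = x z) :
    ι.compLpL 2 μ w = x := by
  refine Lp.ext ?_
  filter_upwards [ι.coeFn_compLpL w, hw] with z h1 h2
  rw [h1, h2]

theorem MemSobolev.smul (hd : HasDensity law μ p) {f : Lp H 2 μ}
    (hf : MemSobolev 𝕜 law μ q f) {k : 𝕜} (hk : ‖k‖ ≤ 1) :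
    MemSobolev 𝕜 law μ q (k • f : Lp H 2 μ) ∧ sobolevNorm 𝕜 law μ q (k • f : Lp H 2 μ) ≤
      √((multiIndices N q).card) * sobolevNorm 𝕜 law μ q f := by
  have hμ := hd.absolutelyContinuous
  obtain ⟨F, hF, hF0⟩ := hf.exists_sobolevJet hμ
  refine (hF.clm_comp ((k • ContinuousLinearMap.id 𝕜 H).restrictScalars ℝ) fun x => ?_).memSobolev
    hμ (sobolevNorm_nonneg ..) ?_
  · change ‖k • x‖ ≤ ‖x‖
    rw [norm_smul]
    exact mul_le_of_le_one_left (norm_nonneg x) hk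
  · have hk' : ∀ᵐ z ∂volume.restrict (box law), (k • f : Lp H 2 μ) z = k • f z :=
      hd.absolutelyContinuous'.ae_le (Lp.coeFn_smul k f)
    filter_upwards [hF0, hk'] with z h1 h2
    rw [h2, ← h1]
    rfl

theorem IsSymmFamily.mem_domain (h : IsSymmFamily law ℓ (ι.restrictScalars ℝ) B c C)
    (hd : HasDensity law μ p)
    (hgr : ∀ x y, (x, y) ∈ A.graph ↔ (x, y) ∈ symbolGraph μ (ι.restrictScalars ℝ) (B []))
    (f : Lp D 2 μ) : ∃ hf : ι.compLpL 2 μ f ∈ A.domain,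
      ‖A ⟨ι.compLpL 2 μ f, hf⟩‖ ≤ C * ‖f‖ ∧ ∀ q ≤ ℓ, MemSobolev 𝕜 law μ q f →
        MemSobolev 𝕜 law μ q (A ⟨ι.compLpL 2 μ f, hf⟩) ∧
        sobolevNorm 𝕜 law μ q (A ⟨ι.compLpL 2 μ f, hf⟩) ≤
          √((multiIndices N q).card) * (2 ^ q * C) * sobolevNorm 𝕜 law μ q f := by
  obtain ⟨g, hg, hgz, hgn⟩ := h.exists_mem_symbolGraph hd f
  have he : (ι.restrictScalars ℝ).compLpL 2 μ f = ι.compLpL 2 μ f := by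
    refine (compLpL_eq_of_ae ?_).symm
    filter_upwards [(ι.restrictScalars ℝ).coeFn_compLpL f] with z hz
    rw [hz]; rfl
  rw [he, ← hgr] at hg
  obtain ⟨hf, hA⟩ := exists_apply_eq_of_mem_graph hg
  refine ⟨hf, by rwa [hA], fun q hq hfq => ?_⟩
  rw [hA]
  have := h.sobolev_apply hd hq hgz hfq
  refine ⟨this.1, this.2.trans (le_of_eq ?_)⟩
  ring

theorem IsSymmFamily.existsUnique_complexShift
    (h : IsSymmFamily law ℓ (ι.restrictScalars ℝ) B c C) (hd : HasDensity law μ p)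
    (hgr : ∀ x y, (x, y) ∈ A.graph ↔ (x, y) ∈ symbolGraph μ (ι.restrictScalars ℝ) (B []))
    {η r : ℝ} (hη : η ∈ Ioo (Real.pi / 2) Real.pi) (hr : 0 < r) {l : ℂ} (hl : l ∈ gammaCurve η r)
    (f : Lp H 2 μ × Lp H 2 μ) :
    ∃! u : A.domain × A.domain, ComplexShiftEq A l u f := by
  obtain ⟨hab, ha⟩ := gammaCurve_bounds hη hr hl
  obtain ⟨hδ, hδ1⟩ := neg_cos_mem hη
  obtain ⟨U, hU⟩ := h.exists_shift hd hδ hδ1 ha f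
  obtain ⟨u, rfl⟩ := exists_eq_of_isShift hgr hU
  refine ⟨u, (isShift_iff_complexShiftEq hgr).1 hU, fun v hv => ?_⟩
  have := h.shift_unique hd hδ hδ1 ha hab ((isShift_iff_complexShiftEq hgr).2 hv) hU
  exact Prod.ext (Subtype.ext (congrArg Prod.fst this)) (Subtype.ext (congrArg Prod.snd this))

theorem IsSymmFamily.complexShift_bound
    (h : IsSymmFamily law ℓ (ι.restrictScalars ℝ) B c C) (hd : HasDensity law μ p)
    (hgr : ∀ x y, (x, y) ∈ A.graph ↔ (x, y) ∈ symbolGraph μ (ι.restrictScalars ℝ) (B []))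
    {η r : ℝ} (hη : η ∈ Ioo (Real.pi / 2) Real.pi) (hr : 0 < r) (hq : q ≤ ℓ) :
    ∃ K ≥ (0 : ℝ), ∀ l ∈ gammaCurve η r, ∀ f : Lp H 2 μ × Lp H 2 μ,
      MemSobolev 𝕜 law μ q f.1 → MemSobolev 𝕜 law μ q f.2 →
      ∀ u : A.domain × A.domain, ComplexShiftEq A l u f →
        ∃ w₁ w₂ : Lp D 2 μ, ι.compLpL 2 μ w₁ = (u.1 : Lp H 2 μ) ∧
          ι.compLpL 2 μ w₂ = (u.2 : Lp H 2 μ) ∧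
          MemSobolev 𝕜 law μ q w₁ ∧ MemSobolev 𝕜 law μ q w₂ ∧
          √(sobolevNorm 𝕜 law μ q w₁ ^ 2 + sobolevNorm 𝕜 law μ q w₂ ^ 2) ≤
            K * √(sobolevNorm 𝕜 law μ q f.1 ^ 2 + sobolevNorm 𝕜 law μ q f.2 ^ 2) := by
  obtain ⟨hδ, hδ1⟩ := neg_cos_mem hη
  have hR : 0 ≤ resolventConst N c C (-Real.cos η) q * c⁻¹ :=
    mul_nonneg (h.resolventConst_nonneg hδ1) (inv_nonneg.2 h.pos.le)
  -- The inner factor 2 passes from the Euclidean norm of the data to the sum of the two norms, the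
  -- outer one adds up the two components of the solution.
  refine ⟨2 * (resolventConst N c C (-Real.cos η) q * c⁻¹ * 2), by positivity,
    fun l hl f h1 h2 u hu => ?_⟩
  obtain ⟨hab, ha⟩ := gammaCurve_bounds hη hr hl
  have hM : sobolevNorm 𝕜 law μ q f.1 + sobolevNorm 𝕜 law μ q f.2 ≤
      2 * √(sobolevNorm 𝕜 law μ q f.1 ^ 2 + sobolevNorm 𝕜 law μ q f.2 ^ 2) := by
    have e1 : sobolevNorm 𝕜 law μ q f.1 ≤
        √(sobolevNorm 𝕜 law μ q f.1 ^ 2 + sobolevNorm 𝕜 law μ q f.2 ^ 2) :=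
      Real.le_sqrt_of_sq_le (le_add_of_nonneg_right (sq_nonneg _))
    have e2 : sobolevNorm 𝕜 law μ q f.2 ≤
        √(sobolevNorm 𝕜 law μ q f.1 ^ 2 + sobolevNorm 𝕜 law μ q f.2 ^ 2) :=
      Real.le_sqrt_of_sq_le (le_add_of_nonneg_left (sq_nonneg _))
    linarith
  obtain ⟨⟨w₁, w₂, e1, e2, m1, m2⟩, -⟩ := h.sobolev_shift hd hδ hδ1 ha hab hq
    ((isShift_iff_complexShiftEq hgr).2 hu) h1 h2 hM
  refine ⟨w₁, w₂, compLpL_eq_of_ae e1, compLpL_eq_of_ae e2, m1.1, m2.1, ?_⟩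
  have n1 := sobolevNorm_nonneg (𝕜 := 𝕜) (law := law) (μ := μ) (q := q) (f := w₁)
  have n2 := sobolevNorm_nonneg (𝕜 := 𝕜) (law := law) (μ := μ) (q := q) (f := w₂)
  have e3 : √(sobolevNorm 𝕜 law μ q w₁ ^ 2 + sobolevNorm 𝕜 law μ q w₂ ^ 2) ≤
      sobolevNorm 𝕜 law μ q w₁ + sobolevNorm 𝕜 law μ q w₂ := by
    rw [Real.sqrt_le_left (add_nonneg n1 n2)]
    nlinarith
  refine e3.trans ((add_le_add m1.2 m2.2).trans (le_of_eq ?_))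
  ring

theorem IsSymmFamily.shiftBijective
    (h : IsSymmFamily law ℓ (ι.restrictScalars ℝ) B c C) (hd : HasDensity law μ p)
    (hgr : ∀ x y, (x, y) ∈ A.graph ↔ (x, y) ∈ symbolGraph μ (ι.restrictScalars ℝ) (B []))
    {η r : ℝ} (hη : η ∈ Ioo (Real.pi / 2) Real.pi) (hr : 0 < r) {l : 𝕜}
    (hl : (⟨RCLike.re l, RCLike.im l⟩ : ℂ) ∈ gammaCurve η r) : ShiftBijective A l := by
  obtain ⟨hab, ha⟩ := gammaCurve_bounds hη hr hl
  obtain ⟨hδ, hδ1⟩ := neg_cos_mem hη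
  refine ⟨fun u v huv => ?_, fun f => ?_⟩
  · have := h.shift_unique hd hδ hδ1 ha hab (isShift_of_scalar hgr huv) (isShift_of_scalar hgr rfl)
    exact Subtype.ext (congrArg Prod.fst this)
  · obtain ⟨U, hU⟩ := h.exists_shift hd hδ hδ1 ha (f, 0)
    exact exists_scalar_of_isShift hgr hU

theorem IsSymmFamily.shift_bound
    (h : IsSymmFamily law ℓ (ι.restrictScalars ℝ) B c C) (hd : HasDensity law μ p)
    (hgr : ∀ x y, (x, y) ∈ A.graph ↔ (x, y) ∈ symbolGraph μ (ι.restrictScalars ℝ) (B []))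
    {η r : ℝ} (hη : η ∈ Ioo (Real.pi / 2) Real.pi) (hr : 0 < r) (hq : q ≤ ℓ) :
    ∃ K ≥ (0 : ℝ), ∀ l : 𝕜, (⟨RCLike.re l, RCLike.im l⟩ : ℂ) ∈ gammaCurve η r →
      ∀ f : Lp H 2 μ, MemSobolev 𝕜 law μ q f → ∀ u : A.domain, l • (u : Lp H 2 μ) + A u = f →
        ∃ w : Lp D 2 μ, ι.compLpL 2 μ w = (u : Lp H 2 μ) ∧ MemSobolev 𝕜 law μ q w ∧
          sobolevNorm 𝕜 law μ q w ≤ K * sobolevNorm 𝕜 law μ q f := by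
  obtain ⟨hδ, hδ1⟩ := neg_cos_mem hη
  have hR : 0 ≤ resolventConst N c C (-Real.cos η) q * c⁻¹ :=
    mul_nonneg (h.resolventConst_nonneg hδ1) (inv_nonneg.2 h.pos.le)
  -- The data of the complexified equation are (f, -I f), and the norm of the second component is
  -- bounded through `MemSobolev.smul`.
  refine ⟨resolventConst N c C (-Real.cos η) q * c⁻¹ * (1 + √((multiIndices N q).card)),
    by positivity, fun l hl f hf u hu => ?_⟩
  obtain ⟨hab, ha⟩ := gammaCurve_bounds hη hr hl
  have hf' := hf.smul hd norm_neg_I_le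
  obtain ⟨⟨w, -, e, -, m, -⟩, -⟩ := h.sobolev_shift hd hδ hδ1 ha hab hq (isShift_of_scalar hgr hu)
    hf hf'.1 (add_le_add le_rfl hf'.2)
  refine ⟨w, compLpL_eq_of_ae e, m.1, m.2.trans (le_of_eq ?_)⟩
  ring

theorem IsSymmFamily.shift_norm_bound
    (h : IsSymmFamily law ℓ (ι.restrictScalars ℝ) B c C) (hd : HasDensity law μ p)
    (hgr : ∀ x y, (x, y) ∈ A.graph ↔ (x, y) ∈ symbolGraph μ (ι.restrictScalars ℝ) (B []))
    {η r : ℝ} (hη : η ∈ Ioo (Real.pi / 2) Real.pi) (hr : 0 < r) :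
    ∃ K ≥ (0 : ℝ), ∀ l : 𝕜, (⟨RCLike.re l, RCLike.im l⟩ : ℂ) ∈ gammaCurve η r →
      ∀ (f : Lp H 2 μ) (u : A.domain), l • (u : Lp H 2 μ) + A u = f →
        ∃ w : Lp D 2 μ, ι.compLpL 2 μ w = (u : Lp H 2 μ) ∧ ‖w‖ ≤ K * ‖f‖ := by
  obtain ⟨hδ, hδ1⟩ := neg_cos_mem hη
  have hc := h.pos
  refine ⟨(√(1 - -Real.cos η) * c)⁻¹ * 2, by positivity, fun l hl f u hu => ?_⟩
  obtain ⟨hab, ha⟩ := gammaCurve_bounds hη hr hl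
  obtain ⟨⟨w, -, e, -, m, -⟩, -⟩ := h.norm_shift_le hd hδ hδ1 ha hab (isShift_of_scalar hgr hu)
  refine ⟨w, compLpL_eq_of_ae e, m.trans ?_⟩
  rw [mul_assoc]
  refine mul_le_mul_of_nonneg_left ?_ (by positivity)
  have : ‖-(RCLike.I : 𝕜) • f‖ ≤ ‖f‖ := by
    rw [norm_smul]
    exact mul_le_of_le_one_left (norm_nonneg f) norm_neg_I_le
  linarith

theorem IsSymmFamily.semigroup_bound [IsFiniteMeasure μ]
    (h : IsSymmFamily law ℓ (ι.restrictScalars ℝ) B c C) (hd : HasDensity law μ p)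
    (hgr : ∀ x y, (x, y) ∈ A.graph ↔ (x, y) ∈ symbolGraph μ (ι.restrictScalars ℝ) (B []))
    {T : ℝ≥0 → Lp H 2 μ →L[𝕜] Lp H 2 μ} (hT : Generates (-A) T) (hq : q ≤ ℓ) :
    ∃ K ≥ (0 : ℝ), ∀ f : Lp H 2 μ, MemSobolev 𝕜 law μ q f →
      (∀ t, MemSobolev 𝕜 law μ q (T t f) ∧
        sobolevNorm 𝕜 law μ q (T t f) ≤ K * sobolevNorm 𝕜 law μ q f) ∧
      ∀ τ : ℝ≥0, 0 < τ → ∃ hτ : T τ f ∈ A.domain,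
        MemSobolev 𝕜 law μ q (((τ : ℝ) : 𝕜) • A ⟨T τ f, hτ⟩ : Lp H 2 μ) ∧
        sobolevNorm 𝕜 law μ q (((τ : ℝ) : 𝕜) • A ⟨T τ f, hτ⟩ : Lp H 2 μ) ≤
          K * sobolevNorm 𝕜 law μ q f := by
  obtain ⟨K, hK, hb⟩ := h.exists_sobolev_semigroup_bound 𝕜 hd hq (hT.generatesNeg hgr)
  refine ⟨K, hK, fun f hf => ⟨(hb f hf).1, fun τ hτ => ?_⟩⟩
  obtain ⟨g, hg, hm⟩ := (hb f hf).2 τ hτ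
  obtain ⟨hτf, hA⟩ := exists_apply_eq_of_mem_graph ((hgr _ _).2 hg)
  refine ⟨hτf, ?_⟩
  have hA' : A ⟨T τ f, hτf⟩ = g := hA
  rw [hA', ← RCLike.real_smul_eq_coe_smul (K := 𝕜)]
  exact hm

end Realization

/-! ### The joint law of the noise -/

section Law

variable {Ω : Type*} [MeasurableSpace Ω] {P : Measure Ω} [IsProbabilityMeasure P] {N : ℕ}
  {law : Fin N → NoiseLaw} {Z : Ω → Fin N → ℝ}

theorem hasDensity_of_iIndepFun (hZ : Measurable Z)
    (hind : iIndepFun (fun (j : Fin N) (ω : Ω) => Z ω j) P)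
    (hlaw : ∀ j, P.map (fun ω => Z ω j) = (law j).measure) :
    HasDensity law (P.map Z) fun z => ∏ j, (law j).density (z j) := by
  have hm : ∀ j, Measurable fun ω => Z ω j := fun j => (measurable_pi_apply j).comp hZ
  have hfin : ∀ j, IsFiniteMeasure (law j).measure := fun j => by
    rw [← hlaw j]
    infer_instance
  have h1 := (iIndepFun_iff_map_fun_eq_pi_map fun j => (hm j).aemeasurable).1 hind
  simp only [hlaw] at h1
  have h2 : P.map Z = Measure.pi fun j => (law j).measure := h1
  rw [h2]
  exact hasDensity_pi law

end Law

end RandomEvolution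

/-! ### The main theorem -/

theorem mainTheorem7 {𝕜 : Type*} [RCLike 𝕜]
    {Ω : Type*} [MeasurableSpace Ω] (P : Measure Ω) [IsProbabilityMeasure P]
    {N : ℕ} (law : Fin N → RandomEvolution.NoiseLaw) (Z : Ω → Fin N → ℝ) (hZ : Measurable Z)
    (hind : iIndepFun (fun (j : Fin N) (ω : Ω) => Z ω j) P)
    (hlaw : ∀ j, P.map (fun ω => Z ω j) = (law j).measure)
    (μ : Measure (Fin N → ℝ)) (hμ : μ = P.map Z)
    {H V D : Type*}
    [NormedAddCommGroup H] [InnerProductSpace 𝕜 H] [CompleteSpace H]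
    [TopologicalSpace.SeparableSpace H]
    [NormedAddCommGroup V] [InnerProductSpace 𝕜 V] [CompleteSpace V]
    [TopologicalSpace.SeparableSpace V]
    [NormedAddCommGroup D] [InnerProductSpace 𝕜 D] [CompleteSpace D]
    (ιV : V →L[𝕜] H) (hιV : Function.Injective ιV) (hVdense : DenseRange ιV)
    (ιD : D →L[𝕜] H) (hιD : Function.Injective ιD)
    (a : (Fin N → ℝ) → V →ₗ[𝕜] V →ₗ⋆[𝕜] 𝕜)
    (A : (Fin N → ℝ) → H →ₗ.[𝕜] H) (hA : A = fun z => RandomEvolution.formOperator ιV (a z))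
    (bA : Lp H 2 μ →ₗ.[𝕜] Lp H 2 μ) (hbA : bA = RandomEvolution.randomOperator μ A)
    (hform : RandomEvolution.UniformForms μ a)
    (hdom : RandomEvolution.ConstantDomain μ ιD A)
    (ℓ : ℕ) (hder : RandomEvolution.DerivativeBounds law μ ιV ιD a ℓ) :
    -- (a)
    (∀ q ≤ ℓ, ∃ C ≥ (0 : ℝ), ∀ f : Lp D 2 μ, RandomEvolution.MemSobolev 𝕜 law μ q f →
      ∃ h : ιD.compLpL 2 μ f ∈ bA.domain,
        RandomEvolution.MemSobolev 𝕜 law μ q (bA ⟨ιD.compLpL 2 μ f, h⟩) ∧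
        RandomEvolution.sobolevNorm 𝕜 law μ q (bA ⟨ιD.compLpL 2 μ f, h⟩) ≤
          C * RandomEvolution.sobolevNorm 𝕜 law μ q f) ∧
    (∃ C ≥ (0 : ℝ), ∀ f : Lp D 2 μ, ∃ h : ιD.compLpL 2 μ f ∈ bA.domain,
      ‖bA ⟨ιD.compLpL 2 μ f, h⟩‖ ≤ C * ‖f‖) ∧
    -- (b)
    (∀ η ∈ Ioo (Real.pi / 2) Real.pi, ∀ r > (0 : ℝ),
      -- the resolvent at scalars on the curve
      (∀ l : 𝕜, (⟨RCLike.re l, RCLike.im l⟩ : ℂ) ∈ RandomEvolution.gammaCurve η r →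
        RandomEvolution.ShiftBijective bA l) ∧
      (∀ q ≤ ℓ, ∃ C ≥ (0 : ℝ), ∀ l : 𝕜,
        (⟨RCLike.re l, RCLike.im l⟩ : ℂ) ∈ RandomEvolution.gammaCurve η r →
        ∀ f : Lp H 2 μ, RandomEvolution.MemSobolev 𝕜 law μ q f →
        ∀ u : bA.domain, l • (u : Lp H 2 μ) + bA u = f →
          ∃ w : Lp D 2 μ, ιD.compLpL 2 μ w = (u : Lp H 2 μ) ∧
            RandomEvolution.MemSobolev 𝕜 law μ q w ∧
            RandomEvolution.sobolevNorm 𝕜 law μ q w ≤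
              C * RandomEvolution.sobolevNorm 𝕜 law μ q f) ∧
      (∃ C ≥ (0 : ℝ), ∀ l : 𝕜,
        (⟨RCLike.re l, RCLike.im l⟩ : ℂ) ∈ RandomEvolution.gammaCurve η r →
        ∀ (f : Lp H 2 μ) (u : bA.domain), l • (u : Lp H 2 μ) + bA u = f →
          ∃ w : Lp D 2 μ, ιD.compLpL 2 μ w = (u : Lp H 2 μ) ∧ ‖w‖ ≤ C * ‖f‖) ∧
      -- the complexified resolvent at complex numbers on the curve
      (∀ l ∈ RandomEvolution.gammaCurve η r, ∀ f : Lp H 2 μ × Lp H 2 μ,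
        ∃! u : bA.domain × bA.domain, RandomEvolution.ComplexShiftEq bA l u f) ∧
      (∀ q ≤ ℓ, ∃ C ≥ (0 : ℝ), ∀ l ∈ RandomEvolution.gammaCurve η r, ∀ f : Lp H 2 μ × Lp H 2 μ,
        RandomEvolution.MemSobolev 𝕜 law μ q f.1 → RandomEvolution.MemSobolev 𝕜 law μ q f.2 →
        ∀ u : bA.domain × bA.domain, RandomEvolution.ComplexShiftEq bA l u f →
          ∃ w₁ w₂ : Lp D 2 μ, ιD.compLpL 2 μ w₁ = (u.1 : Lp H 2 μ) ∧
            ιD.compLpL 2 μ w₂ = (u.2 : Lp H 2 μ) ∧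
            RandomEvolution.MemSobolev 𝕜 law μ q w₁ ∧ RandomEvolution.MemSobolev 𝕜 law μ q w₂ ∧
            √(RandomEvolution.sobolevNorm 𝕜 law μ q w₁ ^ 2 +
                RandomEvolution.sobolevNorm 𝕜 law μ q w₂ ^ 2) ≤
              C * √(RandomEvolution.sobolevNorm 𝕜 law μ q f.1 ^ 2 +
                RandomEvolution.sobolevNorm 𝕜 law μ q f.2 ^ 2))) ∧
    -- the semigroup generated by `-𝐀`
    (∃ T : ℝ≥0 → Lp H 2 μ →L[𝕜] Lp H 2 μ, RandomEvolution.Generates (-bA) T) ∧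
    (∀ T : ℝ≥0 → Lp H 2 μ →L[𝕜] Lp H 2 μ, RandomEvolution.Generates (-bA) T →
      ∀ q ≤ ℓ, ∀ Tmax > (0 : ℝ≥0), ∃ C ≥ (0 : ℝ), ∀ f : Lp H 2 μ, RandomEvolution.MemSobolev 𝕜 law μ q f →
        -- (c)
        (∀ t : ℝ≥0, t ≤ Tmax →
          RandomEvolution.MemSobolev 𝕜 law μ q (T t f) ∧
          RandomEvolution.sobolevNorm 𝕜 law μ q (T t f) ≤
            C * RandomEvolution.sobolevNorm 𝕜 law μ q f) ∧
        -- (d)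
        (∀ τ : ℝ≥0, 0 < τ → τ ≤ Tmax → ∃ h : T τ f ∈ bA.domain,
          RandomEvolution.MemSobolev 𝕜 law μ q (((τ : ℝ) : 𝕜) • bA ⟨T τ f, h⟩ : Lp H 2 μ) ∧
          RandomEvolution.sobolevNorm 𝕜 law μ q (((τ : ℝ) : 𝕜) • bA ⟨T τ f, h⟩ : Lp H 2 μ) ≤
            C * RandomEvolution.sobolevNorm 𝕜 law μ q f)) := by
  -- The real inner products induced by the `𝕜`-structures; all preceding estimates are stated for
  -- them.
  let := InnerProductSpace.rclikeToReal 𝕜 H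
  let := InnerProductSpace.rclikeToReal 𝕜 V
  let := InnerProductSpace.rclikeToReal 𝕜 D
  have hH : IsScalarTower ℝ 𝕜 H := inferInstance
  have hV : IsScalarTower ℝ 𝕜 V := inferInstance
  have hD : IsScalarTower ℝ 𝕜 D := inferInstance
  subst hA hbA
  have hd := RandomEvolution.hasDensity_of_iIndepFun hZ hind hlaw
  rw [← hμ] at hd
  have hprob : IsProbabilityMeasure μ := by
    rw [hμ]
    exact Measure.isProbabilityMeasure_map hZ.aemeasurable
  obtain ⟨B, c, C, h, hB, hsep⟩ := RandomEvolution.exists_isSymmFamily hd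
    (IsProbabilityMeasure.ne_zero μ) hιV hVdense hιD hform hdom hder
  -- The graph of the random operator agrees with that of the multiplication operator with symbol `B
  -- []`, because the fibres agree for almost every `z`.
  have hgr : ∀ x y, (x, y) ∈ (RandomEvolution.randomOperator μ
      fun z => RandomEvolution.formOperator ιV (a z)).graph ↔
      (x, y) ∈ RandomEvolution.symbolGraph μ (ιD.restrictScalars ℝ) (B []) := fun x y => by
    rw [RandomEvolution.mem_randomOperator_graph]
    refine eventually_congr ?_
    filter_upwards [hB] with z hz
    exact hz _ _
  have hC := h.nonneg
  refine ⟨fun q hq => ⟨√((RandomEvolution.multiIndices N q).card) * (2 ^ q * C), by positivity,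
      fun f hf => ?_⟩, ⟨C, hC, fun f => ?_⟩, fun η hη r hr => ⟨fun l hl =>
      h.shiftBijective hd hgr hη hr hl, fun q hq => h.shift_bound hd hgr hη hr hq,
      h.shift_norm_bound hd hgr hη hr, fun l hl f => h.existsUnique_complexShift hd hgr hη hr hl f,
      fun q hq => h.complexShift_bound hd hgr hη hr hq⟩,
    (h.isMaxMonotone hd).exists_generates hgr, fun T hT q hq Tmax _ => ?_⟩
  · obtain ⟨hfd, -, hm⟩ := h.mem_domain hd hgr f
    exact ⟨hfd, hm q hq hf⟩
  · obtain ⟨hfd, hn, -⟩ := h.mem_domain hd hgr f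
    exact ⟨hfd, hn⟩
  · obtain ⟨K, hK, hb⟩ := h.semigroup_bound hd hgr hT hq
    exact ⟨K, hK, fun f hf => ⟨fun t _ => (hb f hf).1 t, fun τ hτ _ => (hb f hf).2 τ hτ⟩⟩
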